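/- Let $r,n$ be positive integers with $r\mid n$, let $s\in\mathbb{Z}$ with $\gcd(s,r)=1$, and let $k,l\ge 0$ be integers. Let $\mu_m\subset\mathbb{C}^\times$ be the group of $m$th roots of unity, $W(r,n)=\mu_r^n\rtimes S_n$, acting on $\mathbb{C}^n$ by monomial matrices and hence on $$T(r,n)=\{z\in\mathbb{C}^n \mid z_i\neq 0\ \forall i,\ z_i^r\neq z_j^r\ \forall i\neq j\}.$$ Let $A^\bullet(T(r,n))$ be the Orlik--Solomon algebra, i.e. the algebra of differential forms on $T(r,n)$ generated over $\mathbb{C}$ by $\omega_i=\frac{dz_i}{z_i}$ and $\omega_{i,j,\eta}=\frac{dz_i-\eta\,dz_j}{z_i-\eta z_j}$ for $i\ne j$, $\eta\in\mu_r$; the group $W(r,n)$ acts on it, $g$ acting by pull-back along $g^{-1}$. A decorated directed forest $F$ on $\{1,\dots,n\}$ is a directed forest in which every vertex is a root (out-degree $0$) or has out-degree $1$, with edges labelled by elements of $\mu_r$ and each root declared open or closed. Put $\alpha(F)=\alpha_1(F)\wedge\cdots\wedge\alpha_n(F)$, where $\alpha_i(F)=\omega_i$ if $i$ is a closed root, $\alpha_i(F)=\omega_{i,j,\eta}$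 if there is an edge $i\to j$ labelled $\eta$, and $\alpha_i(F)=(-1)^{i-1-|\{\text{open roots}\,<\,i\}|}$ if $i$ is an open root. Let $A^p(T(r,n))_m$ be the span of all $\alpha(F)$ such that the number of edges plus the number of closed roots of $F$ is $p$ and $F$ has at least $m$ closed roots; this is a $W(r,n)$-stable subspace. Put $A^{k,l}(T(r,n))=A^{k+l}(T(r,n))_l/A^{k+l}(T(r,n))_{l+1}$. For a representation $V$ of $W(r,n)$ let $V_{(s/r)}$ be the representation of $S_n$ on $\{v\in V\mid (\zeta_1,\dots,\zeta_n).v=\zeta_1^{-s}\cdots\zeta_n^{-s}v\ \ \forall (\zeta_i)\in\mu_r^n\}$. Let $\varepsilon_n$ be the sign character of $S_n$. For a partition $\lambda$ let $\ell(\lambda)$ be its number of parts and $m_i(\lambda)$ the number of parts equal to $i$. For each $m$ fix a generator of $\mu_m$ and embed $\mu_m$ in $S_m$ by sending it to the $m$-cycle $(1,2,\dots,m)$. For partitions $\lambda^1,\lambda^2$ with $|\lambda^1|+|\lambda^2|=n/r$ let $$H_{\lambda^1,\lambda^2}=\bigl((\mu_{r\lambda^1_1}\times\cdots\times\mu_{r\lambda^1_{\ell(\lambda^1)}})\rtimes(S_{m_1(\lambda^1)}\times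 S_{m_2(\lambda^1)}\times\cdots)\bigr)\times\bigl((\mu_{r\lambda^2_1}\times\cdots\times\mu_{r\lambda^2_{\ell(\lambda^2)}})\rtimes(S_{m_1(\lambda^2)}\times S_{m_2(\lambda^2)}\times\cdots)\bigr),$$ embedded in $S_n$ by decomposing $\{1,\dots,n\}$ into blocks of sizes $r\lambda^j_a$, letting each $\mu_{r\lambda^j_a}$ act on its block as above and $S_{m_i(\lambda^j)}$ permute the blocks with $\lambda^j_a=i$. Let $\psi$ be the character of $H_{\lambda^1,\lambda^2}$ which takes the product in $\mathbb{C}^\times$ of all the $\mu_{r\lambda^j_a}$ components, and let $\varepsilon$ be the product of the sign characters of the $S_{m_i(\lambda^1)}$ components (those for $\lambda^1$ only). Then, as a representation of $S_n$, $$\varepsilon_n\otimes A^{k,l}(T(r,n))_{(s/r)}\;\cong\bigoplus_{\substack{\lambda^1,\lambda^2\\ |\lambda^1|+|\lambda^2|=n/r\\ \ell(\lambda^1)=n-k-l\\ \ell(\lambda^2)=l}}\mathrm{Ind}_{H_{\lambda^1,\lambda^2}}^{S_n}(\varepsilon\psi).$$ -/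

import Mathlib

open scoped DirectSum TensorProduct

noncomputable section

namespace TwistedTorus

/-! ## The wreath product and the hyperplane complement -/

/-- `S_n` acting on `μ_r^n` by permuting the factors: `(w ζ)_i = ζ_{w⁻¹ i}`. -/
def permTorus (r n : ℕ) : Equiv.Perm (Fin n) →* MulAut (Fin n → rootsOfUnity r ℂ) where
  toFun w :=
    { toFun := fun ζ i => ζ (w⁻¹ i)
      invFun := fun ζ i => ζ (w i)
      left_inv := fun ζ => by ext i; simp
      right_inv := fun ζ => by ext i; simp
      map_mul' := fun _ _ => rfl }
  map_one' := by ext; rfl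
  map_mul' w w' := by ext; simp [mul_inv_rev]

/-- The wreath product `W(r,n) = μ_r ≀ S_n = μ_r^n ⋊ S_n`. -/
abbrev W (r n : ℕ) : Type := (Fin n → rootsOfUnity r ℂ) ⋊[permTorus r n] Equiv.Perm (Fin n)

/-- The standard representation of `W(r,n)` on `ℂ^n`: permutation matrices, and diagonal matrices
with entries in `μ_r`. -/
def stdRep (r n : ℕ) : Representation ℂ (W r n) (Fin n → ℂ) where
  toFun g :=
    { toFun := fun z i => ((g.left i : ℂˣ) : ℂ) * z (g.right⁻¹ i)
      map_add' := fun x y => by ext i; simp [mul_add]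
      map_smul' := fun c x => by ext i; simp [mul_left_comm] }
  map_one' := by ext; simp
  map_mul' g h := by
    apply LinearMap.ext; intro z; ext i
    simp [permTorus, mul_assoc]

/-- The hyperplane complement `T(r,n)`. -/
def T (r n : ℕ) : Set (Fin n → ℂ) :=
  {z | (∀ i, z i ≠ 0) ∧ ∀ i j, i ≠ j → z i ^ r ≠ z j ^ r}

theorem root_pow {r : ℕ} (ζ : rootsOfUnity r ℂ) : ((ζ : ℂˣ) : ℂ) ^ r = 1 := by
  have h := ζ.2
  rw [mem_rootsOfUnity] at h
  simpa using congrArg Units.val h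

theorem stdRep_mem {r n : ℕ} (g : W r n) {z : Fin n → ℂ} (hz : z ∈ T r n) :
    stdRep r n g z ∈ T r n := by
  refine ⟨fun i => mul_ne_zero (Units.ne_zero _) (hz.1 _), fun i j hij => ?_⟩
  simp only [stdRep, MonoidHom.coe_mk, OneHom.coe_mk, LinearMap.coe_mk, AddHom.coe_mk, mul_pow,
    root_pow, one_mul]
  exact hz.2 _ _ (fun h => hij (g.right⁻¹.injective h))

/-! ## Differential forms and the Orlik–Solomon algebra -/

/-- The exterior algebra of the cotangent space `(ℂ^n)^*`. -/
abbrev Cotangent (n : ℕ) : Type := ExteriorAlgebra ℂ (Module.Dual ℂ (Fin n → ℂ))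

/-- Differential forms on `T(r,n)`: since `T(r,n)` is open in `ℂ^n`, its cotangent bundle is
trivial and a form is a function with values in the exterior algebra of `(ℂ^n)^*`; the product is
the pointwise wedge product.  The regular ones form the subalgebra `regularForms`. -/
abbrev Form (r n : ℕ) : Type := T r n → Cotangent n

/-- The constant form `dz_i`. -/
def dz (r n : ℕ) (i : Fin n) : Form r n :=
  fun _ => ExteriorAlgebra.ι ℂ (LinearMap.proj i : (Fin n → ℂ) →ₗ[ℂ] ℂ)

/-- A function on `T(r,n)` as a form of degree `0`. -/
def fn (r n : ℕ) (f : T r n → ℂ) : Form r n := fun z => algebraMap ℂ (Cotangent n) (f z)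

/-- `Ω^•(T(r,n))`, generated by the coordinate functions `z_i`, the inverses of the equations of
the deleted hyperplanes, and the forms `dz_i`. -/
def regularForms (r n : ℕ) : Subalgebra ℂ (Form r n) :=
  Algebra.adjoin ℂ
    (Set.range (fun i => fn r n (fun z => z.1 i)) ∪
      Set.range (fun i => fn r n (fun z => (z.1 i)⁻¹)) ∪
      {x | ∃ (i j : Fin n) (η : rootsOfUnity r ℂ), i ≠ j ∧
        x = fn r n (fun z => (z.1 i - ((η : ℂˣ) : ℂ) * z.1 j)⁻¹)} ∪
      Set.range (dz r n))

/-- `ω_i = dz_i / z_i`. -/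
def omega (r n : ℕ) (i : Fin n) : Form r n := fun z => (z.1 i)⁻¹ • dz r n i z

/-- `ω_{i,j,η} = (dz_i - η dz_j) / (z_i - η z_j)`. -/
def omega₂ (r n : ℕ) (i j : Fin n) (η : rootsOfUnity r ℂ) : Form r n :=
  fun z => (z.1 i - ((η : ℂˣ) : ℂ) * z.1 j)⁻¹ • (dz r n i z - ((η : ℂˣ) : ℂ) • dz r n j z)

/-- The Orlik–Solomon algebra `A^•(T(r,n))`. -/
def osAlgebra (r n : ℕ) : Subalgebra ℂ (Form r n) :=
  Algebra.adjoin ℂ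
    (Set.range (omega r n) ∪ {x | ∃ (i j : Fin n) (η : rootsOfUnity r ℂ), i ≠ j ∧
      x = omega₂ r n i j η})

theorem osAlgebra_le_regularForms (r n : ℕ) : osAlgebra r n ≤ regularForms r n := by
  have hdz : ∀ i, dz r n i ∈ regularForms r n := fun i =>
    Algebra.subset_adjoin (Or.inr ⟨i, rfl⟩)
  refine Algebra.adjoin_le ?_
  rintro x (⟨i, rfl⟩ | ⟨i, j, η, hij, rfl⟩)
  · have h : omega r n i = fn r n (fun z => (z.1 i)⁻¹) * dz r n i := by
      funext z; simp [omega, fn, Algebra.smul_def]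
    rw [h]
    exact mul_mem (Algebra.subset_adjoin (Or.inl (Or.inl (Or.inr ⟨i, rfl⟩)))) (hdz i)
  · have h : omega₂ r n i j η = fn r n (fun z => (z.1 i - ((η : ℂˣ) : ℂ) * z.1 j)⁻¹) *
        (dz r n i - ((η : ℂˣ) : ℂ) • dz r n j) := by
      funext z; simp [omega₂, fn, Algebra.smul_def]
    rw [h]
    exact mul_mem (Algebra.subset_adjoin (Or.inl (Or.inr ⟨i, j, η, hij, rfl⟩)))
      (sub_mem (hdz i) (Subalgebra.smul_mem _ (hdz j) _))

/-- The action of `g ∈ W(r,n)` on forms, i.e. pull-back along the action of `g⁻¹` on `T(r,n)`; so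
`ζ` sends `z_i` to `ζ_i⁻¹ z_i`, and `w` sends `z_i`, `dz_i` to `z_{w(i)}`, `dz_{w(i)}`. -/
def formAct (r n : ℕ) (g : W r n) : Form r n →ₐ[ℂ] Form r n where
  toFun α z := ExteriorAlgebra.map ((stdRep r n).dual g) (α ⟨stdRep r n g⁻¹ z.1, stdRep_mem _ z.2⟩)
  map_one' := by ext; simp
  map_mul' _ _ := by ext; simp
  map_zero' := by ext; simp
  map_add' _ _ := by ext; simp
  commutes' c := by ext z; simp

/-- The representation of `W(r,n)` on differential forms. -/
def formRep (r n : ℕ) : Representation ℂ (W r n) (Form r n) where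
  toFun g := (formAct r n g).toLinearMap
  map_one' := by
    apply LinearMap.ext; intro α; funext z
    change ExteriorAlgebra.map ((stdRep r n).dual 1) _ = α z
    rw [map_one]
    simp only [inv_one, map_one, Module.End.one_apply]
    exact congrArg (fun f => f (α z)) ExteriorAlgebra.map_id
  map_mul' g h := by
    apply LinearMap.ext; intro α; funext z
    change ExteriorAlgebra.map ((stdRep r n).dual (g * h)) _ =
      ExteriorAlgebra.map ((stdRep r n).dual g) (ExteriorAlgebra.map ((stdRep r n).dual h) _)
    rw [map_mul, ← AlgHom.comp_apply, ExteriorAlgebra.map_comp_map]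
    simp only [mul_inv_rev, map_mul, Module.End.mul_apply]
    rfl

/-! ## Decorated directed forests -/

/-- The role of a vertex in a decorated directed forest: an open root, a closed root, or the
start of a (unique) edge with label `η` and end `j`. -/
inductive Kind (r n : ℕ) : Type
  | openRoot : Kind r n
  | closedRoot : Kind r n
  | edge (j : Fin n) (η : rootsOfUnity r ℂ) : Kind r n

/-- Decorated directed forests on the vertex set `Fin n`: every vertex is an open or closed root
(out-degree `0`) or has out-degree `1` with an edge labelled by `μ_r`, and there are no directed
cycles or loops.  As out-degrees are at most `1`, this says that each connected component is a
directed tree. -/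
structure Forest (r n : ℕ) : Type where
  kind : Fin n → Kind r n
  acyclic : ∀ i, ¬ Relation.TransGen (fun a b => ∃ η, kind a = Kind.edge b η) i i

namespace Forest

variable {r n : ℕ}

/-- `i` is an open root. -/
def IsOpenRoot (F : Forest r n) (i : Fin n) : Prop := F.kind i = Kind.openRoot

/-- `i` is a closed root. -/
def IsClosedRoot (F : Forest r n) (i : Fin n) : Prop := F.kind i = Kind.closedRoot

/-- The number of edges: each vertex that is not a root is the start of exactly one edge. -/
def numEdges (F : Forest r n) : ℕ := {i | ∃ j η, F.kind i = Kind.edge j η}.ncard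

/-- The number of closed roots. -/
def numClosed (F : Forest r n) : ℕ := {i | F.IsClosedRoot i}.ncard

/-- `ε_i(F) = (-1)^(number of vertices before i which are not open roots)`. -/
def sgn (F : Forest r n) (i : Fin n) : ℂ := (-1) ^ {j | j < i ∧ ¬ F.IsOpenRoot j}.ncard

/-- The factors of `α(F)`. -/
def alphaFactor (F : Forest r n) (i : Fin n) : Form r n :=
  match F.kind i with
  | Kind.openRoot => algebraMap ℂ (Form r n) (F.sgn i)
  | Kind.closedRoot => omega r n i
  | Kind.edge j η => omega₂ r n i j η

/-- `α(F) = α_1(F) ∧ α_2(F) ∧ ⋯ ∧ α_n(F)`. -/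
def alpha (F : Forest r n) : Form r n := (List.ofFn F.alphaFactor).prod

theorem alpha_mem_osAlgebra (F : Forest r n) : F.alpha ∈ osAlgebra r n := by
  refine Subalgebra.list_prod_mem _ ?_
  intro x hx
  obtain ⟨i, rfl⟩ := (List.mem_ofFn' _ _).1 hx
  unfold alphaFactor
  split
  · exact Subalgebra.algebraMap_mem _ _
  · exact Algebra.subset_adjoin (Or.inl ⟨i, rfl⟩)
  · rename_i j η h
    refine Algebra.subset_adjoin (Or.inr ⟨i, j, η, ?_, rfl⟩)
    rintro rfl
    exact F.acyclic i (Relation.TransGen.single ⟨η, h⟩)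

end Forest

/-! ## The action on forests, the filtration, and `A^{k,l}(T(r,n))` -/

/-- The action of `W(r,n)` on the roles of vertices: for `g = ζ w`, an edge from `i` to `j` with
label `η` becomes an edge from `w(i)` to `w(j)` with label `η ζ_{w(i)} ζ_{w(j)}⁻¹`. -/
def Kind.act {r n : ℕ} (g : W r n) (i : Fin n) : Kind r n → Kind r n
  | Kind.openRoot => Kind.openRoot
  | Kind.closedRoot => Kind.closedRoot
  | Kind.edge j η => Kind.edge (g.right j) (η * g.left (g.right i) * (g.left (g.right j))⁻¹)

namespace Forest

variable {r n : ℕ}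

/-- The action of `W(r,n)` on decorated directed forests. -/
def act (g : W r n) (F : Forest r n) : Forest r n where
  kind v := (F.kind (g.right⁻¹ v)).act g (g.right⁻¹ v)
  acyclic i h := by
    refine F.acyclic (g.right⁻¹ i) (h.lift (fun v => g.right⁻¹ v) ?_)
    rintro a b ⟨η, hab⟩
    cases hk : F.kind (g.right⁻¹ a) with
    | openRoot => rw [hk] at hab; simp [Kind.act] at hab
    | closedRoot => rw [hk] at hab; simp [Kind.act] at hab
    | edge j θ =>
      simp only [hk, Kind.act, Kind.edge.injEq] at hab
      refine ⟨θ, ?_⟩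
      rw [← hab.1]
      have h' : g.right⁻¹ (g.right j) = j := g.right.symm_apply_apply j
      simp only [h']
      exact hk

theorem act_kind (g : W r n) (F : Forest r n) (i : Fin n) :
    (F.act g).kind (g.right i) = (F.kind i).act g i := by
  simp [act]

theorem numClosed_act (g : W r n) (F : Forest r n) : (F.act g).numClosed = F.numClosed := by
  unfold numClosed
  rw [← Set.ncard_image_of_injective {i | F.IsClosedRoot i} g.right.injective]
  congr 1
  ext v
  obtain ⟨i, rfl⟩ := g.right.surjective v
  simp only [IsClosedRoot, Set.mem_ofPred_eq, act_kind, Set.mem_image, EmbeddingLike.apply_eq_iff_eq,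
    exists_eq_right]
  cases F.kind i <;> simp [Kind.act]

theorem numEdges_act (g : W r n) (F : Forest r n) : (F.act g).numEdges = F.numEdges := by
  unfold numEdges
  rw [← Set.ncard_image_of_injective {i | ∃ j η, F.kind i = Kind.edge j η} g.right.injective]
  congr 1
  ext v
  obtain ⟨i, rfl⟩ := g.right.surjective v
  simp only [Set.mem_ofPred_eq, act_kind, Set.mem_image, EmbeddingLike.apply_eq_iff_eq,
    exists_eq_right]
  cases F.kind i <;> simp [Kind.act]

/-- `α_i(F)` with the sign of an open root removed. -/
def bareFactor (F : Forest r n) (i : Fin n) : Form r n :=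
  match F.kind i with
  | Kind.openRoot => 1
  | Kind.closedRoot => omega r n i
  | Kind.edge j η => omega₂ r n i j η

theorem bareFactor_eq (F : Forest r n) (i : Fin n) : F.bareFactor i = 1 ∨
    ∃ v : T r n → Module.Dual ℂ (Fin n → ℂ), F.bareFactor i = fun z => ExteriorAlgebra.ι ℂ (v z) := by
  unfold bareFactor
  split
  · exact Or.inl rfl
  · refine Or.inr ⟨fun z => (z.1 i)⁻¹ • LinearMap.proj i, ?_⟩
    funext z; simp [omega, dz]
  · rename_i j η h
    refine Or.inr ⟨fun z => (z.1 i - ((η : ℂˣ) : ℂ) * z.1 j)⁻¹ •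
      (LinearMap.proj i - ((η : ℂˣ) : ℂ) • LinearMap.proj j), ?_⟩
    funext z; simp [omega₂, dz]

theorem bareFactor_comm (F : Forest r n) (i j : Fin n) :
    F.bareFactor i * F.bareFactor j = F.bareFactor j * F.bareFactor i ∨
    F.bareFactor i * F.bareFactor j = -(F.bareFactor j * F.bareFactor i) := by
  rcases F.bareFactor_eq i with h | ⟨v, h⟩
  · left; rw [h, one_mul, mul_one]
  rcases F.bareFactor_eq j with h' | ⟨v', h'⟩
  · left; rw [h', one_mul, mul_one]
  right
  rw [h, h']
  funext z
  exact eq_neg_of_add_eq_zero_left (ExteriorAlgebra.ι_add_mul_swap _ _)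

theorem alphaFactor_eq (F : Forest r n) (i : Fin n) :
    ∃ c : ℂ, c ≠ 0 ∧ F.alphaFactor i = c • F.bareFactor i := by
  unfold alphaFactor bareFactor
  split
  · exact ⟨F.sgn i, by simp [sgn], by rw [Algebra.algebraMap_eq_smul_one]⟩
  · exact ⟨1, one_ne_zero, by simp⟩
  · exact ⟨1, one_ne_zero, by simp⟩

theorem prod_alphaFactor (F : Forest r n) (l : List (Fin n)) :
    ∃ c : ℂ, c ≠ 0 ∧ (l.map F.alphaFactor).prod = c • (l.map F.bareFactor).prod := by
  induction l with
  | nil => exact ⟨1, one_ne_zero, by simp⟩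
  | cons a l ih =>
    obtain ⟨c, hc, h⟩ := ih
    obtain ⟨d, hd, h'⟩ := F.alphaFactor_eq a
    exact ⟨d * c, mul_ne_zero hd hc, by simp [h, h', smul_smul, mul_comm c d]⟩

theorem prod_perm (F : Forest r n) {l l' : List (Fin n)} (h : l.Perm l') :
    (l.map F.bareFactor).prod = (l'.map F.bareFactor).prod ∨
    (l.map F.bareFactor).prod = -(l'.map F.bareFactor).prod := by
  induction h with
  | nil => exact Or.inl rfl
  | cons a _ ih => rcases ih with h | h <;> simp [h]
  | swap a b l =>
    simp only [List.map_cons, List.prod_cons, ← mul_assoc]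
    rcases F.bareFactor_comm b a with h | h <;> simp [h]
  | trans _ _ ih ih' => rcases ih with h | h <;> rcases ih' with h' | h' <;> simp [h, h']

theorem formAct_bareFactor (g : W r n) (F : Forest r n) (i : Fin n) :
    formAct r n g (F.bareFactor i) = (F.act g).bareFactor (g.right i) := by
  have hstd : ∀ (i : Fin n) (z : Fin n → ℂ), stdRep r n g⁻¹ z i =
      ((g.left (g.right i) : ℂˣ) : ℂ)⁻¹ * z (g.right i) := by
    intro i z
    change ((((g.left (g.right i))⁻¹ : rootsOfUnity r ℂ) : ℂˣ) : ℂ) * _ = _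
    rw [Subgroup.coe_inv, Units.val_inv_eq_inv_val]
    rfl
  have hdz : ∀ (i : Fin n) (z : T r n), ExteriorAlgebra.map ((stdRep r n).dual g)
      (dz r n i z) = ((g.left (g.right i) : ℂˣ) : ℂ)⁻¹ • dz r n (g.right i) z := by
    intro i z
    unfold dz
    rw [ExteriorAlgebra.map_apply_ι, ← map_smul]
    congr 1
    apply LinearMap.ext; intro v
    exact hstd i v
  unfold bareFactor
  rw [act_kind]
  cases F.kind i with
  | openRoot => simp [Kind.act]
  | closedRoot =>
    funext z
    change ExteriorAlgebra.map ((stdRep r n).dual g) ((stdRep r n g⁻¹ z.1 i)⁻¹ • dz r n i z) = _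
    rw [map_smul, hdz, hstd, smul_smul]
    have := Units.ne_zero (g.left (g.right i) : ℂˣ)
    simp only [Kind.act, omega]
    congr 1
    field_simp
  | edge j η =>
    funext z
    change ExteriorAlgebra.map ((stdRep r n).dual g)
      ((stdRep r n g⁻¹ z.1 i - ((η : ℂˣ) : ℂ) * stdRep r n g⁻¹ z.1 j)⁻¹ •
        (dz r n i z - ((η : ℂˣ) : ℂ) • dz r n j z)) = _
    have h₁ := Units.ne_zero (g.left (g.right i) : ℂˣ)
    have h₂ := Units.ne_zero (g.left (g.right j) : ℂˣ)
    have h₃ : (dz r n (g.right i) z - (((η : ℂˣ) : ℂ) * ((g.left (g.right i) : ℂˣ) : ℂ) *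
        ((g.left (g.right j) : ℂˣ) : ℂ)⁻¹) • dz r n (g.right j) z) =
        ((g.left (g.right i) : ℂˣ) : ℂ) • (((g.left (g.right i) : ℂˣ) : ℂ)⁻¹ •
        dz r n (g.right i) z - (((η : ℂˣ) : ℂ) * ((g.left (g.right j) : ℂˣ) : ℂ)⁻¹) •
        dz r n (g.right j) z) := by
      rw [smul_sub, smul_smul, mul_inv_cancel₀ h₁, one_smul, smul_smul]
      congr 2
      ring
    have h₄ : z.1 (g.right i) - ((η : ℂˣ) : ℂ) * ((g.left (g.right i) : ℂˣ) : ℂ) *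
        ((g.left (g.right j) : ℂˣ) : ℂ)⁻¹ * z.1 (g.right j) = ((g.left (g.right i) : ℂˣ) : ℂ) *
        (((g.left (g.right i) : ℂˣ) : ℂ)⁻¹ * z.1 (g.right i) - ((η : ℂˣ) : ℂ) *
        (((g.left (g.right j) : ℂˣ) : ℂ)⁻¹ * z.1 (g.right j))) := by
      field_simp
    rw [map_smul, map_sub, map_smul, hdz, hdz, hstd, hstd, smul_smul]
    simp only [Kind.act, omega₂, Subgroup.coe_mul, Subgroup.coe_inv, Units.val_mul,
      Units.val_inv_eq_inv_val]
    rw [h₃, h₄, mul_inv, smul_smul, mul_comm _⁻¹ _⁻¹, mul_assoc, inv_mul_cancel₀ h₁, mul_one]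

theorem formAct_alpha (g : W r n) (F : Forest r n) :
    ∃ c : ℂ, formAct r n g F.alpha = c • (F.act g).alpha := by
  obtain ⟨c, hc, h⟩ := F.prod_alphaFactor (List.finRange n)
  obtain ⟨d, hd, h'⟩ := (F.act g).prod_alphaFactor (List.finRange n)
  have hp : ((List.finRange n).map g.right).Perm (List.finRange n) := by
    rw [List.perm_ext_iff_of_nodup ((List.nodup_finRange n).map g.right.injective)
      (List.nodup_finRange n)]
    intro a
    simp only [List.mem_map, List.mem_finRange, true_and, iff_true]
    exact g.right.surjective a
  unfold alpha
  rw [List.ofFn_eq_map, List.ofFn_eq_map, h, h', map_smul, map_list_prod, List.map_map]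
  have hf : (formAct r n g) ∘ F.bareFactor = (F.act g).bareFactor ∘ g.right :=
    funext (F.formAct_bareFactor g)
  rw [hf, ← List.map_map]
  rcases (F.act g).prod_perm hp with h | h
  · exact ⟨c * d⁻¹, by rw [h, smul_smul, mul_assoc, inv_mul_cancel₀ hd, mul_one]⟩
  · exact ⟨-(c * d⁻¹), by rw [h, smul_smul, neg_mul, mul_assoc, inv_mul_cancel₀ hd, mul_one,
      smul_neg, neg_smul]⟩

end Forest

/-- The filtration `A^p(T(r,n))_m`, spanned by the `α(F)` for forests `F` with `k` edges and `l`
closed roots such that `k + l = p` and `l ≥ m`. -/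
def filtration (r n p m : ℕ) : Submodule ℂ (Form r n) :=
  Submodule.span ℂ {x | ∃ F : Forest r n, F.numEdges + F.numClosed = p ∧ m ≤ F.numClosed ∧
    x = F.alpha}

theorem filtration_stable (r n p m : ℕ) (g : W r n) :
    filtration r n p m ≤ (filtration r n p m).comap (formRep r n g) := by
  refine Submodule.span_le.2 ?_
  rintro x ⟨F, hp, hm, rfl⟩
  obtain ⟨c, hc⟩ := F.formAct_alpha g
  change formAct r n g F.alpha ∈ filtration r n p m
  rw [hc]
  exact Submodule.smul_mem _ _ (Submodule.subset_span
    ⟨F.act g, by rw [F.numEdges_act, F.numClosed_act, hp], by rwa [F.numClosed_act], rfl⟩)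

/-- `A^{k,l}(T(r,n)) = A^{k+l}(T(r,n))_l / A^{k+l}(T(r,n))_{l+1}`. -/
abbrev A (r n k l : ℕ) : Type :=
  filtration r n (k + l) l ⧸ (filtration r n (k + l) (l + 1)).submoduleOf (filtration r n (k + l) l)

/-- The representation of `W(r,n)` on `A^{k,l}(T(r,n))`. -/
def repA (r n k l : ℕ) : Representation ℂ (W r n) (A r n k l) :=
  ((formRep r n).subrepresentation _ (filtration_stable r n (k + l) l)).quotient _
    (fun g _ hx => filtration_stable r n (k + l) (l + 1) g hx)

/-! ## Isotypic components -/

section Isotypic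

variable {r n : ℕ} {V : Type*} [AddCommGroup V] [Module ℂ V] (ρ : Representation ℂ (W r n) V)

/-- `V_{(s/r)}`: the vectors on which each `ζ ∈ μ_r^n` acts as `ζ_1^{-s} ⋯ ζ_n^{-s}`. -/
def isotypic (s : ℤ) : Submodule ℂ V where
  carrier := {v | ∀ ζ : Fin n → rootsOfUnity r ℂ,
    ρ (SemidirectProduct.inl ζ) v = (∏ i, ((ζ i : ℂˣ) : ℂ) ^ (-s)) • v}
  add_mem' ha hb ζ := by rw [map_add, ha, hb, smul_add]
  zero_mem' ζ := by simp
  smul_mem' c v hv ζ := by rw [map_smul, hv, smul_comm]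

theorem isotypic_stable (s : ℤ) (w : Equiv.Perm (Fin n)) :
    isotypic ρ s ≤ (isotypic ρ s).comap (ρ.comp SemidirectProduct.inr w) := by
  intro v hv ζ
  have h : (SemidirectProduct.inl ζ * SemidirectProduct.inr w : W r n) =
      SemidirectProduct.inr w * SemidirectProduct.inl (permTorus r n w⁻¹ ζ) := by
    apply SemidirectProduct.ext
    · funext i
      simp only [SemidirectProduct.mul_left, SemidirectProduct.left_inl,
        SemidirectProduct.left_inr, SemidirectProduct.right_inl, SemidirectProduct.right_inr,
        map_one, mul_one, one_mul]
      change ζ i = ζ (w (w⁻¹ i))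
      exact congrArg ζ (w.apply_symm_apply i).symm
    · simp
  change ρ (SemidirectProduct.inl ζ) (ρ (SemidirectProduct.inr w) v) =
    _ • ρ (SemidirectProduct.inr w) v
  rw [← Module.End.mul_apply, ← map_mul, h, map_mul, Module.End.mul_apply, hv, map_smul]
  congr 1
  exact Equiv.prod_comp w (fun i => ((ζ i : ℂˣ) : ℂ) ^ (-s))

/-- The representation of `S_n` on `V_{(s/r)}`. -/
def isotypicRep (s : ℤ) : Representation ℂ (Equiv.Perm (Fin n)) (isotypic ρ s) :=
  Representation.subrepresentation (ρ.comp SemidirectProduct.inr) (isotypic ρ s)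
    (isotypic_stable ρ s)

end Isotypic

/-- A one-dimensional character as a representation on `ℂ`. -/
def charRep {G : Type*} [Group G] (χ : G →* ℂˣ) : Representation ℂ G ℂ where
  toFun g := (χ g : ℂ) • LinearMap.id
  map_one' := by ext; simp
  map_mul' g h := by ext; simp [mul_comm]

/-- The sign character `ε_n` of `S_n`, with values in `ℂ`. -/
def signChar (α : Type*) [Fintype α] [DecidableEq α] : Equiv.Perm α →* ℂˣ :=
  (Units.map (Int.castRingHom ℂ : ℤ →* ℂ)).comp Equiv.Perm.sign

/-! ## The subgroups of `S_n` and their characters -/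

section Blocks

variable (r : ℕ) {a : ℕ} (lam : Nat.Partition a)

/-- The multiplicity `m_{i+1}(λ)` of `i + 1` as a part of `λ`. -/
def mult (i : Fin a) : ℕ := lam.parts.count (i.1 + 1)

/-- The set permuted by the block group of `λ`: a disjoint union of `m_i(λ)` blocks, each a copy of
`ℤ/ri`, for each `i`. -/
abbrev Vertex : Type := Σ i : Fin a, Fin (mult lam i) × ZMod (r * (i.1 + 1))

/-- The product of the cyclic groups `μ_{r λ_b}` over all parts `λ_b` of `λ`; the parts equal to `i`
are indexed by `Fin (m_i(λ))`, and `μ_m` is written as the cyclic group `ℤ/m`. -/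
abbrev Cyclics : Type := ∀ i : Fin a, Fin (mult lam i) → Multiplicative (ZMod (r * (i.1 + 1)))

/-- `S_{m_1(λ)} × S_{m_2(λ)} × ⋯`. -/
abbrev Perms : Type := ∀ i : Fin a, Equiv.Perm (Fin (mult lam i))

/-- `S_{m_i(λ)}` permutes the factors `μ_{r λ_b}` with `λ_b = i`. -/
def permCyclics : Perms lam →* MulAut (Cyclics r lam) where
  toFun σ :=
    { toFun := fun c i b => c i ((σ i)⁻¹ b)
      invFun := fun c i b => c i (σ i b)
      left_inv := fun c => by funext i b; simp
      right_inv := fun c => by funext i b; simp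
      map_mul' := fun _ _ => rfl }
  map_one' := by ext; rfl
  map_mul' σ τ := by ext; simp [mul_inv_rev]

/-- `(μ_{r λ_1} × μ_{r λ_2} × ⋯) ⋊ (S_{m_1(λ)} × S_{m_2(λ)} × ⋯)`. -/
abbrev BlockGroup : Type := Cyclics r lam ⋊[permCyclics r lam] Perms lam

/-- The block group as a group of permutations: each cyclic factor rotates its block, and
`S_{m_i(λ)}` permutes the blocks of size `ri`. -/
def blockPerm : BlockGroup r lam →* Equiv.Perm (Vertex r lam) where
  toFun g :=
    { toFun := fun v => ⟨v.1, g.right v.1 v.2.1, (g.left v.1 (g.right v.1 v.2.1)).toAdd + v.2.2⟩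
      invFun := fun v => ⟨v.1, (g.right v.1)⁻¹ v.2.1, -(g.left v.1 v.2.1).toAdd + v.2.2⟩
      left_inv := fun v => by simp
      right_inv := fun v => by simp }
  map_one' := by
    apply Equiv.ext
    rintro ⟨i, b, x⟩
    simp
  map_mul' g h := by
    apply Equiv.ext
    rintro ⟨i, b, x⟩
    simp [permCyclics, add_assoc]

/-- The character of `ℤ/m ≅ μ_m` sending the generator `1` to `ζ`. -/
def cycChar {m : ℕ} [NeZero m] (ζ : rootsOfUnity m ℂ) : Multiplicative (ZMod m) →* ℂˣ where
  toFun j := (ζ : ℂˣ) ^ j.toAdd.val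
  map_one' := by simp
  map_mul' j k := by
    have h : (ζ : ℂˣ) ^ m = 1 := ζ.2
    rw [toAdd_mul, ZMod.val_add, ← pow_add]
    conv_rhs => rw [← Nat.div_add_mod (j.toAdd.val + k.toAdd.val) m, pow_add, pow_mul, h, one_pow,
      one_mul]

/-- The product of the sign characters of the components `S_{m_i(λ)}`. -/
def eps : BlockGroup r lam →* ℂˣ where
  toFun g := ∏ i, signChar _ (g.right i)
  map_one' := by simp
  map_mul' g h := by simp [Finset.prod_mul_distrib]

variable [NeZero r]

/-- The character `ψ`, the product of the components in the cyclic groups; here each `μ_m` is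
identified with `ℤ/m` through the generator `ζ m`. -/
def psi (ζ : ∀ m : ℕ, rootsOfUnity m ℂ) : BlockGroup r lam →* ℂˣ where
  toFun g := ∏ i, ∏ b, cycChar (ζ (r * (i.1 + 1))) (g.left i b)
  map_one' := by simp
  map_mul' g h := by
    simp only [SemidirectProduct.mul_left, Pi.mul_apply, map_mul, Finset.prod_mul_distrib]
    congr 1
    refine Finset.prod_congr rfl fun i _ => ?_
    exact Equiv.prod_comp (g.right i)⁻¹ (fun b => cycChar (ζ (r * (i.1 + 1))) (h.left i b))

theorem card_vertex : Fintype.card (Vertex r lam) = r * a := by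
  have h : ∑ i : Fin a, mult lam i * (i.1 + 1) = a := by
    have h₁ : lam.parts.sum = ∑ m ∈ Finset.range (a + 1), lam.parts.count m • m :=
      Finset.sum_multiset_count_of_subset _ _ fun m hm => by
        rw [Multiset.mem_toFinset] at hm
        rw [Finset.mem_range, Nat.lt_succ_iff, ← lam.parts_sum]
        exact Multiset.le_sum_of_mem hm
    rw [lam.parts_sum, Finset.sum_range_succ', Finset.sum_range] at h₁
    simpa [mult] using h₁.symm
  rw [Fintype.card_sigma]
  simp only [Fintype.card_prod, Fintype.card_fin, ZMod.card]
  calc _ = r * ∑ i : Fin a, mult lam i * (i.1 + 1) := by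
        rw [Finset.mul_sum]
        exact Finset.sum_congr rfl fun i _ => by ring
    _ = r * a := by rw [h]

end Blocks

/-- A pair of partitions `(λ¹, λ²)` with `|λ¹| + |λ²| = n/r`, `ℓ(λ¹) = n - k - l`, `ℓ(λ²) = l`. -/
structure PartitionPair (r n k l : ℕ) : Type where
  size₁ : ℕ
  size₂ : ℕ
  fst : Nat.Partition size₁
  snd : Nat.Partition size₂
  size_eq : r * (size₁ + size₂) = n
  length_fst : fst.parts.card + k + l = n
  length_snd : snd.parts.card = l

namespace PartitionPair

variable {r n k l : ℕ} [NeZero r] (P : PartitionPair r n k l)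

/-- An identification of the disjoint union of all blocks with `{1, …, n}`. -/
def vertexEquiv : Vertex r P.fst ⊕ Vertex r P.snd ≃ Fin n :=
  Fintype.equivFinOfCardEq (by
    rw [Fintype.card_sum, card_vertex, card_vertex, ← mul_add, P.size_eq])

/-- The subgroup of `S_n` attached to `(λ¹, λ²)`, as an embedded abstract group. -/
def embedding : BlockGroup r P.fst × BlockGroup r P.snd →* Equiv.Perm (Fin n) :=
  (Equiv.permCongrHom P.vertexEquiv).toMonoidHom.comp
    ((Equiv.Perm.sumCongrHom _ _).comp ((blockPerm r P.fst).prodMap (blockPerm r P.snd)))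

/-- The character `ε ψ`: signs of the permutations of the equal parts of `λ¹` only, times the
product of all components in cyclic groups. -/
def character (ζ : ∀ m : ℕ, rootsOfUnity m ℂ) :
    BlockGroup r P.fst × BlockGroup r P.snd →* ℂˣ :=
  (eps r P.fst * psi r P.fst ζ).coprod (psi r P.snd ζ)

/-- The summand `Ind (ε ψ)` attached to `(λ¹, λ²)`. -/
def summand (ζ : ∀ m : ℕ, rootsOfUnity m ℂ) :
    Representation ℂ (Equiv.Perm (Fin n))
      (Representation.IndV P.embedding (charRep (P.character ζ))) :=
  Representation.ind P.embedding (charRep (P.character ζ))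

end PartitionPair

end TwistedTorus

end

noncomputable section

namespace TwistedTorus

/-! ## Products of consecutive differences in an algebra satisfying Arnold's relation -/

section Path

variable {R : Type*} [Ring R] {X : Type*} (e : X → X → R)

/-! Decreasing forests, whose edges go from larger to smaller vertices, give a basis of the algebra
adapted to the degree and to the number of closed roots. Arnold's relation rewrites any product of
generators in these terms without losing closed roots (`decSpan_mul_isGen`,
`filtration_eq_decSpan`), and independence is the uniqueness of partial fractions in the last
coordinate (`linearIndependent_decForm`). In this basis the torus only changes edge labels, and each
orbit contains exactly one forest with all labels equal to `1`. Hence the isotypic component of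
`A^{k,l}` is spanned by the projections of unlabelled forests.

The form of an unlabelled forest is a combination of products of words: a word stands for the
product of the forms `diag` over consecutive letters, times `omega` of its last letter if the root
is closed (`decForm_plain_mem_span`). Up to sign, the words on a set of `b` letters behave like the
Lie representation, which by Klyachko is induced from a faithful character of the cyclic group of
order `b`; so words may be replaced by twisted cyclic sums (`IsArnold.pathForm_mem_span_cycForm`).
With a closed root this remains true modulo more closed roots, because there the forms `omega` of
all letters of a word agree (`pathForm_mul_omega_sub_mem`). A product of cyclic sums is fixed by
every torus element constant on each word, so, `s` being prime to `r`, its projection vanishes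
unless `r` divides all lengths (`proj_cycList_eq_zero`).

The surviving products are indexed by labellings of blocks of sizes `r λ`. After multiplication by
the sign of the concatenated word (`signedForm`), a permutation of the letters acts by relabelling
up to the sign character, rotating a block multiplies by a power of the chosen root of unity, and
exchanging two equal blocks multiplies by `-1` for open roots and by `1` for closed roots. This
produces `ε_n`, `ψ` and `ε`, and gives a surjection from the sum of induced characters
(`fromSum_surjective`).

Injectivity is a dimension count (`fromSum_bijective`). Rotating all blocks of a labelling is a
permutation with coloured cycles, which `Dec.code` encodes as an unlabelled decreasing forest.
Labellings with the same code differ by an element of the block group, the centraliser of the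
rotation, so the source has dimension at most the number of codes. The torus stabiliser of a coded
forest consists of elements constant on cycles, whose lengths are divisible by `r`; the character is
trivial on it, and the projections of the coded forests are linearly independent
(`linearIndependent_isoMap`). So the target has dimension at least the number of codes. -/

/-- The product of `e` over the consecutive pairs of a word. -/
def pathForm : List X → R
  | [] => 1
  | [_] => 1
  | x :: y :: l => e x y * pathForm (y :: l)

@[simp] theorem pathForm_singleton (x : X) : pathForm e [x] = 1 := rfl

@[simp] theorem pathForm_cons_cons (x y : X) (l : List X) :
    pathForm e (x :: y :: l) = e x y * pathForm e (y :: l) := rfl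

theorem pathForm_append (u : List X) (x : X) (v : List X) :
    pathForm e (u ++ x :: v) = pathForm e (u ++ [x]) * pathForm e (x :: v) := by
  induction u with
  | nil => simp
  | cons a u ih =>
    cases u with
    | nil => simp
    | cons b u =>
      simp only [List.cons_append, pathForm_cons_cons] at ih ⊢
      rw [ih, mul_assoc]

theorem pathForm_append_two (u : List X) (x y : X) :
    pathForm e (u ++ [x, y]) = pathForm e (u ++ [x]) * e x y := by
  rw [pathForm_append]; simp

end Path

section Arnold

variable {R : Type*} [Ring R] [Algebra ℂ R]

/-- Graded commutativity: a product of `p` odd elements passes a product of `q` odd elements with `p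
* q` sign changes. The case `q = 1` is settled first. -/
theorem mul_comm_of_mem_pow {O : Submodule ℂ R} (hO : ∀ x ∈ O, ∀ y ∈ O, x * y = -(y * x))
    {p q : ℕ} {x y : R} (hx : x ∈ O ^ p) (hy : y ∈ O ^ q) :
    x * y = (-1 : ℂ) ^ (p * q) • (y * x) := by
  have h₁ : ∀ (p : ℕ) (x : R), x ∈ O ^ p → ∀ y ∈ O, x * y = (-1 : ℂ) ^ p • (y * x) := by
    intro p x hx y hy
    induction hx using Submodule.pow_induction_on_left' with
    | algebraMap r => simp [Algebra.algebraMap_eq_smul_one]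
    | add x y i hx hy ihx ihy => rw [add_mul, ihx, ihy, mul_add, smul_add]
    | mem_mul m hm i x hx ih =>
      rw [mul_assoc, ih, mul_smul_comm, ← mul_assoc, hO m hm y hy, pow_succ, neg_mul, mul_assoc]
      simp
  induction hy using Submodule.pow_induction_on_left' with
  | algebraMap r => simp [Algebra.algebraMap_eq_smul_one]
  | add x y i hx hy ihx ihy => rw [mul_add, ihx, ihy, add_mul, smul_add]
  | mem_mul m hm i y hy ih =>
    rw [← mul_assoc, h₁ p x hx m hm, smul_mul_assoc, mul_assoc, ih, mul_smul_comm, smul_smul,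
      ← mul_assoc, Nat.succ_eq_add_one, mul_add, mul_one, pow_add, mul_comm ((-1 : ℂ) ^ p)]

variable {X : Type*}

/-- A family `e x y` of odd elements indexed by pairs of points, behaving like the logarithmic
forms `d log (x - y)`. -/
structure IsArnold (O : Submodule ℂ R) (e : X → X → R) : Prop where
  anti : ∀ x ∈ O, ∀ y ∈ O, x * y = -(y * x)
  mem : ∀ x y, e x y ∈ O
  symm : ∀ x y, e x y = e y x
  arnold : ∀ x y z, x ≠ y → y ≠ z → x ≠ z → e x z * e y z = e x y * e y z + e x z * e x y

variable {e : X → X → R} {O : Submodule ℂ R}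

theorem IsArnold.pathForm_mem (h : IsArnold O e) (x : X) (l : List X) :
    pathForm e (x :: l) ∈ O ^ l.length := by
  induction l generalizing x with
  | nil => simpa using ⟨1, map_one _⟩
  | cons y l ih =>
    rw [pathForm_cons_cons, List.length_cons, pow_succ']
    exact Submodule.mul_mem_mul (h.mem x y) (ih y)

theorem IsArnold.pathForm_mem_of_length (h : IsArnold O e) {m : ℕ} {l : List X}
    (hl : l.length = m + 1) : pathForm e l ∈ O ^ m := by
  cases l with
  | nil => simp at hl
  | cons x l =>
    have := h.pathForm_mem x l
    simp only [List.length_cons, add_left_inj] at hl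
    rwa [hl] at this

theorem IsArnold.comm (h : IsArnold O e) {p q : ℕ} {x y : R} (hx : x ∈ O ^ p) (hy : y ∈ O ^ q) :
    x * y = (-1 : ℂ) ^ (p * q) • (y * x) := mul_comm_of_mem_pow h.anti hx hy

theorem IsArnold.comm_one (h : IsArnold O e) {p : ℕ} {x y : R} (hx : x ∈ O ^ p) (hy : y ∈ O) :
    x * y = (-1 : ℂ) ^ p • (y * x) := by
  simpa using h.comm hx (q := 1) (by simpa using hy)

/-- Attaching a new leaf to the end of a word: the result is a combination of words in which the
new letter has been inserted. -/
theorem IsArnold.attach_leaf (h : IsArnold O e) (i j : X) (u : List X)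
    (hu : (i :: (u ++ [j])).Nodup) :
    pathForm e (u ++ [j]) * e i j ∈
      Submodule.span ℂ {x | ∃ u' : List X, u'.Perm (i :: u) ∧ x = pathForm e (u' ++ [j])} := by
  induction u using List.reverseRecOn generalizing j with
  | nil =>
    refine Submodule.subset_span ⟨[i], List.Perm.refl _, ?_⟩
    simp
  | append_singleton u a ih =>
    have hd := hu
    simp only [List.nodup_cons, List.mem_append, List.mem_singleton, not_or, List.nodup_append,
      ne_eq] at hd
    have hij : i ≠ j := by tauto
    have hia : i ≠ a := by tauto
    have haj : a ≠ j := fun hh => hd.2.2.2 a (by simp) j (by simp) hh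
    have harn := h.arnold a i j (Ne.symm hia) hij haj
    have hodd : e a j * e a i = -(e a i * e a j) := h.anti _ (h.mem _ _) _ (h.mem _ _)
    -- Arnold's relation on `a`, `i`, `j` either inserts `i` between `a` and `j`, or moves the leaf
    -- `i` from `j` to the preceding letter `a`, where the induction hypothesis applies.
    have key : pathForm e (u ++ [a] ++ [j]) * e i j =
        pathForm e (u ++ [a, i, j]) - pathForm e (u ++ [a]) * e i a * e a j := by
      have h₁ : pathForm e (u ++ [a] ++ [j]) = pathForm e (u ++ [a]) * e a j := by
        rw [List.append_assoc]; exact pathForm_append_two e u a j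
      have h₂ : pathForm e (u ++ [a, i, j]) = pathForm e (u ++ [a]) * (e a i * e i j) := by
        rw [pathForm_append]; simp
      rw [h₁, h₂, mul_assoc, harn, hodd, mul_add, h.symm i a, mul_neg, mul_assoc, sub_eq_add_neg]
    rw [key]
    refine Submodule.sub_mem _ (Submodule.subset_span ⟨u ++ [a, i], ?_, by simp⟩) ?_
    · have : (u ++ [a, i]).Perm ((u ++ [a]) ++ [i]) := by simp
      exact this.trans (List.perm_append_singleton _ _)
    · have hn : (i :: (u ++ [a])).Nodup := by
        have : (i :: (u ++ [a])).Sublist (i :: (u ++ [a] ++ [j])) := by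
          refine List.Sublist.cons_cons _ ?_
          exact List.sublist_append_left _ _
        exact hu.sublist this
      have := ih a hn
      have hm := Submodule.apply_mem_span_image_of_mem_span (LinearMap.mulRight ℂ (e a j)) this
      rw [LinearMap.mulRight_apply] at hm
      refine Submodule.span_mono ?_ hm
      rintro _ ⟨_, ⟨u', hu', rfl⟩, rfl⟩
      refine ⟨u' ++ [a], ?_, ?_⟩
      · exact (hu'.append_right [a])
      · rw [LinearMap.mulRight_apply, List.append_assoc]
        exact (pathForm_append_two e u' a j).symm

/-! ### The Klyachko elements -/

/-- The partially cyclic sums interpolating between words and their twisted cyclic sums. -/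
def partCyc (e : X → X → R) (q : ℂ) (u : List X) (y : X) : R :=
  ∑ j ∈ Finset.range (u.length + 1),
    (-q) ^ j • (pathForm e (y :: u.take j) * pathForm e (u.drop j ++ [y]))

theorem partCyc_nil (q : ℂ) (y : X) : partCyc e q [] y = 1 := by simp [partCyc]

theorem IsArnold.partCyc_singleton (h : IsArnold O e) (q : ℂ) (b y : X) :
    partCyc e q [b] y = (1 - q) • e b y := by
  simp [partCyc, Finset.sum_range_succ, h.symm y b, sub_smul, ← sub_eq_add_neg]

/-- Here `y` is joined to both `a` and `b`. Arnold's relation on this triangle keeps one of the two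
edges at `y` and joins `a` to `b` instead; the signs come from moving a degree-one factor past the
rest. -/
theorem IsArnold.partCyc_middle (h : IsArnold O e) (a b y : X) (m₁ m₂ : List X) (hab : a ≠ b)
    (hay : a ≠ y) (hby : b ≠ y) :
    pathForm e (y :: a :: m₁) * pathForm e (m₂ ++ [b, y]) =
      pathForm e (b :: a :: m₁) * pathForm e (m₂ ++ [b]) * e b y +
      (-1 : ℂ) ^ (m₁.length + m₂.length + 1) •
        (pathForm e (a :: m₁) * pathForm e (m₂ ++ [b, a]) * e a y) := by
  have hA := h.pathForm_mem a m₁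
  have hB : pathForm e (m₂ ++ [b]) ∈ O ^ m₂.length := h.pathForm_mem_of_length (by simp)
  rw [pathForm_cons_cons, pathForm_cons_cons, pathForm_append_two, pathForm_append_two]
  set A := pathForm e (a :: m₁)
  set B := pathForm e (m₂ ++ [b])
  have hAB : A * B ∈ O ^ (m₁.length + m₂.length) := by
    rw [pow_add]; exact Submodule.mul_mem_mul hA hB
  have hmove : ∀ c ∈ O, c * (A * B) = (-1 : ℂ) ^ (m₁.length + m₂.length) • (A * B * c) := by
    intro c hc
    rw [h.comm_one hAB hc, smul_smul, ← pow_add, ← two_mul, pow_mul]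
    simp
  have harn := h.arnold a b y hab hby hay
  have hodd : e a y * e a b = -(e a b * e a y) := h.anti _ (h.mem _ _) _ (h.mem _ _)
  calc e y a * A * (B * e b y) = e a y * (A * B) * e b y := by rw [h.symm y a]; simp only [mul_assoc]
    _ = (-1 : ℂ) ^ (m₁.length + m₂.length) • (A * B * (e a y * e b y)) := by
      rw [hmove _ (h.mem _ _), smul_mul_assoc, mul_assoc]
    _ = (-1 : ℂ) ^ (m₁.length + m₂.length) • (A * B * e a b) * e b y +
        (-1 : ℂ) ^ (m₁.length + m₂.length + 1) • (A * B * e a b * e a y) := by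
      rw [harn, hodd, mul_add, smul_add, smul_mul_assoc, pow_succ]
      simp only [mul_assoc, mul_neg, smul_neg, mul_one, neg_smul]
    _ = e b a * A * B * e b y + (-1 : ℂ) ^ (m₁.length + m₂.length + 1) •
        (A * (B * e b a) * e a y) := by
      rw [← hmove _ (h.mem _ _), h.symm b a]
      simp only [mul_assoc]

/-- The right side is a difference between a function of the word `a m b` and a multiple of the same
function of its rotation `m b a`. This is the shape that `mem_of_sub_rotate_mem` inverts. -/
theorem IsArnold.partCyc_rec (h : IsArnold O e) (q : ℂ) (a b y : X) (m : List X) (hab : a ≠ b)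
    (hay : a ≠ y) (hby : b ≠ y) :
    partCyc e q (a :: (m ++ [b])) y = partCyc e q (a :: m) b * e b y -
      (q * (-1) ^ (m.length + 1)) • (partCyc e q (m ++ [b]) a * e a y) := by
  -- Every interior term of the left sum contributes one term to each sum on the right. The first
  -- and last terms, `h0` and `hlast`, supply the two that are still missing.
  have hsum : ∀ j ∈ Finset.range (m.length + 1),
      (-q) ^ (j + 1) • (pathForm e (y :: (a :: (m ++ [b])).take (j + 1)) *
        pathForm e ((a :: (m ++ [b])).drop (j + 1) ++ [y])) =
      (-q) ^ (j + 1) • (pathForm e (b :: (a :: m).take (j + 1)) *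
        pathForm e ((a :: m).drop (j + 1) ++ [b])) * e b y -
      (q * (-1) ^ (m.length + 1)) • ((-q) ^ j • (pathForm e (a :: (m ++ [b]).take j) *
        pathForm e ((m ++ [b]).drop j ++ [a])) * e a y) := by
    intro j hj
    rw [Finset.mem_range] at hj
    have hjm : j ≤ m.length := by omega
    have hmid := h.partCyc_middle a b y (m.take j) (m.drop j) hab hay hby
    have hlen : (m.take j).length + (m.drop j).length + 1 = m.length + 1 := by
      simp [hjm]
    rw [hlen] at hmid
    simp only [List.take_succ_cons, List.drop_succ_cons, List.take_append_of_le_length hjm,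
      List.drop_append_of_le_length hjm, List.append_assoc, List.singleton_append] 
    rw [hmid, smul_add, smul_mul_assoc, smul_mul_assoc, smul_smul, smul_smul, sub_eq_add_neg,
      ← neg_smul]
    congr 2
    ring
  have h0 : pathForm e (a :: (m ++ [b]) ++ [y]) = pathForm e (a :: m ++ [b]) * e b y := by
    have := pathForm_append_two e (a :: m) b y
    simpa using this
  have hlast : pathForm e (y :: a :: (m ++ [b])) =
      (-1 : ℂ) ^ (m.length + 1) • (pathForm e (a :: (m ++ [b])) * e a y) := by
    have hm := h.pathForm_mem a (m ++ [b])
    rw [h.comm_one hm (h.mem a y), pathForm_cons_cons, h.symm y a, smul_smul, ← pow_add]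
    simp [← two_mul, pow_mul]
  unfold partCyc
  rw [show (a :: (m ++ [b])).length + 1 = m.length + 1 + 1 + 1 by simp,
    show (a :: m).length + 1 = m.length + 1 + 1 by simp,
    show (m ++ [b]).length + 1 = m.length + 1 + 1 by simp,
    Finset.sum_range_succ, Finset.sum_range_succ', Finset.sum_congr rfl hsum,
    Finset.sum_sub_distrib, Finset.sum_range_succ' _ (m.length + 1),
    Finset.sum_range_succ _ (m.length + 1), add_mul, add_mul, smul_add, Finset.sum_mul,
    Finset.sum_mul, Finset.smul_sum]
  have e1 : (a :: (m ++ [b])).take (m.length + 1 + 1) = a :: (m ++ [b]) := by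
    rw [List.take_of_length_le]; simp
  have e2 : (a :: (m ++ [b])).drop (m.length + 1 + 1) = [] := by
    rw [List.drop_of_length_le]; simp
  have e3 : (m ++ [b]).take (m.length + 1) = m ++ [b] := by
    rw [List.take_of_length_le]; simp
  have e4 : (m ++ [b]).drop (m.length + 1) = [] := by
    rw [List.drop_of_length_le]; simp
  rw [e1, e2, e3, e4, hlast]
  simp only [List.take_zero, List.drop_zero, pathForm_singleton, pow_zero, one_smul, one_mul,
    List.nil_append, mul_one]
  rw [h0, smul_mul_assoc, smul_smul, smul_smul]
  have : (-q) ^ (m.length + 1 + 1) * (-1) ^ (m.length + 1) =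
      -(q * (-1) ^ (m.length + 1) * (-q) ^ (m.length + 1)) := by ring
  rw [this, neg_smul]
  abel

/-- The twisted cyclic sum of a word. -/
def cycForm (e : X → X → R) (Q : ℂ) (w : List X) : R :=
  ∑ j ∈ Finset.range w.length, Q ^ j • pathForm e (w.rotate j)

/-- Exchanging the two pieces, of degrees `j` and `u.length - j`, turns each term into a rotation of
the word. Since `j ^ 2` and `j` have the same parity, the sign of the exchange turns `(-q) ^ j` into
the `j`-th power of the new ratio. -/
theorem IsArnold.partCyc_eq_cycForm (h : IsArnold O e) (q : ℂ) (u : List X) (y : X) :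
    partCyc e q u y = cycForm e (q * (-1) ^ u.length) (u ++ [y]) := by
  unfold partCyc cycForm
  rw [show (u ++ [y]).length = u.length + 1 by simp]
  refine Finset.sum_congr rfl fun j hj => ?_
  rw [Finset.mem_range] at hj
  have hj' : j ≤ u.length := by omega
  rw [List.rotate_eq_drop_append_take (by simp; omega), List.drop_append_of_le_length hj',
    List.take_append_of_le_length hj', List.append_assoc, List.singleton_append,
    pathForm_append e _ y (u.take j)]
  have h1 := h.pathForm_mem y (u.take j)
  have h2 : pathForm e (u.drop j ++ [y]) ∈ O ^ (u.drop j).length :=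
    h.pathForm_mem_of_length (by simp)
  rw [h.comm h1 h2, smul_smul]
  congr 1
  rw [List.length_take_of_le hj', List.length_drop]
  obtain ⟨d, hd⟩ := Nat.exists_eq_add_of_le hj'
  rw [hd, Nat.add_sub_cancel_left, mul_pow, ← pow_mul, neg_pow, add_mul, pow_add, ← pow_two,
    mul_comm j d, pow_mul _ d j]
  have : ((-1 : ℂ)) ^ j = (-1) ^ (j ^ 2) := by
    rcases Nat.even_or_odd j with hh | hh
    · rw [hh.neg_one_pow, (hh.pow_of_ne_zero two_ne_zero).neg_one_pow]
    · rw [hh.neg_one_pow, hh.pow.neg_one_pow]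
  rw [this]
  ring

/-- Telescoping the differences around a full turn gives `(1 - Q ^ w.length) • g w`, whose
coefficient is invertible. -/
theorem mem_of_sub_rotate_mem {V : Type*} [AddCommGroup V] [Module ℂ V] (S : Submodule ℂ V)
    (g : List X → V) (Q : ℂ) (w : List X) (hQ : Q ^ w.length ≠ 1)
    (hg : ∀ j, g (w.rotate j) - Q • g (w.rotate (j + 1)) ∈ S) : g w ∈ S := by
  have key : ∀ j, g w - Q ^ j • g (w.rotate j) ∈ S := by
    intro j
    induction j with
    | zero => simp
    | succ j ih =>
      have := S.add_mem ih (S.smul_mem (Q ^ j) (hg j))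
      rw [smul_sub, smul_smul, ← pow_succ] at this
      convert this using 1
      abel
  have := key w.length
  rw [List.rotate_length] at this
  have h' : (1 - Q ^ w.length) • g w ∈ S := by rwa [sub_smul, one_smul]
  exact (S.smul_mem_iff (sub_ne_zero.2 (Ne.symm hQ))).1 h'

/-- Klyachko's theorem: every word is a combination of twisted cyclic sums. -/
theorem IsArnold.pathForm_mem_span_cycForm (h : IsArnold O e) (q : ℂ) (w : List X)
    (hw : w.Nodup) (hne : w ≠ []) (hq : ∀ k, 0 < k → k < w.length → q ^ k ≠ 1) :
    pathForm e w ∈ Submodule.span ℂ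
      {x | ∃ w' : List X, w'.Perm w ∧ x = cycForm e (q * (-1) ^ (w.length - 1)) w'} := by
  set S := Submodule.span ℂ
      {x | ∃ w' : List X, w'.Perm w ∧ x = cycForm e (q * (-1) ^ (w.length - 1)) w'} with hS
  -- The statement interpolates between the cyclic sum of the whole word (`t` empty) and the word
  -- itself (`u` empty); each step of the induction removes one letter from the symmetrised part.
  have main : ∀ (t : List X) (u : List X) (y : X), (u ++ y :: t).Perm w →
      partCyc e q u y * pathForm e (y :: t) ∈ S := by
    intro t
    induction t with
    | nil =>
      intro u y hp
      rw [pathForm_singleton, mul_one, h.partCyc_eq_cycForm]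
      refine Submodule.subset_span ⟨u ++ [y], hp, ?_⟩
      rw [← hp.length_eq]
      simp
    | cons y t ih =>
      intro u x hp
      -- The distinguished letter is made the last letter of the argument of `g`, so that rotating
      -- the argument makes sense; the reversal only serves to read it off.
      set g : List X → R := fun l => match l.reverse with
        | [] => 0
        | b :: l => partCyc e q l.reverse b * pathForm e (b :: y :: t) with hg
      have hgc : ∀ (l : List X) (b : X), g (l ++ [b]) =
          partCyc e q l b * pathForm e (b :: y :: t) := by
        intro l b; simp [hg]
      rw [← hgc]
      have hlen : (u ++ [x]).length = u.length + 1 := by simp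
      have hlw : (u.length + 1) + (t.length + 1) = w.length := by
        rw [← hp.length_eq]; simp; omega
      refine mem_of_sub_rotate_mem S g (q * (-1) ^ u.length) (u ++ [x]) ?_ ?_
      -- The sign disappears because `u.length * (u.length + 1)` is even, and `u.length + 1 <
      -- w.length` because at least one letter remains outside.
      · rw [hlen, mul_pow, ← pow_mul, (Nat.even_mul_succ_self u.length).neg_one_pow, mul_one]
        exact hq _ (by omega) (by omega)
      · intro j
        rw [← List.rotate_rotate]
        have hpr : ((u ++ [x]).rotate j ++ y :: t).Perm w := by
          refine List.Perm.trans ?_ hp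
          have := ((u ++ [x]).rotate_perm j).append_right (y :: t)
          simpa using this
        have hll : ((u ++ [x]).rotate j).length = u.length + 1 := by simp
        generalize (u ++ [x]).rotate j = v at hpr hll
        have hnd : (v ++ y :: t).Nodup := hpr.nodup_iff.2 hw
        cases v with
        | nil => simp at hll
        | cons a m =>
          simp only [List.rotate_cons_succ, List.rotate_zero]
          induction m using List.reverseRecOn with
          | nil =>
            have hu : u.length = 0 := by simpa using hll.symm
            have e1 := hgc [] a
            simp only [List.nil_append] at e1 ⊢
            rw [e1, hu, partCyc_nil]
            have h2 := ih [a] y (by simpa using hpr)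
            rw [h.partCyc_singleton, smul_mul_assoc] at h2
            rw [one_mul, pathForm_cons_cons, pow_zero, mul_one]
            rwa [sub_smul, one_smul] at h2
          | append_singleton m b _ =>
            have hml : u.length = m.length + 1 := by simpa using hll.symm
            have e1 : g (a :: (m ++ [b])) = partCyc e q (a :: m) b * pathForm e (b :: y :: t) := by
              have := hgc (a :: m) b
              simpa using this
            rw [e1, hgc, hml]
            have h2 := ih (a :: (m ++ [b])) y hpr
            have hd := hnd
            simp only [List.cons_append, List.append_assoc, List.nodup_cons, List.mem_append,
              List.mem_cons, not_or, List.nodup_append] at hd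
            have hab : a ≠ b := by tauto
            have hay : a ≠ y := by tauto
            have hby : b ≠ y := by tauto
            rw [h.partCyc_rec q a b y m hab hay hby, sub_mul, smul_mul_assoc, mul_assoc,
              mul_assoc] at h2
            simpa only [pathForm_cons_cons] using h2
  cases w with
  | nil => exact absurd rfl hne
  | cons x t =>
    have := main t [] x (by simp)
    simpa [partCyc_nil] using this

end Arnold

/-! ## Logarithmic forms of hyperplanes -/

section Log

variable {r n : ℕ}

/-- The space of differential `1`-forms. -/
def oneForms (r n : ℕ) : Submodule ℂ (Form r n) :=
  LinearMap.range ((ExteriorAlgebra.ι ℂ (M := Module.Dual ℂ (Fin n → ℂ))).compLeft (T r n))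

theorem oneForms_anti (x : Form r n) (hx : x ∈ oneForms r n) (y : Form r n)
    (hy : y ∈ oneForms r n) : x * y = -(y * x) := by
  obtain ⟨v, rfl⟩ := hx
  obtain ⟨w, rfl⟩ := hy
  funext z
  exact eq_neg_of_add_eq_zero_left (ExteriorAlgebra.ι_add_mul_swap _ _)

/-- The logarithmic form `dL / L` of a linear form `L`. -/
def logForm (r : ℕ) {n : ℕ} (L : Module.Dual ℂ (Fin n → ℂ)) : Form r n :=
  fun z => (L z.1)⁻¹ • ExteriorAlgebra.ι ℂ L

theorem logForm_mem (L : Module.Dual ℂ (Fin n → ℂ)) : logForm r L ∈ oneForms r n :=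
  ⟨fun z => (L z.1)⁻¹ • L, by funext z; simp [logForm]⟩

theorem logForm_smul {c : ℂ} (hc : c ≠ 0) (L : Module.Dual ℂ (Fin n → ℂ)) :
    logForm r (c • L) = logForm r L := by
  funext z
  simp only [logForm, LinearMap.smul_apply, map_smul, smul_smul, smul_eq_mul, mul_inv]
  congr 1
  field_simp

theorem logForm_neg (L : Module.Dual ℂ (Fin n → ℂ)) : logForm r (-L) = logForm r L := by
  rw [← logForm_smul (neg_ne_zero.2 one_ne_zero) L]; simp

theorem logForm_mul_self (L : Module.Dual ℂ (Fin n → ℂ)) : logForm r L * logForm r L = 0 := by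
  funext z
  simp [logForm]

/-- Arnold's relation. -/
theorem logForm_arnold (L M : Module.Dual ℂ (Fin n → ℂ)) (hL : ∀ z ∈ T r n, L z ≠ 0)
    (hM : ∀ z ∈ T r n, M z ≠ 0) (hLM : ∀ z ∈ T r n, (L + M) z ≠ 0) :
    logForm r (L + M) * logForm r M =
      logForm r L * logForm r M + logForm r (L + M) * logForm r L := by
  funext z
  have h1 := hL z.1 z.2
  have h2 := hM z.1 z.2
  have h3 := hLM z.1 z.2
  have hsq : ∀ v : Module.Dual ℂ (Fin n → ℂ), ExteriorAlgebra.ι ℂ v * ExteriorAlgebra.ι ℂ v = 0 :=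
    fun v => ExteriorAlgebra.ι_sq_zero v
  have hsw : ExteriorAlgebra.ι ℂ M * ExteriorAlgebra.ι ℂ L =
      -(ExteriorAlgebra.ι ℂ L * ExteriorAlgebra.ι ℂ M) :=
    eq_neg_of_add_eq_zero_left (ExteriorAlgebra.ι_add_mul_swap _ _)
  simp only [logForm, Pi.mul_apply, Pi.add_apply, map_add, smul_mul_smul_comm, add_mul, hsq, hsw,
    add_zero, zero_add, smul_neg]
  rw [← sub_eq_add_neg, ← sub_smul]
  congr 1
  rw [LinearMap.add_apply] at h3 ⊢
  field_simp
  ring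

/-- The `i`-th coordinate as a linear form. -/
def coord {n : ℕ} (i : Fin n) : Module.Dual ℂ (Fin n → ℂ) := LinearMap.proj i

@[simp] theorem coord_apply (i : Fin n) (z : Fin n → ℂ) : coord i z = z i := rfl

theorem omega_eq (i : Fin n) : omega r n i = logForm r (coord i) := rfl

theorem omega₂_eq (i j : Fin n) (η : rootsOfUnity r ℂ) :
    omega₂ r n i j η = logForm r (coord i - ((η : ℂˣ) : ℂ) • coord j) := by
  funext z
  simp [omega₂, logForm, dz, coord]

theorem omega₂_symm (i j : Fin n) (η : rootsOfUnity r ℂ) :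
    omega₂ r n i j η = omega₂ r n j i η⁻¹ := by
  have h : ((η : ℂˣ) : ℂ) ≠ 0 := Units.ne_zero _
  have e : coord i - ((η : ℂˣ) : ℂ) • coord j =
      (-((η : ℂˣ) : ℂ)) • (coord j - ((η⁻¹ : rootsOfUnity r ℂ) : ℂˣ) • coord i) := by
    rw [smul_sub, Units.smul_def, smul_smul, Subgroup.coe_inv, Units.val_inv_eq_inv_val, neg_mul,
      mul_inv_cancel₀ h, neg_one_smul, neg_smul]
    abel
  rw [omega₂_eq, omega₂_eq, e, logForm_smul (neg_ne_zero.2 h)]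
  rfl

theorem omega_mem (i : Fin n) : omega r n i ∈ oneForms r n := by
  rw [omega_eq]; exact logForm_mem _

theorem omega₂_mem (i j : Fin n) (η : rootsOfUnity r ℂ) : omega₂ r n i j η ∈ oneForms r n := by
  rw [omega₂_eq]; exact logForm_mem _

theorem sub_ne_zero_of_mem {z : Fin n → ℂ} (hz : z ∈ T r n) {i j : Fin n} (hij : i ≠ j)
    (η : rootsOfUnity r ℂ) : z i - ((η : ℂˣ) : ℂ) * z j ≠ 0 := by
  intro h
  refine hz.2 i j hij ?_
  rw [sub_eq_zero.1 h, mul_pow, root_pow, one_mul]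

theorem coord_sub_ne_zero {z : Fin n → ℂ} (hz : z ∈ T r n) {i j : Fin n} (hij : i ≠ j)
    (η : rootsOfUnity r ℂ) : (coord i - ((η : ℂˣ) : ℂ) • coord j) z ≠ 0 := by
  simpa using sub_ne_zero_of_mem hz hij η

/-- The forms `dlog (z_i - z_j)`. -/
def diag (r n : ℕ) (i j : Fin n) : Form r n := omega₂ r n i j 1

theorem diag_eq (i j : Fin n) : diag r n i j = logForm r (coord i - coord j) := by
  rw [diag, omega₂_eq]; simp

theorem isArnold_diag : IsArnold (oneForms r n) (diag r n) where
  anti := oneForms_anti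
  mem i j := omega₂_mem i j 1
  symm i j := by rw [diag, omega₂_symm, inv_one, diag]
  arnold x y z hxy hyz hxz := by
    have h : ∀ i j : Fin n, i ≠ j → ∀ z ∈ T r n, (coord i - coord j) z ≠ 0 := by
      intro i j hij z hz
      simpa using sub_ne_zero_of_mem hz hij 1
    rw [diag_eq, diag_eq, diag_eq]
    have := logForm_arnold (r := r) (coord x - coord y) (coord y - coord z) (h x y hxy) (h y z hyz)
      (by rw [sub_add_sub_cancel]; exact h x z hxz)
    rwa [sub_add_sub_cancel] at this

/-- Next to an edge joining `i` and `j`, replacing `ω_i` by `ω_j` costs only a product of two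
closed-root forms, a term deeper in the filtration. -/
theorem diag_mul_omega_sub (i j : Fin n) (hij : i ≠ j) :
    diag r n i j * omega r n i - diag r n i j * omega r n j = -(omega r n i * omega r n j) := by
  have h := logForm_arnold (r := r) (coord i - coord j) (coord j)
    (fun z hz => by simpa using sub_ne_zero_of_mem hz hij 1) (fun z hz => hz.1 j)
    (fun z hz => by simpa using hz.1 i)
  rw [sub_add_cancel, ← omega_eq, ← omega_eq, ← diag_eq] at h
  have h' : omega r n i * diag r n i j = -(diag r n i j * omega r n i) :=
    oneForms_anti _ (omega_mem i) _ (omega₂_mem i j 1)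
  rw [h, h']
  abel

end Log

/-! ## Decreasing forests -/

section Dec

/-- The possible roles of the vertex `m` in a decreasing forest: open root, closed root, or start of
an edge to a smaller vertex. -/
abbrev Slot (r m : ℕ) : Type := Option (Option (Fin m × rootsOfUnity r ℂ))

/-- Decorated forests on `{0, …, m-1}` all of whose edges go from larger to smaller vertices. -/
def Dec (r : ℕ) : ℕ → Type
  | 0 => Unit
  | m + 1 => Dec r m × Slot r m

instance finite_dec (r : ℕ) [NeZero r] (m : ℕ) : Finite (Dec r m) := by
  induction m with
  | zero => exact inferInstanceAs (Finite Unit)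
  | succ m ih => exact inferInstanceAs (Finite (Dec r m × Slot r m))

variable {r n : ℕ}

/-- The linear form vanishing at the position which a slot assigns to the vertex `m`; the open root
is given the value `0`. -/
def slotPoint (m : ℕ) (h : m < n) : Option (Fin m × rootsOfUnity r ℂ) → Module.Dual ℂ (Fin n → ℂ)
  | none => 0
  | some (j, η) => ((η : ℂˣ) : ℂ) • coord (Fin.castLT j (j.2.trans h))

/-- The factor of a vertex. -/
def slotForm (m : ℕ) (h : m < n) : Slot r m → Form r n
  | none => 1
  | some x => logForm r (coord ⟨m, h⟩ - slotPoint m h x)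

/-- The differential form of a decreasing forest. -/
def decForm : ∀ m : ℕ, m ≤ n → Dec r m → Form r n
  | 0, _, _ => 1
  | m + 1, h, d => decForm m (Nat.le_of_succ_le h) d.1 * slotForm m h d.2

theorem decForm_succ (m : ℕ) (h : m + 1 ≤ n) (d : Dec r m) (s : Slot r m) :
    decForm (m + 1) h ((d, s) : Dec r m × Slot r m) =
      decForm m (Nat.le_of_succ_le h) d * slotForm m h s := rfl

/-- The argument `none` of `slotPoint` is the closed root, placed at the origin. The open root is
the outer `none` of `Slot` and contributes the factor `1`. -/
theorem slotForm_closed (m : ℕ) (h : m < n) :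
    slotForm (r := r) m h (some none) = omega r n ⟨m, h⟩ := by
  simp [slotForm, slotPoint, omega_eq]

theorem slotForm_edge (m : ℕ) (h : m < n) (j : Fin m) (η : rootsOfUnity r ℂ) :
    slotForm m h (some (some (j, η))) =
      omega₂ r n ⟨m, h⟩ (Fin.castLT j (j.2.trans h)) η := by
  rw [slotForm, slotPoint, omega₂_eq]

/-! ### Linear independence -/

/-- Contraction of exterior forms with the `v`-th coordinate vector field, from the right. -/
def contr {n : ℕ} (v : Fin n) : Cotangent n →ₗ[ℂ] Cotangent n :=
  (CliffordAlgebra.contractRight (Q := (0 : QuadraticForm ℂ (Module.Dual ℂ (Fin n → ℂ))))).flip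
    (LinearMap.applyₗ (Pi.single v 1))

theorem contr_one (v : Fin n) : contr v 1 = 0 :=
  CliffordAlgebra.contractRight_one _ _

theorem contr_mul_ι (v : Fin n) (x : Cotangent n) (L : Module.Dual ℂ (Fin n → ℂ)) :
    contr v (x * ExteriorAlgebra.ι ℂ L) =
      L (Pi.single v 1) • x - contr v x * ExteriorAlgebra.ι ℂ L :=
  CliffordAlgebra.contractRight_mul_ι _ _ _

/-- Forms which only involve the first `m` variables. -/
def basicForms (r n m : ℕ) : Submodule ℂ (Form r n) where
  carrier := {B | (∀ z z' : T r n, (∀ v : Fin n, v.1 < m → z.1 v = z'.1 v) → B z = B z') ∧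
    ∀ (v : Fin n), m ≤ v.1 → ∀ z, contr v (B z) = 0}
  add_mem' := by
    rintro a b ⟨h1, h2⟩ ⟨h3, h4⟩
    refine ⟨fun z z' h => ?_, fun v hv z => ?_⟩
    · rw [Pi.add_apply, Pi.add_apply, h1 z z' h, h3 z z' h]
    · rw [Pi.add_apply, map_add, h2 v hv z, h4 v hv z, add_zero]
  zero_mem' := ⟨fun _ _ _ => rfl, fun v hv z => by simp⟩
  smul_mem' := by
    rintro c a ⟨h1, h2⟩
    refine ⟨fun z z' h => ?_, fun v hv z => ?_⟩
    · rw [Pi.smul_apply, Pi.smul_apply, h1 z z' h]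
    · rw [Pi.smul_apply, map_smul, h2 v hv z, smul_zero]

theorem slotPoint_apply_eq (m : ℕ) (h : m < n) (x : Option (Fin m × rootsOfUnity r ℂ))
    {z z' : Fin n → ℂ} (hz : ∀ v : Fin n, v.1 < m → z v = z' v) :
    slotPoint m h x z = slotPoint m h x z' := by
  rcases x with _ | ⟨j, η⟩
  · rfl
  · simp only [slotPoint, LinearMap.smul_apply, coord_apply]
    rw [hz _ j.2]

theorem slotPoint_single (m : ℕ) (h : m < n) (x : Option (Fin m × rootsOfUnity r ℂ))
    (v : Fin n) (hv : m ≤ v.1) : slotPoint m h x (Pi.single v 1) = 0 := by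
  rcases x with _ | ⟨j, η⟩
  · rfl
  · simp only [slotPoint, LinearMap.smul_apply, coord_apply]
    rw [Pi.single_eq_of_ne, smul_zero]
    intro hh
    have h1 := congrArg Fin.val hh
    have h2 := j.2
    simp only [Fin.val_castLT] at h1
    omega

/-- Contraction removes the last one-form and leaves a scalar rational function times `B`, so that
relations between forms become partial fraction identities. -/
theorem contr_mul_logForm {B : Form r n} {z : T r n} (v : Fin n) (hB : contr v (B z) = 0)
    (L : Module.Dual ℂ (Fin n → ℂ)) :
    contr v ((B * logForm r L) z) = ((L z.1)⁻¹ * L (Pi.single v 1)) • B z := by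
  have : (B * logForm r L) z = (L z.1)⁻¹ • (B z * ExteriorAlgebra.ι ℂ L) := by
    simp only [Pi.mul_apply, logForm, mul_smul_comm]
  rw [this, map_smul, contr_mul_ι, hB, zero_mul, sub_zero, smul_smul]

theorem decForm_mem_basicForms (m : ℕ) (h : m ≤ n) (d : Dec r m) :
    decForm m h d ∈ basicForms r n m := by
  induction m with
  | zero =>
    refine ⟨fun _ _ _ => rfl, fun v _ z => ?_⟩
    exact contr_one v
  | succ m ih =>
    obtain ⟨d, s⟩ := d
    obtain ⟨h1, h2⟩ := ih (Nat.le_of_succ_le h) d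
    refine ⟨fun z z' hz => ?_, fun v hv z => ?_⟩
    · have e1 := h1 z z' fun v hv => hz v (hv.trans (Nat.lt_succ_self m))
      change decForm m _ d z * slotForm m h s z = decForm m _ d z' * slotForm m h s z'
      rw [e1]
      congr 1
      rcases s with _ | x
      · rfl
      · simp only [slotForm, logForm, LinearMap.sub_apply, coord_apply]
        rw [hz ⟨m, h⟩ (Nat.lt_succ_self m),
          slotPoint_apply_eq m h x (fun v hv => hz v (hv.trans (Nat.lt_succ_self m)))]
    · erw [decForm_succ]
      rcases s with _ | x
      · rw [slotForm, mul_one]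
        exact h2 v (Nat.le_of_succ_le hv) z
      · rw [slotForm, contr_mul_logForm _ (h2 v (Nat.le_of_succ_le hv) z)]
        have : (coord ⟨m, h⟩ - slotPoint m h x) (Pi.single v 1) = 0 := by
          rw [LinearMap.sub_apply, slotPoint_single m h x v (by omega),
            sub_zero, coord_apply, Pi.single_eq_of_ne]
          intro hh
          have := congrArg Fin.val hh
          simp only at this
          omega
        rw [this, mul_zero, zero_smul]

/-- Partial fractions with vector coefficients are unique. -/
theorem eq_zero_of_sum_inv_sub_smul {ι V : Type*} [Fintype ι] [AddCommGroup V] [Module ℂ V]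
    (p : ι → ℂ) (hp : Function.Injective p) (b : ι → V) (S : Set ℂ) (hS : S.Finite)
    (h : ∀ t ∉ S, ∑ x, (t - p x)⁻¹ • b x = 0) (x : ι) : b x = 0 := by
  classical
  rw [← Module.forall_dual_apply_eq_zero_iff ℂ]
  intro φ
  -- `P` is the sum with denominators cleared, after applying a functional. It has infinitely many
  -- roots, hence is zero, and evaluating it at `p x` isolates the coefficient of the pole at `p x`.
  set P : Polynomial ℂ := ∑ y, Polynomial.C (φ (b y)) *
    ∏ w ∈ Finset.univ.erase y, (Polynomial.X - Polynomial.C (p w)) with hP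
  have hP0 : P = 0 := by
    refine Polynomial.eq_zero_of_infinite_isRoot P ?_
    refine Set.Infinite.mono ?_ ((hS.union (Set.finite_range p)).infinite_compl)
    intro t ht
    rw [Set.mem_compl_iff, Set.mem_union, not_or] at ht
    have h0 := congrArg φ (h t ht.1)
    simp only [map_sum, map_smul, smul_eq_mul, map_zero] at h0
    have hne : ∀ w, t - p w ≠ 0 := fun w hw => ht.2 ⟨w, (sub_eq_zero.1 hw).symm⟩
    change Polynomial.eval t P = 0
    rw [hP, Polynomial.eval_finsetSum]
    have : ∀ y ∈ Finset.univ, Polynomial.eval t (Polynomial.C (φ (b y)) *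
        ∏ w ∈ Finset.univ.erase y, (Polynomial.X - Polynomial.C (p w))) =
        (∏ w, (t - p w)) * ((t - p y)⁻¹ * φ (b y)) := by
      intro y _
      rw [← Finset.mul_prod_erase Finset.univ (fun w => t - p w) (Finset.mem_univ y)]
      simp only [Polynomial.eval_mul, Polynomial.eval_C, Polynomial.eval_prod, Polynomial.eval_sub,
        Polynomial.eval_X]
      have := hne y
      field_simp
    rw [Finset.sum_congr rfl this, ← Finset.mul_sum, h0, mul_zero]
  have h1 := congrArg (Polynomial.eval (p x)) hP0
  rw [hP, Polynomial.eval_finsetSum, Polynomial.eval_zero,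
    Finset.sum_eq_single x] at h1
  · simp only [Polynomial.eval_mul, Polynomial.eval_C, Polynomial.eval_prod, Polynomial.eval_sub,
      Polynomial.eval_X] at h1
    refine (mul_eq_zero.1 h1).resolve_right ?_
    change ∏ w ∈ Finset.univ.erase x, (p x - p w) ≠ 0
    rw [Finset.prod_ne_zero_iff]
    intro w hw hh
    exact (Finset.mem_erase.1 hw).1 (hp (sub_eq_zero.1 hh)).symm
  · intro y _ hy
    rw [Polynomial.eval_mul, Polynomial.eval_prod,
      Finset.prod_eq_zero (Finset.mem_erase.2 ⟨Ne.symm hy, Finset.mem_univ x⟩) (by simp), mul_zero]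
  · simp

/-- The points are the poles in the coordinate `z_m`. Taking `r`-th powers recovers the vertex,
because the `z_j ^ r` are distinct on `T`; then the label is determined since `z_j` is nonzero. -/
theorem slotPoint_injective (m : ℕ) (h : m < n) {z : Fin n → ℂ} (hz : z ∈ T r n) :
    Function.Injective fun x : Option (Fin m × rootsOfUnity r ℂ) => slotPoint m h x z := by
  have hne : ∀ (j : Fin m) (η : rootsOfUnity r ℂ), slotPoint m h (some (j, η)) z ≠ 0 := by
    intro j η
    simp only [slotPoint, LinearMap.smul_apply, coord_apply]
    exact mul_ne_zero (Units.ne_zero _) (hz.1 _)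
  rintro (_ | ⟨j, η⟩) (_ | ⟨j', η'⟩) hh
  · rfl
  · exact absurd hh.symm (hne _ _)
  · exact absurd hh (hne _ _)
  · simp only [slotPoint, LinearMap.smul_apply, coord_apply, smul_eq_mul] at hh
    have hj : j = j' := by
      by_contra hj
      refine hz.2 (Fin.castLT j (j.2.trans h)) (Fin.castLT j' (j'.2.trans h)) ?_ ?_
      · intro he
        exact hj (Fin.ext (by simpa using congrArg Fin.val he))
      · have := congrArg (· ^ r) hh
        simpa [mul_pow, root_pow] using this
    subst hj
    have := mul_right_cancel₀ (hz.1 _) hh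
    rw [Units.val_inj, Subtype.val_inj] at this
    rw [this]

variable [NeZero r]

theorem update_mem_T {z : Fin n → ℂ} (hz : z ∈ T r n) (v : Fin n) :
    ∃ S : Set ℂ, S.Finite ∧ ∀ t ∉ S, Function.update z v t ∈ T r n := by
  -- The index `j = v` is included in the union as well, which excludes only finitely many further
  -- values.
  refine ⟨{0} ∪ ⋃ j : Fin n, {t | t ^ r = z j ^ r}, ?_, ?_⟩
  · refine (Set.finite_singleton 0).union (Set.finite_iUnion fun j => ?_)
    have hp : (Polynomial.X ^ r - Polynomial.C (z j ^ r) : Polynomial ℂ) ≠ 0 :=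
      Polynomial.X_pow_sub_C_ne_zero (Nat.pos_of_ne_zero (NeZero.ne r)) _
    refine (Polynomial.finite_setOfPred_isRoot hp).subset fun t ht => ?_
    simpa [sub_eq_zero] using ht
  · intro t ht
    simp only [Set.singleton_union, Set.mem_insert_iff, Set.mem_iUnion, Set.mem_ofPred_eq, not_or,
      not_exists] at ht
    refine ⟨fun i => ?_, fun i j hij => ?_⟩
    · rcases eq_or_ne i v with rfl | hi
      · simpa using ht.1
      · simpa [hi] using hz.1 i
    · rcases eq_or_ne i v with rfl | hi
      · simpa [hij.symm] using ht.2 j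
      · rcases eq_or_ne j v with rfl | hj
        · simpa [hi] using fun hh => ht.2 i hh.symm
        · simpa [hi, hj] using hz.2 i j hij

theorem T_nonempty (r n : ℕ) [NeZero r] : (T r n).Nonempty := by
  refine ⟨fun i => ((i.1 + 1 : ℕ) : ℂ), fun i => Nat.cast_ne_zero.2 (Nat.succ_ne_zero _), ?_⟩
  intro i j hij h
  have h' : (i.1 + 1) ^ r = (j.1 + 1) ^ r := by
    beta_reduce at h
    exact_mod_cast h
  have := Nat.pow_left_injective (NeZero.ne r) h'
  exact hij (Fin.ext (by simpa using this))

/-- Contraction with the field of the `m`-th coordinate kills the open-root term. With that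
coordinate as a free variable `t`, what remains is a partial fraction expansion whose vector
coefficients `B (some x) z` do not depend on `t`. -/
theorem eq_zero_of_sum_mul_slotForm (m : ℕ) (h : m < n) [Fintype (Slot r m)]
    (B : Slot r m → Form r n) (hB : ∀ s, B s ∈ basicForms r n m)
    (hsum : ∑ s, B s * slotForm m h s = 0) (s : Slot r m) : B s = 0 := by
  classical
  have : Fintype (Option (Fin m × rootsOfUnity r ℂ)) := Fintype.ofFinite _
  obtain rfl := Subsingleton.elim ‹Fintype (Slot r m)› instFintypeOption
  have hsum' : B none + ∑ x, B (some x) * logForm r (coord ⟨m, h⟩ - slotPoint m h x) = 0 := by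
    rw [← hsum, Fintype.sum_option]
    simp [slotForm]
  have hx : ∀ x, B (some x) = 0 := by
    intro x
    funext z
    obtain ⟨S, hS, hT⟩ := update_mem_T z.2 ⟨m, h⟩
    refine eq_zero_of_sum_inv_sub_smul (fun x => slotPoint m h x z.1)
      (slotPoint_injective m h z.2) (fun x => B (some x) z) S hS (fun t ht => ?_) x
    set z' : T r n := ⟨_, hT t ht⟩ with hz'
    have hag : ∀ v : Fin n, v.1 < m → z'.1 v = z.1 v := by
      intro v hv
      have : v ≠ ⟨m, h⟩ := by rintro rfl; exact lt_irrefl _ hv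
      simp [hz', this]
    have h0 := congrArg (fun F : Form r n => contr ⟨m, h⟩ (F z')) hsum'
    simp only [Pi.add_apply, map_add, Finset.sum_apply, map_sum, Pi.zero_apply, map_zero] at h0
    rw [(hB none).2 ⟨m, h⟩ le_rfl z', zero_add] at h0
    rw [← h0]
    refine Finset.sum_congr rfl fun y _ => ?_
    rw [contr_mul_logForm _ ((hB (some y)).2 ⟨m, h⟩ le_rfl z'), (hB (some y)).1 z' z hag]
    congr 1
    rw [LinearMap.sub_apply, LinearMap.sub_apply,
      slotPoint_single m h y _ le_rfl, slotPoint_apply_eq m h y hag]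
    simp [hz']
  rcases s with _ | x
  · simpa [hx] using hsum'
  · exact hx x

/-- A relation is grouped by the slot of the last vertex. Each group vanishes separately and is a
relation between forests on fewer vertices. -/
theorem linearIndependent_decForm (m : ℕ) (h : m ≤ n) :
    LinearIndependent ℂ (decForm (r := r) m h) := by
  induction m with
  | zero =>
    have : Nonempty (T r n) := (T_nonempty r n).to_subtype
    have : Unique (Dec r 0) := inferInstanceAs (Unique Unit)
    rw [linearIndependent_unique_iff]
    exact one_ne_zero
  | succ m ih =>
    have hm := ih (Nat.le_of_succ_le h)
    have : Fintype (Dec r m) := Fintype.ofFinite _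
    have : Fintype (Slot r m) := Fintype.ofFinite _
    let _ : Fintype (Dec r (m + 1)) := inferInstanceAs (Fintype (Dec r m × Slot r m))
    rw [Fintype.linearIndependent_iff] at hm ⊢
    intro g hg ⟨d, s⟩
    refine hm (fun d => g (d, s)) ?_ d
    refine eq_zero_of_sum_mul_slotForm m h
      (fun s => ∑ d, g (d, s) • decForm m (Nat.le_of_succ_le h) d) (fun s => ?_) ?_ s
    · exact Submodule.sum_mem _ fun d _ =>
        Submodule.smul_mem _ _ (decForm_mem_basicForms m _ d)
    · rw [← hg]
      simp only [Finset.sum_mul]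
      refine (Fintype.sum_prod_type_right (fun p : Dec r m × Slot r m => (g p •
        decForm m (Nat.le_of_succ_le h) p.1) * slotForm m h p.2)).symm.trans ?_
      refine Finset.sum_congr rfl fun p _ => ?_
      exact smul_mul_assoc _ _ _

end Dec

/-! ## The filtration in terms of decreasing forests -/

section Filtration

variable {r n : ℕ}

/-- The weight of a generator: `1` for `ω_i` and `0` for `ω_{i,j,η}`. -/
def slotWeight {m : ℕ} : Option (Fin m × rootsOfUnity r ℂ) → ℕ
  | none => 1
  | some _ => 0

/-- The degree of the form of a slot. -/
def slotDeg {m : ℕ} : Slot r m → ℕ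
  | none => 0
  | some _ => 1

/-- The number of closed roots of a slot. -/
def slotClosed {m : ℕ} : Slot r m → ℕ
  | none => 0
  | some x => slotWeight x

/-- The number of edges and closed roots of a decreasing forest. -/
def Dec.deg : ∀ m : ℕ, Dec r m → ℕ
  | 0, _ => 0
  | m + 1, d => Dec.deg m d.1 + slotDeg d.2

/-- The number of closed roots of a decreasing forest. -/
def Dec.closed : ∀ m : ℕ, Dec r m → ℕ
  | 0, _ => 0
  | m + 1, d => Dec.closed m d.1 + slotClosed d.2

/-- The span of the forms of decreasing forests with given degree and a lower bound on the number
of closed roots. -/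
def decSpan (m : ℕ) (h : m ≤ n) (p q : ℕ) : Submodule ℂ (Form r n) :=
  Submodule.span ℂ {x | ∃ d : Dec r m, Dec.deg m d = p ∧ q ≤ Dec.closed m d ∧ x = decForm m h d}

theorem decForm_mem_decSpan {m : ℕ} (h : m ≤ n) (d : Dec r m) {p q : ℕ} (hp : Dec.deg m d = p)
    (hq : q ≤ Dec.closed m d) : decForm m h d ∈ decSpan m h p q :=
  Submodule.subset_span ⟨d, hp, hq, rfl⟩

theorem decSpan_anti {m : ℕ} (h : m ≤ n) (p : ℕ) {q q' : ℕ} (hq : q ≤ q') :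
    decSpan (r := r) m h p q' ≤ decSpan m h p q :=
  Submodule.span_mono fun _ ⟨d, hd, hd', hx⟩ => ⟨d, hd, hq.trans hd', hx⟩

theorem mul_slotForm_mem {m : ℕ} (h : m + 1 ≤ n) (s : Slot r m) {p q : ℕ} {a : Form r n}
    (ha : a ∈ decSpan m (Nat.le_of_succ_le h) p q) :
    a * slotForm m h s ∈ decSpan (m + 1) h (p + slotDeg s) (q + slotClosed s) := by
  have := Submodule.apply_mem_span_image_of_mem_span (LinearMap.mulRight ℂ (slotForm m h s)) ha
  rw [LinearMap.mulRight_apply] at this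
  refine Submodule.span_mono ?_ this
  rintro _ ⟨_, ⟨d, hp, hq, rfl⟩, rfl⟩
  exact ⟨((d, s) : Dec r m × Slot r m), congrArg (· + slotDeg s) hp,
    Nat.add_le_add_right hq (slotClosed s), rfl⟩

/-- The generators of the Orlik–Solomon algebra involving the first `m` variables only, with their
weights. -/
inductive IsGen (r n m : ℕ) : ℕ → Form r n → Prop
  | omega (i : Fin n) (hi : i.1 < m) : IsGen r n m 1 (omega r n i)
  | omega₂ (i j : Fin n) (η : rootsOfUnity r ℂ) (hij : i ≠ j) (hi : i.1 < m) (hj : j.1 < m) :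
      IsGen r n m 0 (omega₂ r n i j η)

theorem IsGen.mem {m w : ℕ} {g : Form r n} (hg : IsGen r n m w g) : g ∈ oneForms r n := by
  cases hg with
  | omega i => exact omega_mem i
  | omega₂ i j η => exact omega₂_mem i j η

theorem slotForm_some_mem (m : ℕ) (h : m < n) (x : Option (Fin m × rootsOfUnity r ℂ)) :
    slotForm m h (some x) ∈ oneForms r n := logForm_mem _

theorem IsGen.succ {m w : ℕ} (h : m < n) {g : Form r n} (hg : IsGen r n (m + 1) w g) :
    IsGen r n m w g ∨ ∃ x, g = slotForm m h (some x) ∧ w = slotWeight x := by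
  cases hg with
  | omega i hi =>
    rcases Nat.lt_succ_iff_lt_or_eq.1 hi with hi | hi
    · exact Or.inl (.omega i hi)
    · refine Or.inr ⟨none, ?_, rfl⟩
      rw [slotForm_closed]
      congr 1
      exact Fin.ext hi
  | omega₂ i j η hij hi hj =>
    rcases Nat.lt_succ_iff_lt_or_eq.1 hi with hi | hi
    · rcases Nat.lt_succ_iff_lt_or_eq.1 hj with hj | hj
      · exact Or.inl (.omega₂ i j η hij hi hj)
      · refine Or.inr ⟨some (⟨i.1, hi⟩, η⁻¹), ?_, rfl⟩
        rw [slotForm_edge, omega₂_symm]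
        congr 1
        exact Fin.ext hj
    · have hj' : j.1 < m := by
        rcases Nat.lt_succ_iff_lt_or_eq.1 hj with hj | hj
        · exact hj
        · exact absurd (Fin.ext (hi.trans hj.symm)) hij
      refine Or.inr ⟨some (⟨j.1, hj'⟩, η), ?_, rfl⟩
      rw [slotForm_edge]
      congr 1
      exact Fin.ext hi

/-- The coefficient which Arnold's relation produces from two slots is again a generator in the
earlier variables. Its weight dominates both weights: a closed root among the two slots makes it an
`ω_j`. This keeps closed roots from being lost. -/
theorem isGen_slotPoint_sub {m : ℕ} (h : m < n) (x y : Option (Fin m × rootsOfUnity r ℂ))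
    (hxy : x ≠ y) : ∃ w, IsGen r n m w (logForm r (slotPoint m h x - slotPoint m h y)) ∧
      slotWeight x ≤ w ∧ slotWeight y ≤ w := by
  have hu : ∀ η : rootsOfUnity r ℂ, ((η : ℂˣ) : ℂ) ≠ 0 := fun η => Units.ne_zero _
  rcases x with _ | ⟨i, η⟩ <;> rcases y with _ | ⟨j, θ⟩
  · exact absurd rfl hxy
  · refine ⟨1, ?_, le_rfl, Nat.zero_le _⟩
    rw [slotPoint, slotPoint, zero_sub, logForm_neg, logForm_smul (hu θ), ← omega_eq]
    exact .omega _ j.2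
  · refine ⟨1, ?_, Nat.zero_le _, le_rfl⟩
    rw [slotPoint, slotPoint, sub_zero, logForm_smul (hu η), ← omega_eq]
    exact .omega _ i.2
  · rcases eq_or_ne i j with rfl | hij
    · have hne : ((η : ℂˣ) : ℂ) - ((θ : ℂˣ) : ℂ) ≠ 0 := by
        intro hh
        rw [sub_eq_zero, Units.val_inj, Subtype.val_inj] at hh
        exact hxy (by rw [hh])
      refine ⟨1, ?_, Nat.zero_le _, Nat.zero_le _⟩
      rw [slotPoint, slotPoint, ← sub_smul, logForm_smul hne, ← omega_eq]
      exact .omega _ i.2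
    · refine ⟨0, ?_, le_rfl, le_rfl⟩
      have e : slotPoint m h (some (i, η)) - slotPoint m h (some (j, θ)) = ((η : ℂˣ) : ℂ) •
          (coord (Fin.castLT i (i.2.trans h)) - (((η⁻¹ * θ : rootsOfUnity r ℂ) : ℂˣ) : ℂ) •
            coord (Fin.castLT j (j.2.trans h))) := by
        rw [slotPoint, slotPoint, smul_sub, smul_smul, Subgroup.coe_mul, Subgroup.coe_inv,
          Units.val_mul, Units.val_inv_eq_inv_val, mul_inv_cancel_left₀ (hu η)]
      rw [e, logForm_smul (hu η), ← omega₂_eq]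
      refine .omega₂ _ _ _ (fun hh => hij ?_) i.2 j.2
      exact Fin.ext (by simpa using congrArg Fin.val hh)

/-- Arnold's relation for the hyperplanes of two slots of `m`: a product with two factors at `m`
becomes one with a single factor at `m` and one factor in smaller variables. -/
theorem slotForm_mul_slotForm [NeZero r] {m : ℕ} (h : m < n)
    (x y : Option (Fin m × rootsOfUnity r ℂ)) (hxy : x ≠ y) :
    slotForm m h (some y) * slotForm m h (some x) =
      logForm r (slotPoint m h x - slotPoint m h y) * slotForm m h (some x) -
      logForm r (slotPoint m h x - slotPoint m h y) * slotForm m h (some y) := by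
  have hne : ∀ x : Option (Fin m × rootsOfUnity r ℂ), ∀ z ∈ T r n,
      (coord ⟨m, h⟩ - slotPoint m h x) z ≠ 0 := by
    rintro (_ | ⟨j, η⟩) z hz
    · simpa [slotPoint] using hz.1 _
    · refine coord_sub_ne_zero hz (fun hh => ?_) η
      have h1 := congrArg Fin.val hh
      have h2 := j.2
      simp only [Fin.val_castLT] at h1
      omega
  have key := logForm_arnold (r := r) (slotPoint m h x - slotPoint m h y)
    (coord ⟨m, h⟩ - slotPoint m h x)
    (fun z hz hh => hxy (slotPoint_injective m h hz
      (by simpa only [LinearMap.sub_apply, sub_eq_zero] using hh)))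
    (hne x) (by simpa using hne y)
  have e : slotPoint m h x - slotPoint m h y + (coord ⟨m, h⟩ - slotPoint m h x) =
    coord ⟨m, h⟩ - slotPoint m h y := by abel
  rw [e] at key
  change logForm r _ * logForm r _ = _
  rw [key, oneForms_anti (logForm r (coord ⟨m, h⟩ - slotPoint m h y)) (logForm_mem _) _
    (logForm_mem _), ← sub_eq_add_neg]
  rfl

/-- Straightening, by induction on the number of variables. A generator in earlier variables passes
the last slot; one at the last vertex fills an open slot, squares to zero against an equal slot, or
is resolved by `slotForm_mul_slotForm`. -/
theorem decSpan_mul_isGen [NeZero r] (m : ℕ) (h : m ≤ n) {w : ℕ} {g : Form r n}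
    (hg : IsGen r n m w g) {p q : ℕ} {a : Form r n} (ha : a ∈ decSpan m h p q) :
    a * g ∈ decSpan m h (p + 1) (q + w) := by
  induction m generalizing w g p q a with
  | zero => cases hg <;> omega
  | succ m ih =>
    have hm := Nat.le_of_succ_le h
    suffices H : ∀ (d : Dec r m) (s : Slot r m),
        decForm m hm d * slotForm m h s * g ∈ decSpan (m + 1) h (Dec.deg m d + slotDeg s + 1)
          (Dec.closed m d + slotClosed s + w) by
      induction ha using Submodule.span_induction with
      | mem x hx =>
        obtain ⟨⟨d, s⟩, hp, hq, rfl⟩ := hx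
        have := H d s
        rw [← hp]
        exact decSpan_anti h _ (Nat.add_le_add_right hq w) this
      | zero => rw [zero_mul]; exact Submodule.zero_mem _
      | add x y _ _ hx hy => rw [add_mul]; exact Submodule.add_mem _ hx hy
      | smul c x _ hx => rw [smul_mul_assoc]; exact Submodule.smul_mem _ _ hx
    intro d s
    have hd : decForm m hm d ∈ decSpan m hm (Dec.deg m d) (Dec.closed m d) :=
      decForm_mem_decSpan hm d rfl le_rfl
    rcases hg.succ h with hg' | ⟨x, rfl, rfl⟩
    · have h1 := mul_slotForm_mem h s (ih hm hg' hd)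
      rcases s with _ | y
      · rw [slotForm, mul_one] at h1 ⊢
        exact h1
      · rw [mul_assoc, oneForms_anti _ (slotForm_some_mem m h y) _ hg'.mem, mul_neg, ← mul_assoc]
        refine Submodule.neg_mem _ ?_
        rwa [add_right_comm, add_right_comm _ _ w]
    · rcases s with _ | y
      · rw [slotForm, mul_one]
        exact mul_slotForm_mem h (some x) hd
      · rcases eq_or_ne x y with rfl | hxy
        · have : slotForm m h (some x) * slotForm m h (some x) = 0 := logForm_mul_self _
          rw [mul_assoc, this, mul_zero]
          exact Submodule.zero_mem _
        -- The surviving slot together with `w` carries at least the total weight of `x` and `y`, as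
        -- `w` bounds each of them.
        · obtain ⟨w, hw, hx, hy⟩ := isGen_slotPoint_sub h x y hxy
          rw [mul_assoc, slotForm_mul_slotForm h x y hxy, mul_sub, ← mul_assoc, ← mul_assoc]
          have h1 := ih hm hw hd
          refine Submodule.sub_mem _ ?_ ?_
          · refine decSpan_anti h _ ?_ (mul_slotForm_mem h (some x) h1)
            simp only [slotClosed]
            omega
          · refine decSpan_anti h _ ?_ (mul_slotForm_mem h (some y) h1)
            simp only [slotClosed]
            omega

/-- The multiplicative filtration of the Orlik–Solomon algebra by degree and number of closed
roots. -/
def multSpan (r n p q : ℕ) : Submodule ℂ (Form r n) where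
  carrier := {x | ∀ p' q', ∀ a ∈ decSpan n le_rfl p' q', a * x ∈ decSpan n le_rfl (p' + p) (q' + q)}
  add_mem' hx hy p' q' a ha := by
    rw [mul_add]; exact Submodule.add_mem _ (hx p' q' a ha) (hy p' q' a ha)
  zero_mem' p' q' a ha := by rw [mul_zero]; exact Submodule.zero_mem _
  smul_mem' c x hx p' q' a ha := by
    rw [mul_smul_comm]; exact Submodule.smul_mem _ _ (hx p' q' a ha)

theorem one_mem_multSpan : (1 : Form r n) ∈ multSpan r n 0 0 := fun p' q' a ha => by
  simpa using ha

theorem mul_mem_multSpan {p q p' q' : ℕ} {x y : Form r n} (hx : x ∈ multSpan r n p q)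
    (hy : y ∈ multSpan r n p' q') : x * y ∈ multSpan r n (p + p') (q + q') := fun p₀ q₀ a ha => by
  rw [← mul_assoc, ← add_assoc, ← add_assoc]
  exact hy _ _ _ (hx _ _ _ ha)

theorem multSpan_anti {p q q' : ℕ} (hq : q ≤ q') : multSpan r n p q' ≤ multSpan r n p q :=
  fun _ hx p₀ q₀ a ha => decSpan_anti _ _ (Nat.add_le_add_left hq q₀) (hx p₀ q₀ a ha)

theorem IsGen.mem_multSpan [NeZero r] {w : ℕ} {g : Form r n} (hg : IsGen r n n w g) :
    g ∈ multSpan r n 1 w := fun _ _ _ ha => decSpan_mul_isGen n le_rfl hg ha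

theorem omega_mem_multSpan [NeZero r] (i : Fin n) : omega r n i ∈ multSpan r n 1 1 :=
  (IsGen.omega i i.2).mem_multSpan

theorem omega₂_mem_multSpan [NeZero r] {i j : Fin n} (hij : i ≠ j) (η : rootsOfUnity r ℂ) :
    omega₂ r n i j η ∈ multSpan r n 1 0 :=
  (IsGen.omega₂ i j η hij i.2 j.2).mem_multSpan

theorem diag_mem_multSpan [NeZero r] (i j : Fin n) : diag r n i j ∈ multSpan r n 1 0 := by
  rcases eq_or_ne i j with rfl | hij
  · have : diag r n i i = 0 := by rw [diag_eq, sub_self]; funext z; simp [logForm]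
    rw [this]
    exact Submodule.zero_mem _
  · exact omega₂_mem_multSpan hij 1

/-- The decreasing forest consisting of open roots. -/
def Dec.openRoots : ∀ m : ℕ, Dec r m
  | 0 => ()
  | m + 1 => ((Dec.openRoots m, none) : Dec r m × Slot r m)

theorem one_mem_decSpan (m : ℕ) (h : m ≤ n) : (1 : Form r n) ∈ decSpan m h 0 0 := by
  refine Submodule.subset_span ⟨Dec.openRoots m, ?_, Nat.zero_le _, ?_⟩
  · induction m with
    | zero => rfl
    | succ m ih => exact ih (Nat.le_of_succ_le h)
  · induction m with
    | zero => rfl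
    | succ m ih =>
      rw [Dec.openRoots, decForm_succ, ← ih, one_mul]
      rfl

/-- The defining condition is applied to the empty product `1`. -/
theorem multSpan_le_decSpan (p q : ℕ) : multSpan r n p q ≤ decSpan n le_rfl p q := fun x hx => by
  have := hx 0 0 1 (one_mem_decSpan n le_rfl)
  simpa using this

/-! ### Comparison with the definition through decorated forests -/

open Classical in
theorem bareFactor_prod_mem [NeZero r] (F : Forest r n) (l : List (Fin n)) :
    (l.map F.bareFactor).prod ∈ multSpan r n
      ((l.map fun i => if F.kind i = Kind.openRoot then 0 else 1).sum)
      ((l.map fun i => if F.kind i = Kind.closedRoot then 1 else 0).sum) := by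
  induction l with
  | nil => exact one_mem_multSpan
  | cons i l ih =>
    simp only [List.map_cons, List.prod_cons, List.sum_cons]
    refine mul_mem_multSpan ?_ ih
    unfold Forest.bareFactor
    cases hk : F.kind i with
    | openRoot => simpa using one_mem_multSpan
    | closedRoot => simpa using omega_mem_multSpan i
    | edge j η =>
      have hij : i ≠ j := by
        rintro rfl
        exact F.acyclic i (Relation.TransGen.single ⟨η, hk⟩)
      simpa using omega₂_mem_multSpan hij η

theorem ncard_eq_sum (P : Fin n → Prop) [DecidablePred P] :
    {i | P i}.ncard = ((List.finRange n).map fun i => if P i then 1 else 0).sum := by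
  rw [← List.ofFn_eq_map, List.sum_ofFn, Finset.sum_boole, Set.ncard_eq_toFinset_card']
  simp

open Classical in
theorem numEdges_add_numClosed (F : Forest r n) : F.numEdges + F.numClosed =
    ((List.finRange n).map fun i => if F.kind i = Kind.openRoot then 0 else 1).sum := by
  unfold Forest.numEdges Forest.numClosed
  rw [ncard_eq_sum, ncard_eq_sum, ← List.sum_map_add]
  congr 1
  refine List.map_congr_left fun i _ => ?_
  unfold Forest.IsClosedRoot
  cases hk : F.kind i <;> simp

theorem alpha_eq_bareFactor_prod (F : Forest r n) : ∃ c : ℂ, c ≠ 0 ∧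
    F.alpha = c • ((List.finRange n).map F.bareFactor).prod := by
  obtain ⟨c, hc, h⟩ := F.prod_alphaFactor (List.finRange n)
  exact ⟨c, hc, by rw [Forest.alpha, List.ofFn_eq_map, h]⟩

theorem filtration_le_multSpan [NeZero r] (p q : ℕ) : filtration r n p q ≤ multSpan r n p q := by
  classical
  refine Submodule.span_le.2 ?_
  rintro _ ⟨F, hp, hq, rfl⟩
  obtain ⟨c, _, h⟩ := alpha_eq_bareFactor_prod F
  rw [h]
  refine Submodule.smul_mem _ _ ?_
  have := bareFactor_prod_mem F (List.finRange n)
  rw [← numEdges_add_numClosed, hp, ← ncard_eq_sum] at this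
  exact multSpan_anti hq this

/-- The role of the vertex `m` given by a slot. -/
def slotKind (m : ℕ) (h : m < n) : Slot r m → Kind r n
  | none => Kind.openRoot
  | some none => Kind.closedRoot
  | some (some (j, η)) => Kind.edge (Fin.castLT j (j.2.trans h)) η

/-- The roles of the vertices in a decreasing forest. -/
def decKind : ∀ m : ℕ, m ≤ n → Dec r m → Fin m → Kind r n
  | 0, _, _ => fun v => v.elim0
  | m + 1, h, d => Fin.snoc (α := fun _ => Kind r n) (decKind m (Nat.le_of_succ_le h) d.1)
      (slotKind m h d.2)

theorem decKind_lt (m : ℕ) (h : m ≤ n) (d : Dec r m) (v : Fin m) (j : Fin n)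
    (η : rootsOfUnity r ℂ) (hv : decKind m h d v = Kind.edge j η) : j.1 < v.1 := by
  induction m with
  | zero => exact v.elim0
  | succ m ih =>
    obtain ⟨d, s⟩ := d
    induction v using Fin.lastCases with
    | last =>
      simp only [decKind, Fin.snoc_last] at hv
      rcases s with _ | _ | ⟨i, θ⟩
      · simp [slotKind] at hv
      · simp [slotKind] at hv
      · simp only [slotKind, Kind.edge.injEq] at hv
        rw [← hv.1]
        exact i.2
    | cast v =>
      simp only [decKind, Fin.snoc_castSucc] at hv
      exact ih (Nat.le_of_succ_le h) d v hv

/-- A decreasing forest as a decorated forest. -/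
def Dec.toForest (d : Dec r n) : Forest r n where
  kind := decKind n le_rfl d
  acyclic i hi := by
    have : ∀ a b, Relation.TransGen (fun a b => ∃ η, decKind n le_rfl d a = Kind.edge b η) a b →
        b < a := by
      intro a b hab
      induction hab with
      | single hb =>
        obtain ⟨η, hb⟩ := hb
        exact decKind_lt n le_rfl d _ _ η hb
      | tail _ hb ih =>
        obtain ⟨η, hb⟩ := hb
        exact lt_trans (decKind_lt n le_rfl d _ _ η hb : _ < _) ih
    exact lt_irrefl _ (this i i hi)

/-- The form given by a role of a vertex. -/
def kindForm (v : Fin n) : Kind r n → Form r n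
  | Kind.openRoot => 1
  | Kind.closedRoot => omega r n v
  | Kind.edge j η => omega₂ r n v j η

theorem kindForm_slotKind (m : ℕ) (h : m < n) (s : Slot r m) :
    kindForm ⟨m, h⟩ (slotKind m h s) = slotForm m h s := by
  rcases s with _ | _ | ⟨i, θ⟩
  · rfl
  · rw [slotForm_closed]; rfl
  · rw [slotForm_edge]; rfl

theorem decForm_eq_prod (m : ℕ) (h : m ≤ n) (d : Dec r m) :
    decForm m h d = (List.ofFn fun v : Fin m =>
      kindForm (Fin.castLE h v) (decKind m h d v)).prod := by
  induction m with
  | zero => simp [decForm]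
  | succ m ih =>
    obtain ⟨d, s⟩ := d
    erw [decForm_succ]
    rw [List.ofFn_succ', List.concat_eq_append, List.prod_append, ih]
    simp only [decKind, Fin.snoc_castSucc, Fin.snoc_last, List.prod_singleton]
    congr 1
    exact (kindForm_slotKind m h s).symm

open Classical in
theorem deg_eq_sum (m : ℕ) (h : m ≤ n) (d : Dec r m) :
    Dec.deg m d = ∑ v, if decKind m h d v = Kind.openRoot then 0 else 1 := by
  induction m with
  | zero => simp [Dec.deg]
  | succ m ih =>
    obtain ⟨d, s⟩ := d
    rw [Fin.sum_univ_castSucc]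
    simp only [decKind, Fin.snoc_castSucc, Fin.snoc_last, Dec.deg]
    rw [ih (Nat.le_of_succ_le h)]
    congr 1
    rcases s with _ | _ | ⟨i, θ⟩ <;> simp [slotDeg, slotKind]

open Classical in
theorem closed_eq_sum (m : ℕ) (h : m ≤ n) (d : Dec r m) :
    Dec.closed m d = ∑ v, if decKind m h d v = Kind.closedRoot then 1 else 0 := by
  induction m with
  | zero => simp [Dec.closed]
  | succ m ih =>
    obtain ⟨d, s⟩ := d
    rw [Fin.sum_univ_castSucc]
    simp only [decKind, Fin.snoc_castSucc, Fin.snoc_last, Dec.closed]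
    rw [ih (Nat.le_of_succ_le h)]
    congr 1
    rcases s with _ | _ | ⟨i, θ⟩ <;> simp [slotClosed, slotWeight, slotKind]

theorem decSpan_le_filtration (p q : ℕ) : decSpan n le_rfl p q ≤ filtration r n p q := by
  classical
  refine Submodule.span_le.2 ?_
  rintro _ ⟨d, hp, hq, rfl⟩
  obtain ⟨c, hc, h⟩ := alpha_eq_bareFactor_prod d.toForest
  have h1 : ((List.finRange n).map d.toForest.bareFactor).prod = decForm n le_rfl d := by
    rw [decForm_eq_prod, ← List.ofFn_eq_map]
    congr 2
  have h2 : decForm n le_rfl d = c⁻¹ • d.toForest.alpha := by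
    rw [h, smul_smul, inv_mul_cancel₀ hc, one_smul, h1]
  rw [h2]
  refine Submodule.smul_mem _ _ (Submodule.subset_span ⟨_, ?_, ?_, rfl⟩)
  · rw [numEdges_add_numClosed, ← hp, deg_eq_sum n le_rfl, ← List.ofFn_eq_map, List.sum_ofFn]
    rfl
  · refine hq.trans (le_of_eq ?_)
    unfold Forest.numClosed Forest.IsClosedRoot
    rw [ncard_eq_sum, closed_eq_sum n le_rfl, ← List.ofFn_eq_map, List.sum_ofFn]
    rfl

/-- The inclusions `filtration ≤ multSpan ≤ decSpan ≤ filtration` close up. Thus one filtration is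
at once spanned by all forests, multiplicative, and equipped with a basis. -/
theorem filtration_eq_decSpan [NeZero r] (p q : ℕ) :
    filtration r n p q = decSpan n le_rfl p q :=
  le_antisymm ((filtration_le_multSpan p q).trans (multSpan_le_decSpan p q))
    (decSpan_le_filtration p q)

theorem filtration_eq_multSpan [NeZero r] (p q : ℕ) : filtration r n p q = multSpan r n p q :=
  le_antisymm (filtration_le_multSpan p q)
    ((multSpan_le_decSpan p q).trans (decSpan_le_filtration p q))

end Filtration

/-! ## The action of the wreath product -/

section Action

variable {r n : ℕ}

theorem formAct_logForm (g : W r n) (L : Module.Dual ℂ (Fin n → ℂ)) :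
    formAct r n g (logForm r L) = logForm r ((stdRep r n).dual g L) := by
  funext z
  change ExteriorAlgebra.map ((stdRep r n).dual g) ((L (stdRep r n g⁻¹ z.1))⁻¹ •
    ExteriorAlgebra.ι ℂ L) = _
  rw [map_smul, ExteriorAlgebra.map_apply_ι]
  rfl

theorem dual_coord (g : W r n) (i : Fin n) : (stdRep r n).dual g (coord i) =
    ((g.left (g.right i) : ℂˣ) : ℂ)⁻¹ • coord (g.right i) := by
  apply LinearMap.ext
  intro z
  change ((((g.left (g.right i))⁻¹ : rootsOfUnity r ℂ) : ℂˣ) : ℂ) * _ = _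
  rw [Subgroup.coe_inv, Units.val_inv_eq_inv_val]
  rfl

theorem formAct_omega (g : W r n) (i : Fin n) :
    formAct r n g (omega r n i) = omega r n (g.right i) := by
  rw [omega_eq, formAct_logForm, dual_coord, logForm_smul (inv_ne_zero (Units.ne_zero _)),
    omega_eq]

theorem formAct_omega₂ (g : W r n) (i j : Fin n) (η : rootsOfUnity r ℂ) :
    formAct r n g (omega₂ r n i j η) = omega₂ r n (g.right i) (g.right j)
      (η * g.left (g.right i) * (g.left (g.right j))⁻¹) := by
  rw [omega₂_eq, formAct_logForm, map_sub, map_smul, dual_coord, dual_coord, omega₂_eq]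
  have h : ((g.left (g.right i) : ℂˣ) : ℂ) ≠ 0 := Units.ne_zero _
  rw [← logForm_smul h]
  congr 1
  simp only [smul_sub, smul_smul, Subgroup.coe_mul, Subgroup.coe_inv, Units.val_mul,
    Units.val_inv_eq_inv_val]
  rw [mul_inv_cancel₀ h, one_smul]
  congr 2
  ring

/-- The element of `W(r,n)` given by an element of the torus. -/
abbrev tor (ζ : Fin n → rootsOfUnity r ℂ) : W r n := SemidirectProduct.inl ζ

/-- The element of `W(r,n)` given by a permutation. -/
abbrev prm (r : ℕ) {n : ℕ} (w : Equiv.Perm (Fin n)) : W r n := SemidirectProduct.inr w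

theorem formAct_tor_omega (ζ : Fin n → rootsOfUnity r ℂ) (i : Fin n) :
    formAct r n (tor ζ) (omega r n i) = omega r n i := formAct_omega _ _

theorem formAct_tor_omega₂ (ζ : Fin n → rootsOfUnity r ℂ) (i j : Fin n) (η : rootsOfUnity r ℂ) :
    formAct r n (tor ζ) (omega₂ r n i j η) = omega₂ r n i j (η * ζ i * (ζ j)⁻¹) :=
  formAct_omega₂ _ _ _ _

theorem formAct_prm_omega (w : Equiv.Perm (Fin n)) (i : Fin n) :
    formAct r n (prm r w) (omega r n i) = omega r n (w i) := formAct_omega _ _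

theorem formAct_prm_diag (w : Equiv.Perm (Fin n)) (i j : Fin n) :
    formAct r n (prm r w) (diag r n i j) = diag r n (w i) (w j) := by
  rw [diag, formAct_omega₂]
  simp [diag]

theorem formRep_apply (g : W r n) (x : Form r n) : formRep r n g x = formAct r n g x := rfl

theorem formAct_tor_mul (ζ ξ : Fin n → rootsOfUnity r ℂ) (x : Form r n) :
    formAct r n (tor (ζ * ξ)) x = formAct r n (tor ζ) (formAct r n (tor ξ) x) := by
  have h : (tor (ζ * ξ) : W r n) = tor ζ * tor ξ := map_mul _ _ _
  rw [← formRep_apply, h, map_mul]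
  rfl

/-! ### The torus action on decreasing forests -/

/-- The action of the torus on slots. -/
def slotAct (ζ : Fin n → rootsOfUnity r ℂ) (m : ℕ) (h : m < n) : Slot r m → Slot r m
  | none => none
  | some none => some none
  | some (some (j, η)) => some (some (j, η * ζ ⟨m, h⟩ * (ζ (Fin.castLT j (j.2.trans h)))⁻¹))

/-- The action of the torus on decreasing forests. -/
def Dec.act (ζ : Fin n → rootsOfUnity r ℂ) : ∀ m : ℕ, m ≤ n → Dec r m → Dec r m
  | 0, _, d => d
  | m + 1, h, d => ((Dec.act ζ m (Nat.le_of_succ_le h) d.1, slotAct ζ m h d.2) :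
      Dec r m × Slot r m)

theorem formAct_slotForm (ζ : Fin n → rootsOfUnity r ℂ) (m : ℕ) (h : m < n) (s : Slot r m) :
    formAct r n (tor ζ) (slotForm m h s) = slotForm m h (slotAct ζ m h s) := by
  rcases s with _ | _ | ⟨j, η⟩
  · exact map_one _
  · rw [slotAct, slotForm_closed, formAct_tor_omega]
  · rw [slotAct, slotForm_edge, slotForm_edge, formAct_tor_omega₂]

theorem formAct_decForm (ζ : Fin n → rootsOfUnity r ℂ) (m : ℕ) (h : m ≤ n) (d : Dec r m) :
    formAct r n (tor ζ) (decForm m h d) = decForm m h (Dec.act ζ m h d) := by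
  induction m with
  | zero => exact map_one _
  | succ m ih =>
    obtain ⟨d, s⟩ := d
    erw [decForm_succ, decForm_succ]
    rw [map_mul, ih, formAct_slotForm]

/-- Replace all labels by `1`. -/
def slotPlain {m : ℕ} : Slot r m → Slot r m
  | none => none
  | some none => some none
  | some (some (j, _)) => some (some (j, 1))

/-- Replace all labels by `1`. -/
def Dec.plain : ∀ m : ℕ, Dec r m → Dec r m
  | 0, d => d
  | m + 1, d => ((Dec.plain m d.1, slotPlain d.2) : Dec r m × Slot r m)

theorem Dec.plain_act (ζ : Fin n → rootsOfUnity r ℂ) (m : ℕ) (h : m ≤ n) (d : Dec r m) :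
    Dec.plain m (Dec.act ζ m h d) = Dec.plain m d := by
  induction m with
  | zero => rfl
  | succ m ih =>
    obtain ⟨d, s⟩ := d
    refine Prod.ext (ih _ d) ?_
    rcases s with _ | _ | ⟨j, η⟩ <;> rfl

theorem Dec.act_congr {ζ ζ' : Fin n → rootsOfUnity r ℂ} (m : ℕ) (h : m ≤ n)
    (hζ : ∀ v : Fin n, v.1 < m → ζ v = ζ' v) (d : Dec r m) :
    Dec.act ζ m h d = Dec.act ζ' m h d := by
  induction m with
  | zero => rfl
  | succ m ih =>
    obtain ⟨d, s⟩ := d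
    refine Prod.ext (ih _ (fun v hv => hζ v (hv.trans (Nat.lt_succ_self m))) d) ?_
    rcases s with _ | _ | ⟨j, η⟩
    · rfl
    · rfl
    · change slotAct ζ m h (some (some (j, η))) = slotAct ζ' m h (some (some (j, η)))
      rw [slotAct, slotAct, hζ ⟨m, h⟩ (Nat.lt_succ_self m),
        hζ (Fin.castLT j (j.2.trans h)) (j.2.trans (Nat.lt_succ_self m))]

/-- A forest has no cycles, so its labels can be prescribed one vertex at a time: the torus
coordinate at a vertex is free when its edge is reached. -/
theorem Dec.exists_act_plain (m : ℕ) (h : m ≤ n) (d : Dec r m) :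
    ∃ ζ : Fin n → rootsOfUnity r ℂ, Dec.act ζ m h (Dec.plain m d) = d := by
  induction m with
  | zero => exact ⟨1, rfl⟩
  | succ m ih =>
    obtain ⟨d, s⟩ := d
    obtain ⟨ζ, hζ⟩ := ih (Nat.le_of_succ_le h) d
    have hlt : ∀ (t : rootsOfUnity r ℂ) (v : Fin n), v.1 < m →
        Function.update ζ ⟨m, h⟩ t v = ζ v := by
      intro t v hv
      refine Function.update_of_ne ?_ _ _
      rintro rfl
      exact lt_irrefl _ hv
    have key : ∀ t : rootsOfUnity r ℂ,
        Dec.act (Function.update ζ ⟨m, h⟩ t) m (Nat.le_of_succ_le h) (Dec.plain m d) = d :=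
      fun t => (Dec.act_congr m _ (hlt t) _).trans hζ
    rcases s with _ | _ | ⟨j, η⟩
    · exact ⟨_, Prod.ext (key 1) rfl⟩
    · exact ⟨_, Prod.ext (key 1) rfl⟩
    -- The torus coordinate at `m` is `η` times that of the target, because the label changes by the
    -- quotient of the two.
    · refine ⟨_, Prod.ext (key (η * ζ (Fin.castLT j (j.2.trans h)))) ?_⟩
      change some (some (j, 1 * Function.update ζ ⟨m, h⟩ (η * ζ (Fin.castLT j (j.2.trans h)))
        ⟨m, h⟩ * (Function.update ζ ⟨m, h⟩ (η * ζ (Fin.castLT j (j.2.trans h)))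
          (Fin.castLT j (j.2.trans h)))⁻¹)) = some (some (j, η))
      rw [Function.update_self, hlt _ _ j.2, one_mul, mul_inv_cancel_right]

/-! ### The projection to the isotypic component -/

/-- The character `ζ ↦ ∏ ζ_i^s` of the torus. -/
def torChar (s : ℤ) : (Fin n → rootsOfUnity r ℂ) →* ℂˣ where
  toFun ζ := ∏ i, (ζ i : ℂˣ) ^ s
  map_one' := by simp
  map_mul' ζ ξ := by simp [mul_zpow, Finset.prod_mul_distrib]

theorem coe_torChar_inv (s : ℤ) (ζ : Fin n → rootsOfUnity r ℂ) :
    (((torChar s ζ)⁻¹ : ℂˣ) : ℂ) = ∏ i, ((ζ i : ℂˣ) : ℂ) ^ (-s) := by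
  simp [torChar, Units.coe_prod]

/-- The class in `A^{k,l}` of an element of the filtration. -/
def mkA (r n k l : ℕ) : filtration r n (k + l) l →ₗ[ℂ] A r n k l := Submodule.mkQ _

theorem repA_mkA (k l : ℕ) (g : W r n) (x : filtration r n (k + l) l) :
    repA r n k l g (mkA r n k l x) =
      mkA r n k l ⟨formRep r n g x.1, filtration_stable r n _ _ g x.2⟩ := rfl

theorem mkA_eq_zero (k l : ℕ) (x : filtration r n (k + l) l) :
    mkA r n k l x = 0 ↔ x.1 ∈ filtration r n (k + l) (l + 1) := by
  rw [mkA, Submodule.mkQ_apply, Submodule.Quotient.mk_eq_zero]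
  rfl

variable [NeZero r]

instance fintypeRoots (r : ℕ) [NeZero r] : Fintype (rootsOfUnity r ℂ) := Fintype.ofFinite _

/-- A multiple of the projection to the isotypic component for `∏ ζ_i^{-s}`. -/
def proj (r n : ℕ) [NeZero r] (s : ℤ) : Form r n →ₗ[ℂ] Form r n :=
  ∑ ζ : Fin n → rootsOfUnity r ℂ, ((torChar s ζ : ℂˣ) : ℂ) • formRep r n (tor ζ)

theorem proj_apply (s : ℤ) (x : Form r n) : proj r n s x =
    ∑ ζ : Fin n → rootsOfUnity r ℂ, ((torChar s ζ : ℂˣ) : ℂ) • formAct r n (tor ζ) x := by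
  simp [proj, formRep_apply]

theorem proj_tor (s : ℤ) (ξ : Fin n → rootsOfUnity r ℂ) (x : Form r n) :
    proj r n s (formAct r n (tor ξ) x) = (((torChar s ξ)⁻¹ : ℂˣ) : ℂ) • proj r n s x := by
  rw [proj_apply, proj_apply, Finset.smul_sum,
    ← Equiv.sum_comp (Equiv.mulRight ξ) (fun ζ : Fin n → rootsOfUnity r ℂ =>
      (((torChar s ξ)⁻¹ : ℂˣ) : ℂ) • ((torChar s ζ : ℂˣ) : ℂ) • formAct r n (tor ζ) x)]
  refine Finset.sum_congr rfl fun ζ _ => ?_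
  rw [Equiv.coe_mulRight, smul_smul, ← Units.val_mul, map_mul, mul_comm, mul_inv_cancel_right]
  congr 1
  exact (formAct_tor_mul ζ ξ x).symm

theorem tor_proj (s : ℤ) (ξ : Fin n → rootsOfUnity r ℂ) (x : Form r n) :
    formRep r n (tor ξ) (proj r n s x) = (((torChar s ξ)⁻¹ : ℂˣ) : ℂ) • proj r n s x := by
  rw [proj_apply, Finset.smul_sum, map_sum,
    ← Equiv.sum_comp (Equiv.mulLeft ξ) (fun ζ : Fin n → rootsOfUnity r ℂ =>
      (((torChar s ξ)⁻¹ : ℂˣ) : ℂ) • ((torChar s ζ : ℂˣ) : ℂ) • formAct r n (tor ζ) x)]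
  refine Finset.sum_congr rfl fun ζ _ => ?_
  rw [Equiv.coe_mulLeft, smul_smul, ← Units.val_mul, map_mul, inv_mul_cancel_left, map_smul]
  congr 1
  exact (formAct_tor_mul ξ ζ x).symm

/-- The torus character is symmetric in the coordinates, so conjugation by a permutation merely
reindexes the sum. -/
theorem prm_proj (s : ℤ) (w : Equiv.Perm (Fin n)) (x : Form r n) :
    formRep r n (prm r w) (proj r n s x) = proj r n s (formRep r n (prm r w) x) := by
  rw [proj_apply, proj_apply, map_sum,
    ← Equiv.sum_comp (permTorus r n w).toEquiv (fun ζ : Fin n → rootsOfUnity r ℂ =>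
      ((torChar s ζ : ℂˣ) : ℂ) • formAct r n (tor ζ) (formRep r n (prm r w) x))]
  refine Finset.sum_congr rfl fun ζ _ => ?_
  have h1 : torChar s ((permTorus r n w).toEquiv ζ) = torChar s ζ :=
    Equiv.prod_comp w⁻¹ (fun i => (ζ i : ℂˣ) ^ s)
  rw [map_smul, h1, ← formRep_apply, ← formRep_apply, ← Module.End.mul_apply,
    ← Module.End.mul_apply, ← map_mul, ← map_mul]
  congr 3
  have := SemidirectProduct.inl_aut (φ := permTorus r n) w ζ
  change prm r w * tor ζ = SemidirectProduct.inl (permTorus r n w ζ) * prm r w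
  rw [this, mul_assoc, mul_assoc, prm, ← map_mul, inv_mul_cancel, map_one, mul_one]

theorem proj_mem_filtration (s : ℤ) (p q : ℕ) {x : Form r n} (hx : x ∈ filtration r n p q) :
    proj r n s x ∈ filtration r n p q := by
  rw [proj_apply]
  exact Submodule.sum_mem _ fun ζ _ => Submodule.smul_mem _ _ (filtration_stable r n p q (tor ζ) hx)

/-- The map to the isotypic component of `A^{k,l}` induced by the projection. -/
def isoMap (r n k l : ℕ) [NeZero r] (s : ℤ) :
    filtration r n (k + l) l →ₗ[ℂ] isotypic (repA r n k l) s :=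
  LinearMap.codRestrict _
    (mkA r n k l ∘ₗ (proj r n s).restrict (fun _ hx => proj_mem_filtration s _ _ hx)) <| by
    intro x ζ
    rw [LinearMap.comp_apply, repA_mkA, ← coe_torChar_inv, ← map_smul]
    congr 1
    exact Subtype.ext (tor_proj s ζ x.1)

theorem isoMap_coe (k l : ℕ) (s : ℤ) (x : filtration r n (k + l) l) :
    (isoMap r n k l s x : A r n k l) = mkA r n k l ⟨proj r n s x.1, proj_mem_filtration s _ _ x.2⟩ :=
  rfl

/-- On a vector of the isotypic component, `proj` is multiplication by the order of the torus, which
is invertible. -/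
theorem isoMap_surjective (k l : ℕ) (s : ℤ) : Function.Surjective (isoMap r n k l s) := by
  rintro ⟨a, ha⟩
  obtain ⟨x, rfl⟩ := Submodule.mkQ_surjective _ a
  have hsum : mkA r n k l ⟨proj r n s x.1, proj_mem_filtration s _ _ x.2⟩ =
      (Fintype.card (Fin n → rootsOfUnity r ℂ) : ℂ) • mkA r n k l x := by
    have h1 : (⟨proj r n s x.1, proj_mem_filtration s _ _ x.2⟩ : filtration r n (k + l) l) =
        ∑ ζ : Fin n → rootsOfUnity r ℂ, ((torChar s ζ : ℂˣ) : ℂ) •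
          (⟨formRep r n (tor ζ) x.1, filtration_stable r n _ _ _ x.2⟩ :
            filtration r n (k + l) l) := by
      apply Subtype.ext
      refine (proj_apply s x.1).trans ?_
      simp [formRep_apply]
    rw [h1, map_sum]
    have h2 : ∀ ζ ∈ (Finset.univ : Finset (Fin n → rootsOfUnity r ℂ)),
        mkA r n k l (((torChar s ζ : ℂˣ) : ℂ) • (⟨formRep r n (tor ζ) x.1,
          filtration_stable r n _ _ _ x.2⟩ : filtration r n (k + l) l)) = mkA r n k l x := by
      intro ζ _
      rw [map_smul, ← repA_mkA]
      have := ha ζ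
      rw [← coe_torChar_inv] at this
      refine (congrArg (fun y => ((torChar s ζ : ℂˣ) : ℂ) • y) this).trans ?_
      rw [smul_smul, ← Units.val_mul, mul_inv_cancel, Units.val_one, one_smul]
      rfl
    rw [Finset.sum_congr rfl h2, Finset.sum_const, Finset.card_univ, Nat.cast_smul_eq_nsmul]
  have hne : (Fintype.card (Fin n → rootsOfUnity r ℂ) : ℂ) ≠ 0 :=
    Nat.cast_ne_zero.2 Fintype.card_ne_zero
  refine ⟨(Fintype.card (Fin n → rootsOfUnity r ℂ) : ℂ)⁻¹ • x, Subtype.ext ?_⟩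
  rw [map_smul, Submodule.coe_smul, isoMap_coe, hsum, smul_smul, inv_mul_cancel₀ hne, one_smul]
  rfl

theorem isoMap_eq_zero (k l : ℕ) (s : ℤ) (x : filtration r n (k + l) l) :
    isoMap r n k l s x = 0 ↔ proj r n s x.1 ∈ filtration r n (k + l) (l + 1) := by
  rw [← Subtype.coe_inj, isoMap_coe, Submodule.coe_zero, mkA_eq_zero]

theorem isotypicRep_isoMap (k l : ℕ) (s : ℤ) (w : Equiv.Perm (Fin n))
    (x : filtration r n (k + l) l) :
    isotypicRep (repA r n k l) s w (isoMap r n k l s x) =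
      isoMap r n k l s ⟨formRep r n (prm r w) x.1, filtration_stable r n _ _ _ x.2⟩ := by
  apply Subtype.ext
  rw [isoMap_coe]
  change repA r n k l (prm r w) (isoMap r n k l s x : A r n k l) = _
  rw [isoMap_coe, repA_mkA]
  congr 1
  exact Subtype.ext (prm_proj s w x.1)

/-! ### Lower bound for the dimension -/

theorem exists_dual_decForm (d₀ : Dec r n) : ∃ ℓ : Form r n →ₗ[ℂ] ℂ,
    ℓ (decForm n le_rfl d₀) = 1 ∧ ∀ d, d ≠ d₀ → ℓ (decForm n le_rfl d) = 0 := by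
  have hli := linearIndependent_decForm (r := r) (n := n) n le_rfl
  obtain ⟨ℓ, hℓ⟩ := LinearMap.exists_extend ((Module.Basis.span hli).coord d₀)
  have key : ∀ d, ℓ (decForm n le_rfl d) = (Module.Basis.span hli).coord d₀
      (Module.Basis.span hli d) := by
    intro d
    rw [← hℓ, LinearMap.comp_apply, Submodule.subtype_apply, Module.Basis.span_apply]
  refine ⟨ℓ, by rw [key]; simp, fun d hd => ?_⟩
  rw [key]
  simp [hd]

/-- The projection of a plain forest is a weighted sum over its torus orbit. The coordinate
functional of `D i₀` sees only the orbit of `D i₀`, where it counts the stabiliser, each element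
having weight `1`. It also vanishes deeper in the filtration, since `D i₀` has exactly `l` closed
roots. -/
theorem linearIndependent_isoMap (k l : ℕ) (s : ℤ) {ι : Type*} [Finite ι] (D : ι → Dec r n)
    (hinj : Function.Injective D) (hplain : ∀ i, Dec.plain n (D i) = D i)
    (hdeg : ∀ i, Dec.deg n (D i) = k + l) (hcl : ∀ i, Dec.closed n (D i) = l)
    (hstab : ∀ i ζ, Dec.act ζ n le_rfl (D i) = D i → torChar s ζ = 1) :
    LinearIndependent ℂ fun i => isoMap r n k l s ⟨decForm n le_rfl (D i),
      decSpan_le_filtration _ _ (decForm_mem_decSpan le_rfl _ (hdeg i) (hcl i).ge)⟩ := by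
  classical
  have : Fintype ι := Fintype.ofFinite ι
  rw [Fintype.linearIndependent_iff]
  intro a ha i₀
  simp only [← map_smul, ← map_sum] at ha
  rw [isoMap_eq_zero, filtration_eq_decSpan] at ha
  obtain ⟨ℓ, h1, h0⟩ := exists_dual_decForm (D i₀)
  have hz : ∀ y ∈ decSpan (r := r) n (le_refl n) (k + l) (l + 1), ℓ y = 0 := by
    intro y hy
    have : decSpan (r := r) n (le_refl n) (k + l) (l + 1) ≤ LinearMap.ker ℓ := by
      refine Submodule.span_le.2 ?_
      rintro _ ⟨d, _, hd, rfl⟩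
      refine h0 d ?_
      rintro rfl
      rw [hcl] at hd
      omega
    exact this hy
  have h2 := hz _ ha
  have hℓ : ∀ i, ℓ (proj r n s (decForm n le_rfl (D i))) = if i = i₀ then
      ((Finset.univ.filter fun ζ : Fin n → rootsOfUnity r ℂ =>
        Dec.act ζ n le_rfl (D i₀) = D i₀).card : ℂ) else 0 := by
    intro i
    rw [proj_apply, map_sum]
    have hterm : ∀ ζ ∈ (Finset.univ : Finset (Fin n → rootsOfUnity r ℂ)),
        ℓ (((torChar s ζ : ℂˣ) : ℂ) • formAct r n (tor ζ) (decForm n le_rfl (D i))) =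
        if i = i₀ ∧ Dec.act ζ n le_rfl (D i₀) = D i₀ then 1 else 0 := by
      intro ζ _
      rw [map_smul, formAct_decForm]
      by_cases hd : Dec.act ζ n le_rfl (D i) = D i₀
      -- Plain forests in the same torus orbit coincide, because `Dec.plain` is constant on orbits.
      · have hi : i = i₀ := by
          refine hinj ?_
          rw [← hplain i, ← hplain i₀, ← hd, Dec.plain_act]
        subst hi
        rw [hd, h1, if_pos ⟨rfl, rfl⟩, hstab i ζ hd]
        simp
      · rw [h0 _ hd, if_neg, smul_zero]
        rintro ⟨rfl, h⟩
        exact hd h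
    rw [Finset.sum_congr rfl hterm]
    by_cases hi : i = i₀
    · simp [hi, Finset.sum_boole]
    · simp [hi]
  have h3 : ℓ (proj r n s (∑ i, a i • decForm n le_rfl (D i))) = 0 := by
    rw [← h2]
    congr 2
    simp
  rw [map_sum, map_sum, Finset.sum_eq_single i₀] at h3
  · rw [map_smul, map_smul, hℓ, if_pos rfl, smul_eq_mul, mul_eq_zero] at h3
    -- The stabiliser contains the identity, so the count is nonzero.
    refine h3.resolve_right (Nat.cast_ne_zero.2 (Finset.card_ne_zero.2 ⟨1, ?_⟩))
    rw [Finset.mem_filter]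
    refine ⟨Finset.mem_univ _, ?_⟩
    have := formAct_decForm (1 : Fin n → rootsOfUnity r ℂ) n le_rfl (D i₀)
    refine (linearIndependent_decForm (r := r) (n := n) n le_rfl).injective ?_
    rw [← this, ← formRep_apply, tor, map_one, map_one]
    rfl
  · intro i _ hi
    rw [map_smul, map_smul, hℓ, if_neg hi, smul_zero]
  · simp

end Action

/-! ## Spanning sets indexed by coloured words -/

section Attach

variable {R : Type*} [Ring R] [Algebra ℂ R] {X : Type*} {e : X → X → R} {O : Submodule ℂ R}

/-- Only the letters before `j` are rearranged; the part from `j` on is untouched. In particular the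
last letter, which may carry a closed root, is kept. -/
theorem IsArnold.attach_leaf' (h : IsArnold O e) (i j : X) (u v : List X)
    (hu : (i :: (u ++ j :: v)).Nodup) :
    pathForm e (u ++ j :: v) * e i j ∈
      Submodule.span ℂ {x | ∃ u' : List X, u'.Perm (i :: u) ∧ x = pathForm e (u' ++ j :: v)} := by
  have hn : (i :: (u ++ [j])).Nodup := by
    refine hu.sublist (List.Sublist.cons_cons _ ?_)
    exact (List.Sublist.refl u).append (List.Sublist.cons_cons _ (List.nil_sublist v))
  have h1 := h.attach_leaf i j u hn
  rw [pathForm_append, mul_assoc, h.comm_one (h.pathForm_mem j v) (h.mem i j), mul_smul_comm,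
    ← mul_assoc]
  refine Submodule.smul_mem _ _ ?_
  have hm := Submodule.apply_mem_span_image_of_mem_span
    (LinearMap.mulRight ℂ (pathForm e (j :: v))) h1
  rw [LinearMap.mulRight_apply] at hm
  refine Submodule.span_mono ?_ hm
  rintro _ ⟨_, ⟨u', hu', rfl⟩, rfl⟩
  exact ⟨u', hu', by rw [LinearMap.mulRight_apply, ← pathForm_append]⟩

end Attach

section Words

variable {r n : ℕ}

theorem diag_mem (i j : Fin n) : diag r n i j ∈ oneForms r n := omega₂_mem i j 1

/-- The form `ω_x` for the last letter `x` of a word. -/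
def lastForm (r : ℕ) {n : ℕ} (w : List (Fin n)) : Form r n := w.getLast?.elim 1 (omega r n)

@[simp] theorem lastForm_append_singleton (u : List (Fin n)) (x : Fin n) :
    lastForm r (u ++ [x]) = omega r n x := by simp [lastForm]

/-- The form of a word; the colour `true` means that its root, the last letter, is closed. -/
def wordForm (r : ℕ) {n : ℕ} : Bool → List (Fin n) → Form r n
  | false, w => pathForm (diag r n) w
  | true, w => pathForm (diag r n) w * lastForm r w

/-- The degree of the form of a word. -/
def wordDeg {n : ℕ} (c : Bool) (w : List (Fin n)) : ℕ := w.length - 1 + c.toNat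

theorem lastForm_mem {w : List (Fin n)} (hw : w ≠ []) : lastForm r w ∈ oneForms r n := by
  rcases List.eq_nil_or_concat' w with rfl | ⟨u, x, rfl⟩
  · exact absurd rfl hw
  · rw [lastForm_append_singleton]; exact omega_mem x

theorem pathForm_mem_pow {w : List (Fin n)} :
    pathForm (diag r n) w ∈ oneForms r n ^ (w.length - 1) := by
  cases w with
  | nil => simpa using ⟨1, map_one _⟩
  | cons x w => exact isArnold_diag.pathForm_mem x w

theorem wordForm_mem_pow (c : Bool) {w : List (Fin n)} (hw : w ≠ []) :
    wordForm r c w ∈ oneForms r n ^ wordDeg c w := by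
  cases c with
  | false => exact pathForm_mem_pow
  | true =>
    rw [wordDeg, Bool.toNat_true, pow_succ]
    exact Submodule.mul_mem_mul pathForm_mem_pow (lastForm_mem hw)

theorem attach_wordForm (c : Bool) (i j : Fin n) (u v : List (Fin n))
    (hu : (i :: (u ++ j :: v)).Nodup) : wordForm r c (u ++ j :: v) * diag r n i j ∈
      Submodule.span ℂ {x | ∃ w : List (Fin n), w.Perm (i :: (u ++ j :: v)) ∧
        x = wordForm r c w} := by
  have h1 := isArnold_diag.attach_leaf' (e := diag r n) i j u v hu
  cases c with
  | false =>
    refine Submodule.span_mono ?_ h1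
    rintro _ ⟨u', hu', rfl⟩
    exact ⟨_, hu'.append_right _, rfl⟩
  | true =>
    have hl : ∀ u' : List (Fin n), lastForm r (u' ++ j :: v) = lastForm r (j :: v) := by
      intro u'
      rw [lastForm, lastForm, List.getLast?_append, List.getLast?_cons, Option.some_or]
    rw [wordForm, hl, mul_assoc, oneForms_anti _ (lastForm_mem (List.cons_ne_nil j v)) _
      (diag_mem i j), mul_neg, ← mul_assoc]
    refine Submodule.neg_mem _ ?_
    have hm := Submodule.apply_mem_span_image_of_mem_span
      (LinearMap.mulRight ℂ (lastForm r (j :: v))) h1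
    rw [LinearMap.mulRight_apply] at hm
    refine Submodule.span_mono ?_ hm
    rintro _ ⟨_, ⟨u', hu', rfl⟩, rfl⟩
    refine ⟨_, hu'.append_right _, ?_⟩
    rw [LinearMap.mulRight_apply, wordForm, hl]

/-- A coloured word. -/
abbrev CWord (n : ℕ) : Type := Bool × List (Fin n)

/-- The product of the forms of a list of coloured words. -/
def listForm (r : ℕ) {n : ℕ} (L : List (CWord n)) : Form r n :=
  (L.map fun p => wordForm r p.1 p.2).prod

/-- The total degree of a list of coloured words. -/
def listDeg {n : ℕ} (L : List (CWord n)) : ℕ := (L.map fun p => wordDeg p.1 p.2).sum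

theorem listForm_mem_pow {L : List (CWord n)} (hL : ∀ p ∈ L, p.2 ≠ []) :
    listForm r L ∈ oneForms r n ^ listDeg L := by
  induction L with
  | nil => simpa [listForm, listDeg] using ⟨1, map_one _⟩
  | cons p L ih =>
    simp only [listForm, listDeg, List.map_cons, List.prod_cons, List.sum_cons]
    rw [pow_add]
    exact Submodule.mul_mem_mul (wordForm_mem_pow _ (hL p (by simp)))
      (ih fun q hq => hL q (List.mem_cons_of_mem _ hq))

theorem listForm_cons (p : CWord n) (L : List (CWord n)) :
    listForm r (p :: L) = wordForm r p.1 p.2 * listForm r L := by simp [listForm]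

theorem listDeg_cons (p : CWord n) (L : List (CWord n)) :
    listDeg (p :: L) = wordDeg p.1 p.2 + listDeg L := by simp [listDeg]

theorem count_true_cons (p : CWord n) (L : List (CWord n)) :
    ((p :: L).map Prod.fst).count true = p.1.toNat + (L.map Prod.fst).count true := by
  obtain ⟨c, w⟩ := p
  cases c <;> simp [add_comm]

theorem listForm_append (L L' : List (CWord n)) :
    listForm r (L ++ L') = listForm r L * listForm r L' := by simp [listForm]

/-- The letter `j` lies in some word of the list. The new edge is moved next to that word at the
price of a sign and absorbed there; the other words and all colours stay the same. -/
theorem attach_listForm (i j : Fin n) (L : List (CWord n)) (hL : ∀ p ∈ L, p.2 ≠ [])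
    (hnd : (i :: (L.map Prod.snd).flatten).Nodup) (hj : j ∈ (L.map Prod.snd).flatten) :
    listForm r L * diag r n i j ∈ Submodule.span ℂ {x | ∃ L' : List (CWord n),
      (L'.map Prod.snd).flatten.Perm (i :: (L.map Prod.snd).flatten) ∧ (∀ p ∈ L', p.2 ≠ []) ∧
      L'.map Prod.fst = L.map Prod.fst ∧ x = listForm r L'} := by
  rw [List.mem_flatten] at hj
  obtain ⟨w, hw, hjw⟩ := hj
  rw [List.mem_map] at hw
  obtain ⟨⟨c, w⟩, hp, rfl⟩ := hw
  obtain ⟨L₁, L₂, rfl⟩ := List.append_of_mem hp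
  obtain ⟨u, v, rfl⟩ := List.append_of_mem hjw
  have hL₂ : ∀ p ∈ L₂, p.2 ≠ [] := fun p hp => hL p (by simp [hp])
  have e1 : listForm r (L₁ ++ (c, u ++ j :: v) :: L₂) = listForm r L₁ *
      (wordForm r c (u ++ j :: v) * listForm r L₂) := by simp [listForm]
  rw [e1, mul_assoc, mul_assoc, isArnold_diag.comm_one (listForm_mem_pow hL₂)
    (diag_mem i j), mul_smul_comm, mul_smul_comm]
  refine Submodule.smul_mem _ _ ?_
  rw [← mul_assoc (wordForm r c _)]
  have hn : (i :: (u ++ j :: v)).Nodup := by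
    refine hnd.sublist (List.Sublist.cons_cons _ ?_)
    simp only [List.map_append, List.map_cons, List.flatten_append, List.flatten_cons]
    exact (List.sublist_append_left _ _).trans (List.sublist_append_right _ _)
  have h1 := attach_wordForm (r := r) c i j u v hn
  have hm := Submodule.apply_mem_span_image_of_mem_span (LinearMap.mulLeft ℂ (listForm r L₁) ∘ₗ
    LinearMap.mulRight ℂ (listForm r L₂)) h1
  rw [LinearMap.comp_apply, LinearMap.mulRight_apply, LinearMap.mulLeft_apply] at hm
  refine Submodule.span_mono ?_ hm
  rintro _ ⟨_, ⟨w, hw, rfl⟩, rfl⟩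
  refine ⟨L₁ ++ (c, w) :: L₂, ?_, ?_, by simp, by simp [listForm]⟩
  · simp only [List.map_append, List.map_cons, List.flatten_append, List.flatten_cons]
    refine ((hw.append_right _).append_left _).trans ?_
    rw [List.cons_append]
    exact List.perm_middle
  · intro p hp
    simp only [List.mem_append, List.mem_cons] at hp
    rcases hp with hp | rfl | hp
    · exact hL p (by simp [hp])
    · rintro hh
      change w = [] at hh
      rw [hh] at hw
      simpa using hw.length_eq
    · exact hL₂ p hp

/-- Forms of unlabelled decreasing forests are combinations of products of words. -/
theorem decForm_plain_mem_span (m : ℕ) (h : m ≤ n) (d : Dec r m) :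
    decForm m h (Dec.plain m d) ∈ Submodule.span ℂ {x | ∃ L : List (CWord n),
      (L.map Prod.snd).flatten.Perm (List.ofFn (Fin.castLE h)) ∧ (∀ p ∈ L, p.2 ≠ []) ∧
      (L.map Prod.fst).count true = Dec.closed m d ∧
      (L.map Prod.fst).count false + Dec.deg m d = m ∧ x = listForm r L} := by
  induction m with
  | zero => exact Submodule.subset_span ⟨[], by simp [decForm, Dec.closed, Dec.deg, listForm]⟩
  | succ m ih =>
    obtain ⟨d, s⟩ := d
    have h1 := ih (Nat.le_of_succ_le h) d
    change decForm m _ (Dec.plain m d) * slotForm m h (slotPlain s) ∈ _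
    set v : Fin n := ⟨m, h⟩ with hv
    have hofn : List.ofFn (Fin.castLE h) = List.ofFn (Fin.castLE (Nat.le_of_succ_le h)) ++ [v] := by
      rw [List.ofFn_succ', List.concat_eq_append]
      rfl
    have hnd : (v :: List.ofFn (Fin.castLE (Nat.le_of_succ_le h))).Nodup := by
      have := List.nodup_ofFn.2 (Fin.castLE_injective h)
      rw [hofn] at this
      exact ((List.perm_append_singleton v _).nodup_iff).1 this
    rw [hofn]
    generalize decForm m _ (Dec.plain m d) = X at h1 ⊢
    induction h1 using Submodule.span_induction with
    | zero => rw [zero_mul]; exact Submodule.zero_mem _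
    | add x y _ _ hx hy => rw [add_mul]; exact Submodule.add_mem _ hx hy
    | smul c x _ hx => rw [smul_mul_assoc]; exact Submodule.smul_mem _ _ hx
    | mem x hx =>
      obtain ⟨L, hp, hne, hc, hd, rfl⟩ := hx
      have hnewp : ∀ c : Bool, ((L ++ [(c, [v])]).map Prod.snd).flatten.Perm
          (List.ofFn (Fin.castLE (Nat.le_of_succ_le h)) ++ [v]) := by
        intro c
        simpa using hp.append_right [v]
      have hnewn : ∀ c : Bool, ∀ p ∈ L ++ [(c, [v])], p.2 ≠ [] := by
        intro c p hp
        rw [List.mem_append, List.mem_singleton] at hp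
        rcases hp with hp | rfl
        · exact hne p hp
        · simp
      -- An open or closed root starts a new one-letter word; an edge attaches the new vertex to the
      -- word containing its target.
      rcases s with _ | _ | ⟨j, η⟩
      · refine Submodule.subset_span ⟨L ++ [(false, [v])], hnewp _, hnewn _, ?_, ?_, ?_⟩
        · simpa [Dec.closed, slotClosed] using hc
        · simp only [List.map_append, List.map_cons, List.map_nil, List.count_append,
            List.count_singleton_self, Dec.deg, slotDeg]
          omega
        · rw [listForm_append]
          simp [listForm, wordForm, slotPlain, slotForm]
      · refine Submodule.subset_span ⟨L ++ [(true, [v])], hnewp _, hnewn _, ?_, ?_, ?_⟩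
        · simpa [Dec.closed, slotClosed, slotWeight] using hc
        · simp only [List.map_append, List.map_cons, List.map_nil, List.count_append, Dec.deg,
            slotDeg]
          simp
          omega
        · rw [listForm_append, slotPlain, slotForm_closed]
          simp [listForm, wordForm, lastForm, hv]
      · rw [slotPlain, slotForm_edge]
        have hj : Fin.castLT j (j.2.trans h) ∈ (L.map Prod.snd).flatten := by
          rw [hp.mem_iff, List.mem_ofFn]
          exact ⟨j, rfl⟩
        have hnd' : (v :: (L.map Prod.snd).flatten).Nodup := (hp.cons v).nodup_iff.2 hnd
        refine Submodule.span_mono ?_ (attach_listForm (r := r) v _ L hne hnd' hj)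
        rintro _ ⟨L', hp', hne', hfst, rfl⟩
        refine ⟨L', ?_, hne', ?_, ?_, rfl⟩
        · refine hp'.trans ((hp.cons v).trans ?_)
          exact (List.perm_append_singleton v _).symm
        · rw [hfst, hc]; simp [Dec.closed, slotClosed, slotWeight]
        · rw [hfst]
          simp only [Dec.deg, slotDeg]
          omega

/-! ### Cyclic sums of coloured words -/

variable [NeZero r]

theorem lastForm_mem_multSpan {w : List (Fin n)} (hw : w ≠ []) :
    lastForm r w ∈ multSpan r n 1 1 := by
  rcases List.eq_nil_or_concat' w with rfl | ⟨u, x, rfl⟩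
  · exact absurd rfl hw
  · rw [lastForm_append_singleton]; exact omega_mem_multSpan x

theorem pathForm_mem_multSpan (x : Fin n) (w : List (Fin n)) :
    pathForm (diag r n) (x :: w) ∈ multSpan r n w.length 0 := by
  induction w generalizing x with
  | nil =>
    rw [pathForm_singleton, List.length_nil]
    exact one_mem_multSpan (r := r) (n := n)
  | cons y w ih =>
    rw [pathForm_cons_cons, List.length_cons, add_comm]
    have h1 := mul_mem_multSpan (diag_mem_multSpan (r := r) x y) (ih y)
    rwa [Nat.add_zero] at h1

theorem wordForm_mem_multSpan (c : Bool) {w : List (Fin n)} (hw : w ≠ []) :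
    wordForm r c w ∈ multSpan r n (wordDeg c w) c.toNat := by
  have h1 : pathForm (diag r n) w ∈ multSpan r n (w.length - 1) 0 := by
    cases w with
    | nil => exact absurd rfl hw
    | cons x w => exact pathForm_mem_multSpan x w
  cases c with
  | false => exact h1
  | true =>
    have := mul_mem_multSpan h1 (lastForm_mem_multSpan (r := r) hw)
    simpa [wordForm, wordDeg] using this

/-- Passing from letter to letter along the word, each consecutive edge exchanges the two forms
`omega` modulo a product of two of them. So, modulo more closed roots, the form of a closed word
does not depend on which letter carries the root. -/
theorem pathForm_mul_omega_sub_mem (x : Fin n) (t : List (Fin n)) (hnd : (x :: t).Nodup)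
    (y : Fin n) (hy : y ∈ x :: t) :
    pathForm (diag r n) (x :: t) * (omega r n y - omega r n x) ∈
      multSpan r n (t.length + 1) 2 := by
  induction t generalizing x y with
  | nil =>
    rw [List.mem_singleton] at hy
    rw [hy, sub_self, mul_zero]
    exact Submodule.zero_mem _
  | cons b t ih =>
    rcases List.mem_cons.1 hy with rfl | hy
    · rw [sub_self, mul_zero]
      exact Submodule.zero_mem _
    · have hxb : x ≠ b := by
        rintro rfl
        exact (List.nodup_cons.1 hnd).1 (by simp)
      have h1 := ih b (List.nodup_cons.1 hnd).2 y hy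
      have h2 := mul_mem_multSpan (diag_mem_multSpan (r := r) x b) h1
      -- The edge from `x` to `b` is moved to the end, next to the difference, where
      -- `diag_mul_omega_sub` applies.
      have h3 : pathForm (diag r n) (x :: b :: t) * (omega r n b - omega r n x) ∈
          multSpan r n ((b :: t).length + 1) 2 := by
        have hc := isArnold_diag.comm_one (isArnold_diag.pathForm_mem (e := diag r n) b t)
          (diag_mem x b)
        have hc' : diag r n x b * pathForm (diag r n) (b :: t) =
            (-1 : ℂ) ^ t.length • (pathForm (diag r n) (b :: t) * diag r n x b) := by
          rw [hc, smul_smul, ← pow_add, ← two_mul, pow_mul]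
          simp
        have hd : diag r n x b * (omega r n b - omega r n x) = omega r n x * omega r n b := by
          have := diag_mul_omega_sub (r := r) x b hxb
          rw [mul_sub, ← neg_sub, this, neg_neg]
        rw [pathForm_cons_cons, hc', smul_mul_assoc, mul_assoc, hd]
        refine Submodule.smul_mem _ _ ?_
        have := mul_mem_multSpan (pathForm_mem_multSpan (r := r) b t)
          (mul_mem_multSpan (omega_mem_multSpan (r := r) x) (omega_mem_multSpan b))
        simpa [add_assoc] using this
      have h4 := Submodule.add_mem _ h3 (by
        simpa [add_comm, add_left_comm, add_assoc, mul_assoc] using h2 :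
          pathForm (diag r n) (x :: b :: t) * (omega r n y - omega r n b) ∈
            multSpan r n ((b :: t).length + 1) 2)
      rw [← mul_add] at h4
      simpa using h4

theorem pathForm_mul_omega_sub_mem' (w : List (Fin n)) (hnd : w.Nodup) (x y : Fin n) (hx : x ∈ w)
    (hy : y ∈ w) : pathForm (diag r n) w * (omega r n x - omega r n y) ∈
      multSpan r n w.length 2 := by
  cases w with
  | nil => simp at hx
  | cons a t =>
    have := Submodule.sub_mem _ (pathForm_mul_omega_sub_mem (r := r) a t hnd x hx)
      (pathForm_mul_omega_sub_mem (r := r) a t hnd y hy)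
    rw [← mul_sub] at this
    simpa using this

variable (ζ : ∀ m : ℕ, rootsOfUnity m ℂ)

/-- The ratio used in the cyclic sum of a word of length `b`. -/
def cycRatio (b : ℕ) : ℂ := ((ζ b : ℂˣ) : ℂ)⁻¹ * (-1) ^ (b - 1)

/-- The twisted cyclic sum of the forms of the rotations of a coloured word. -/
def cycWord (r : ℕ) {n : ℕ} (ζ : ∀ m : ℕ, rootsOfUnity m ℂ) (c : Bool) (w : List (Fin n)) :
    Form r n :=
  ∑ j ∈ Finset.range w.length, cycRatio ζ w.length ^ j • wordForm r c (w.rotate j)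

theorem cycWord_mem_multSpan (c : Bool) {w : List (Fin n)} (hw : w ≠ []) :
    cycWord r ζ c w ∈ multSpan r n (wordDeg c w) c.toNat := by
  refine Submodule.sum_mem _ fun j _ => Submodule.smul_mem _ _ ?_
  have : wordDeg c (w.rotate j) = wordDeg c w := by simp [wordDeg]
  rw [← this]
  exact wordForm_mem_multSpan c (by simpa using hw)

omit [NeZero r] in
theorem cycWord_mem_pow (c : Bool) {w : List (Fin n)} (hw : w ≠ []) :
    cycWord r ζ c w ∈ oneForms r n ^ wordDeg c w := by
  refine Submodule.sum_mem _ fun j _ => Submodule.smul_mem _ _ ?_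
  have : wordDeg c (w.rotate j) = wordDeg c w := by simp [wordDeg]
  rw [← this]
  exact wordForm_mem_pow c (by simpa using hw)

variable (hζ : ∀ m, 0 < m → IsPrimitiveRoot (ζ m) m)

-- For an open root this is Klyachko's theorem with `q` the inverse of the primitive root. For a
-- closed root that expansion is multiplied by `ω_x`; in each rotation `ω_x` is then replaced by the
-- form of its own last letter, with an error having two closed roots.
include hζ in
theorem wordForm_mem_span_cycWord (c : Bool) (w : List (Fin n)) (hw : w.Nodup) (hne : w ≠ []) :
    wordForm r c w ∈ Submodule.span ℂ {x | ∃ w' : List (Fin n), w'.Perm w ∧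
      x = cycWord r ζ c w'} ⊔ multSpan r n (wordDeg c w) (c.toNat + 1) := by
  have hlen : 0 < w.length := List.length_pos_iff.2 hne
  have hq : ∀ k, 0 < k → k < w.length → (((ζ w.length : ℂˣ) : ℂ)⁻¹) ^ k ≠ 1 := by
    intro k hk hkw hh
    rw [inv_pow, inv_eq_one] at hh
    refine (hζ _ hlen).pow_ne_one_of_pos_of_lt hk.ne' hkw ?_
    apply Subtype.ext
    apply Units.ext
    simpa using hh
  have h1 := isArnold_diag.pathForm_mem_span_cycForm (e := diag r n)
    (((ζ w.length : ℂˣ) : ℂ)⁻¹) w hw hne hq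
  cases c with
  | false =>
    refine Submodule.mem_sup_left (Submodule.span_mono ?_ h1)
    rintro _ ⟨w', hw', rfl⟩
    refine ⟨w', hw', ?_⟩
    rw [cycForm, cycWord, cycRatio, hw'.length_eq]
    rfl
  | true =>
    obtain ⟨u, x, rfl⟩ := (List.eq_nil_or_concat' w).resolve_left hne
    rw [wordForm, lastForm_append_singleton]
    have hm := Submodule.apply_mem_span_image_of_mem_span
      (LinearMap.mulRight ℂ (omega r n x)) h1
    rw [LinearMap.mulRight_apply] at hm
    refine Submodule.span_le.2 ?_ hm
    rintro _ ⟨_, ⟨w', hw', rfl⟩, rfl⟩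
    rw [LinearMap.mulRight_apply]
    have key : cycForm (diag r n) (((ζ (u ++ [x]).length : ℂˣ) : ℂ)⁻¹ *
        (-1) ^ ((u ++ [x]).length - 1)) w' * omega r n x - cycWord r ζ true w' ∈
        multSpan r n (wordDeg true (u ++ [x])) 2 := by
      rw [cycForm, cycWord, cycRatio, hw'.length_eq, Finset.sum_mul, ← Finset.sum_sub_distrib]
      refine Submodule.sum_mem _ fun j _ => ?_
      rw [smul_mul_assoc, ← smul_sub]
      refine Submodule.smul_mem _ _ ?_
      have hp : (w'.rotate j).Perm (u ++ [x]) := (w'.rotate_perm j).trans hw'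
      have hne' : w'.rotate j ≠ [] := by
        intro hh
        rw [hh] at hp
        simpa using hp.length_eq
      obtain ⟨u', y, hy⟩ := (List.eq_nil_or_concat' (w'.rotate j)).resolve_left hne'
      have h2 := pathForm_mul_omega_sub_mem' (r := r) (w'.rotate j) (hp.nodup_iff.2 hw) x y
        (hp.mem_iff.2 (by simp)) (by rw [hy]; simp)
      rw [hp.length_eq, mul_sub] at h2
      rw [wordForm]
      have h3 : lastForm r (w'.rotate j) = omega r n y := by
        rw [hy, lastForm_append_singleton]
      rw [h3]
      have h4 : wordDeg true (u ++ [x]) = (u ++ [x]).length := by simp [wordDeg]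
      rwa [h4]
    rw [← sub_add_cancel (cycForm (diag r n) _ w' * omega r n x) (cycWord r ζ true w')]
    exact Submodule.add_mem _ (Submodule.mem_sup_right key)
      (Submodule.mem_sup_left (Submodule.subset_span ⟨w', hw', rfl⟩))

/-- The product of the cyclic sums of a list of coloured words. -/
def cycList (r : ℕ) {n : ℕ} (ζ : ∀ m : ℕ, rootsOfUnity m ℂ) (L : List (CWord n)) : Form r n :=
  (L.map fun p => cycWord r ζ p.1 p.2).prod

omit [NeZero r] in
theorem cycList_cons (p : CWord n) (L : List (CWord n)) :
    cycList r ζ (p :: L) = cycWord r ζ p.1 p.2 * cycList r ζ L := by simp [cycList]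

theorem cycList_mem_multSpan (L : List (CWord n)) (hL : ∀ p ∈ L, p.2 ≠ []) :
    cycList r ζ L ∈ multSpan r n (listDeg L) ((L.map Prod.fst).count true) := by
  induction L with
  | nil => exact one_mem_multSpan
  | cons p L ih =>
    rw [cycList_cons, listDeg_cons, count_true_cons]
    exact mul_mem_multSpan (cycWord_mem_multSpan (r := r) ζ p.1 (hL p (by simp)))
      (ih fun q hq => hL q (List.mem_cons_of_mem _ hq))

theorem listForm_mem_multSpan (L : List (CWord n)) (hL : ∀ p ∈ L, p.2 ≠ []) :
    listForm r L ∈ multSpan r n (listDeg L) ((L.map Prod.fst).count true) := by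
  induction L with
  | nil => exact one_mem_multSpan
  | cons p L ih =>
    rw [listForm_cons, listDeg_cons, count_true_cons]
    exact mul_mem_multSpan (wordForm_mem_multSpan (r := r) p.1 (hL p (by simp)))
      (ih fun q hq => hL q (List.mem_cons_of_mem _ hq))

-- The expansions of the individual words are multiplied; a product using an error term has at least
-- one closed root more than the colours prescribe.
include hζ in
theorem listForm_mem_span_cycList (L : List (CWord n)) (hL : ∀ p ∈ L, p.2 ≠ [])
    (hnd : ∀ p ∈ L, p.2.Nodup) :
    listForm r L ∈ Submodule.span ℂ {x | ∃ L' : List (CWord n),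
      List.Forall₂ (fun p' p => p'.1 = p.1 ∧ p'.2.Perm p.2) L' L ∧ x = cycList r ζ L'} ⊔
        multSpan r n (listDeg L) ((L.map Prod.fst).count true + 1) := by
  induction L with
  | nil =>
    refine Submodule.mem_sup_left (Submodule.subset_span ⟨[], List.Forall₂.nil, rfl⟩)
  | cons p L ih =>
    have hL' : ∀ q ∈ L, q.2 ≠ [] := fun q hq => hL q (List.mem_cons_of_mem _ hq)
    have h1 := wordForm_mem_span_cycWord ζ hζ (r := r) p.1 p.2 (hnd p (by simp)) (hL p (by simp))
    have h2 := ih hL' (fun q hq => hnd q (List.mem_cons_of_mem _ hq))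
    rw [Submodule.mem_sup] at h1 h2
    obtain ⟨x₁, hx₁, y₁, hy₁, e₁⟩ := h1
    obtain ⟨x₂, hx₂, y₂, hy₂, e₂⟩ := h2
    have hx₁' : x₁ ∈ multSpan r n (wordDeg p.1 p.2) p.1.toNat := by
      refine Submodule.span_le.2 ?_ hx₁
      rintro _ ⟨w', hw', rfl⟩
      have : wordDeg p.1 w' = wordDeg p.1 p.2 := by rw [wordDeg, hw'.length_eq, wordDeg]
      rw [← this]
      refine cycWord_mem_multSpan ζ p.1 ?_
      rintro rfl
      exact hL p (by simp) (hw'.nil_eq).symm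
    have hB := listForm_mem_multSpan (r := r) L hL'
    have e3 : listForm r (p :: L) = x₁ * x₂ + (x₁ * y₂ + y₁ * listForm r L) := by
      rw [listForm_cons, ← e₁, add_mul, ← add_assoc, ← mul_add, e₂]
    rw [e3, listDeg_cons, count_true_cons]
    refine Submodule.add_mem _ (Submodule.mem_sup_left ?_) (Submodule.mem_sup_right ?_)
    · have := Submodule.mul_mem_mul hx₁ hx₂
      rw [Submodule.span_mul_span] at this
      refine Submodule.span_mono ?_ this
      rintro _ ⟨_, ⟨w', hw', rfl⟩, _, ⟨L', hL', rfl⟩, rfl⟩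
      exact ⟨(p.1, w') :: L', List.Forall₂.cons ⟨rfl, hw'⟩ hL', (cycList_cons ζ (p.1, w') L').symm⟩
    · refine Submodule.add_mem _ ?_ ?_
      · have := mul_mem_multSpan hx₁' hy₂
        simpa [add_assoc] using this
      · have := mul_mem_multSpan hy₁ hB
        simpa [add_assoc, add_comm, add_left_comm] using this

end Words

/-! ## Spanning sets of the isotypic components -/

section Spanning

variable {r n : ℕ}

/-- The label of an edge changes only by the ratio of the torus coordinates at its ends. -/
theorem formAct_pathForm_of_const (ξ : Fin n → rootsOfUnity r ℂ) (w : List (Fin n))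
    (hξ : ∀ x ∈ w, ∀ y ∈ w, ξ x = ξ y) :
    formAct r n (tor ξ) (pathForm (diag r n) w) = pathForm (diag r n) w := by
  induction w with
  | nil => exact map_one _
  | cons x w ih =>
    cases w with
    | nil => exact map_one _
    | cons y w =>
      rw [pathForm_cons_cons, map_mul,
        ih fun a ha b hb => hξ a (List.mem_cons_of_mem _ ha) b (List.mem_cons_of_mem _ hb), diag,
        formAct_tor_omega₂, hξ x (by simp) y (by simp), one_mul, mul_inv_cancel]

theorem formAct_wordForm_of_const (ξ : Fin n → rootsOfUnity r ℂ) (c : Bool) (w : List (Fin n))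
    (hξ : ∀ x ∈ w, ∀ y ∈ w, ξ x = ξ y) :
    formAct r n (tor ξ) (wordForm r c w) = wordForm r c w := by
  cases c with
  | false => exact formAct_pathForm_of_const ξ w hξ
  | true =>
    rw [wordForm, map_mul, formAct_pathForm_of_const ξ w hξ]
    congr 1
    rcases List.eq_nil_or_concat' w with rfl | ⟨u, x, rfl⟩
    · exact map_one _
    · rw [lastForm_append_singleton, formAct_tor_omega]

variable (ζ : ∀ m : ℕ, rootsOfUnity m ℂ)

theorem formAct_cycWord_of_const (ξ : Fin n → rootsOfUnity r ℂ) (c : Bool) (w : List (Fin n))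
    (hξ : ∀ x ∈ w, ∀ y ∈ w, ξ x = ξ y) :
    formAct r n (tor ξ) (cycWord r ζ c w) = cycWord r ζ c w := by
  rw [cycWord, map_sum]
  refine Finset.sum_congr rfl fun j _ => ?_
  rw [map_smul, formAct_wordForm_of_const]
  intro x hx y hy
  exact hξ x (List.mem_rotate.1 hx) y (List.mem_rotate.1 hy)

theorem formAct_cycList_of_const (ξ : Fin n → rootsOfUnity r ℂ) (L : List (CWord n))
    (hξ : ∀ p ∈ L, ∀ x ∈ p.2, ∀ y ∈ p.2, ξ x = ξ y) :
    formAct r n (tor ξ) (cycList r ζ L) = cycList r ζ L := by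
  rw [cycList, map_list_prod, List.map_map]
  congr 1
  refine List.map_congr_left fun p hp => ?_
  exact formAct_cycWord_of_const ζ ξ p.1 p.2 (hξ p hp)

theorem torChar_indicator (s : ℤ) (γ : rootsOfUnity r ℂ) (w : List (Fin n)) (hw : w.Nodup) :
    torChar s (fun x => if x ∈ w then γ else 1) = ((γ : ℂˣ) ^ s) ^ w.length := by
  have h1 : ∀ x : Fin n, ((if x ∈ w then γ else 1 : rootsOfUnity r ℂ) : ℂˣ) ^ s =
      if x ∈ w.toFinset then (γ : ℂˣ) ^ s else 1 := by
    intro x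
    by_cases hx : x ∈ w <;> simp [hx]
  change ∏ x : Fin n, ((if x ∈ w then γ else 1 : rootsOfUnity r ℂ) : ℂˣ) ^ s = _
  simp only [h1]
  rw [Finset.prod_ite_mem, Finset.univ_inter, Finset.prod_const, List.toFinset_card_of_nodup hw]

/-- Distinct words of a list without repeated letters are disjoint, so a torus element supported on
one word is constant on every word. -/
theorem flatten_pairwise {L : List (CWord n)} (hnd : (L.map Prod.snd).flatten.Nodup)
    {p q : CWord n} (hp : p ∈ L) (hq : q ∈ L) {x y : Fin n} (hx : x ∈ q.2) (hy : y ∈ q.2)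
    (hxp : x ∈ p.2) : y ∈ p.2 := by
  rw [List.nodup_flatten, List.pairwise_map] at hnd
  by_cases hpq : p = q
  · rwa [hpq]
  · have hsymm : Std.Symm fun a b : CWord n => a.2.Disjoint b.2 := ⟨fun _ _ h => h.symm⟩
    have hd := hnd.2.forall hp hq hpq
    exact absurd hx (hd hxp)

variable [NeZero r] (hζ : ∀ m, 0 < m → IsPrimitiveRoot (ζ m) m)

-- The torus element equal to a primitive `r`-th root on the letters of `p` and to `1` elsewhere
-- fixes the product, yet scales its projection by a power of that root with exponent `-s` times the
-- length of `p`. As `s` is prime to `r`, this factor is `1` only if `r` divides the length.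
include hζ in
theorem proj_cycList_eq_zero {s : ℤ} (hs : IsCoprime s (r : ℤ)) (L : List (CWord n))
    (hnd : (L.map Prod.snd).flatten.Nodup) {p : CWord n} (hp : p ∈ L) (hr : ¬ r ∣ p.2.length) :
    proj r n s (cycList r ζ L) = 0 := by
  set ξ : Fin n → rootsOfUnity r ℂ := fun x => if x ∈ p.2 then ζ r else 1 with hξ
  have hpn : p.2.Nodup := (List.nodup_flatten.1 hnd).1 _ (List.mem_map_of_mem hp)
  have h1 : formAct r n (tor ξ) (cycList r ζ L) = cycList r ζ L := by
    refine formAct_cycList_of_const ζ ξ L fun q hq x hx y hy => ?_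
    have h2 : x ∈ p.2 ↔ y ∈ p.2 :=
      ⟨flatten_pairwise hnd hp hq hx hy, flatten_pairwise hnd hp hq hy hx⟩
    simp only [hξ, h2]
  have h2 := proj_tor s ξ (cycList r ζ L)
  rw [h1] at h2
  by_contra h0
  have h3 : (((torChar s ξ)⁻¹ : ℂˣ) : ℂ) = 1 := by
    have : ((((torChar s ξ)⁻¹ : ℂˣ) : ℂ) - 1) • proj r n s (cycList r ζ L) = 0 := by
      rw [sub_smul, ← h2, one_smul, sub_self]
    exact sub_eq_zero.1 ((smul_eq_zero.1 this).resolve_right h0)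
  have h4 : torChar s ξ = 1 := by
    rwa [Units.val_eq_one, inv_eq_one] at h3
  rw [hξ, torChar_indicator s (ζ r) _ hpn, ← zpow_natCast, ← zpow_mul] at h4
  have h5 : (ζ r) ^ (s * (p.2.length : ℤ)) = 1 := by
    apply Subtype.ext
    simpa using h4
  rw [(hζ r (NeZero.pos r)).zpow_eq_one_iff_dvd] at h5
  exact hr (Int.natCast_dvd_natCast.1 (hs.symm.dvd_of_dvd_mul_left h5))

/-- The lists of words which yield a spanning set of the isotypic component. -/
structure Admissible (r k l : ℕ) {n : ℕ} (L : List (CWord n)) : Prop where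
  perm : (L.map Prod.snd).flatten.Perm (List.finRange n)
  ne_nil : ∀ p ∈ L, p.2 ≠ []
  dvd : ∀ p ∈ L, r ∣ p.2.length
  count_true : (L.map Prod.fst).count true = l
  count_false : (L.map Prod.fst).count false + (k + l) = n

/-- A word of length `b` has degree `b` if its root is closed and `b - 1` if it is open. -/
theorem listDeg_add_count (L : List (CWord n)) (hL : ∀ p ∈ L, p.2 ≠ []) :
    listDeg L + (L.map Prod.fst).count false = (L.map Prod.snd).flatten.length := by
  induction L with
  | nil => rfl
  | cons p L ih =>
    have h1 := ih fun q hq => hL q (List.mem_cons_of_mem _ hq)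
    have h2 : 0 < p.2.length := List.length_pos_iff.2 (hL p (by simp))
    obtain ⟨c, w⟩ := p
    rw [listDeg_cons]
    rw [List.map_cons, List.map_cons, List.flatten_cons, List.length_append, List.count_cons, ← h1,
      wordDeg]
    change 0 < w.length at h2
    cases c
    · simp only [Bool.toNat_false, beq_self_eq_true, if_true]
      omega
    · rw [if_neg (by simp)]
      simp only [Bool.toNat_true]
      omega

theorem cycList_mem_filtration {k l : ℕ} {L : List (CWord n)} (hL : Admissible r k l L) :
    cycList r ζ L ∈ filtration r n (k + l) l := by
  have h1 := cycList_mem_multSpan (r := r) ζ L hL.ne_nil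
  have h2 := listDeg_add_count L hL.ne_nil
  rw [hL.perm.length_eq, List.length_finRange] at h2
  have h3 : listDeg L = k + l := by have := hL.count_false; omega
  rwa [h3, hL.count_true, ← filtration_eq_multSpan] at h1

-- The preimage `N` of `S` in the filtration contains everything whose projection lies deeper, and
-- it is stable under the torus. It therefore suffices to treat plain forests, hence words, hence
-- products of cyclic sums; those not covered by `hS` have a word of length prime to the requirement
-- `r ∣ length` and project to zero.
include hζ in
theorem isotypic_eq_top {s : ℤ} (hs : IsCoprime s (r : ℤ)) {k l : ℕ}
    (S : Submodule ℂ (isotypic (repA r n k l) s))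
    (hS : ∀ (L : List (CWord n)) (hL : Admissible r k l L),
      isoMap r n k l s ⟨cycList r ζ L, cycList_mem_filtration ζ hL⟩ ∈ S) : S = ⊤ := by
  set N : Submodule ℂ (Form r n) :=
    (S.comap (isoMap r n k l s)).map (filtration r n (k + l) l).subtype with hN
  have hmem : ∀ (x : Form r n) (hx : x ∈ filtration r n (k + l) l), x ∈ N ↔
      isoMap r n k l s ⟨x, hx⟩ ∈ S := by
    intro x hx
    rw [hN, Submodule.mem_map]
    constructor
    · rintro ⟨y, hy, rfl⟩
      exact hy
    · intro h
      exact ⟨⟨x, hx⟩, h, rfl⟩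
  have hproj : ∀ x ∈ filtration r n (k + l) l, proj r n s x ∈ filtration r n (k + l) (l + 1) →
      x ∈ N := by
    intro x hx h
    rw [hmem x hx, (isoMap_eq_zero k l s _).2 h]
    exact Submodule.zero_mem _
  have hdown : ∀ x ∈ filtration r n (k + l) (l + 1), x ∈ N := by
    intro x hx
    refine hproj x ?_ (proj_mem_filtration s _ _ hx)
    rw [filtration_eq_multSpan] at hx ⊢
    exact multSpan_anti (Nat.le_succ l) hx
  -- After projection a torus element acts by a scalar.
  have htor : ∀ ξ x, x ∈ N → formAct r n (tor ξ) x ∈ N := by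
    intro ξ x hx
    have hx' : x ∈ filtration r n (k + l) l := by
      rw [hN, Submodule.mem_map] at hx
      obtain ⟨y, _, rfl⟩ := hx
      exact y.2
    have hx'' : formAct r n (tor ξ) x ∈ filtration r n (k + l) l :=
      filtration_stable r n _ _ (tor ξ) hx'
    rw [hmem _ hx'']
    rw [hmem x hx'] at hx
    have h1 := S.smul_mem (((torChar s ξ)⁻¹ : ℂˣ) : ℂ) hx
    convert h1 using 1
    rw [← map_smul, ← sub_eq_zero, ← map_sub, isoMap_eq_zero]
    have h2 : proj r n s (formAct r n (tor ξ) x - (((torChar s ξ)⁻¹ : ℂˣ) : ℂ) • x) = 0 := by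
      rw [map_sub, map_smul, proj_tor, sub_self]
    change proj r n s (formAct r n (tor ξ) x - (((torChar s ξ)⁻¹ : ℂˣ) : ℂ) • x) ∈ _
    rw [h2]
    exact Submodule.zero_mem _
  have hall : filtration r n (k + l) l ≤ N := by
    rw [filtration_eq_decSpan]
    refine Submodule.span_le.2 ?_
    rintro _ ⟨d, hdeg, hcl, rfl⟩
    -- With more than `l` closed roots the class is zero; otherwise the forest is a torus translate
    -- of its plain form.
    rcases hcl.lt_or_eq with hlt | heq
    · exact hdown _ (decSpan_le_filtration _ _ (decForm_mem_decSpan le_rfl d hdeg hlt))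
    obtain ⟨ξ, hξ⟩ := Dec.exists_act_plain n le_rfl d
    rw [← hξ, ← formAct_decForm]
    refine htor ξ _ (Submodule.span_le.2 ?_ (decForm_plain_mem_span n le_rfl d))
    rintro _ ⟨L, hp, hne, hct, hcf, rfl⟩
    have hofn : List.ofFn (Fin.castLE (le_refl n)) = List.finRange n := by
      rw [List.ofFn_eq_map]
      exact List.map_id _
    rw [hofn] at hp
    rw [← heq] at hct
    rw [hdeg] at hcf
    have hflat : (L.map Prod.snd).flatten.Nodup := hp.nodup_iff.2 (List.nodup_finRange n)
    have h2 := listDeg_add_count L hne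
    rw [hp.length_eq, List.length_finRange] at h2
    have h3 : listDeg L = k + l := by omega
    have h1 := listForm_mem_span_cycList (r := r) ζ hζ L hne fun p hp =>
      (List.nodup_flatten.1 hflat).1 _ (List.mem_map_of_mem hp)
    rw [h3, hct, ← filtration_eq_multSpan] at h1
    refine (sup_le (Submodule.span_le.2 ?_) hdown : _ ≤ N) h1
    rintro _ ⟨L', hL', rfl⟩
    have hfst : L'.map Prod.fst = L.map Prod.fst := by
      clear * - hL'
      induction hL' with
      | nil => rfl
      | cons h _ ih => simp [h.1, ih]
    have hperm : (L'.map Prod.snd).flatten.Perm (L.map Prod.snd).flatten := by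
      clear * - hL'
      induction hL' with
      | nil => exact List.Perm.refl _
      | cons h _ ih => simpa using h.2.append ih
    have hne' : ∀ p ∈ L', p.2 ≠ [] := by
      clear * - hL' hne
      induction hL' with
      | nil => simp
      | @cons p' p L' L h _ ih =>
        intro q hq
        rcases List.mem_cons.1 hq with rfl | hq
        · intro h0
          have h2 := h.2
          rw [h0] at h2
          exact hne p (by simp) h2.nil_eq.symm
        · exact ih (fun q hq => hne q (List.mem_cons_of_mem _ hq)) q hq
    by_cases hr : ∀ p ∈ L', r ∣ p.2.length
    · have hA : Admissible r k l L' :=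
        ⟨hperm.trans hp, hne', hr, by rw [hfst, hct], by rw [hfst]; exact hcf⟩
      exact (hmem _ (cycList_mem_filtration ζ hA)).2 (hS L' hA)
    · push Not at hr
      obtain ⟨p, hpL, hpr⟩ := hr
      have h4 := proj_cycList_eq_zero ζ hζ hs L' (hperm.nodup_iff.2 hflat) hpL hpr
      refine hproj _ ?_ (by rw [h4]; exact Submodule.zero_mem _)
      have h5 := cycList_mem_multSpan (r := r) ζ L' hne'
      have h6 := listDeg_add_count L' hne'
      rw [hperm.length_eq, hp.length_eq, List.length_finRange, hfst] at h6
      have h7 : listDeg L' = k + l := by omega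
      rwa [h7, hfst, hct, ← filtration_eq_multSpan] at h5
  rw [eq_top_iff]
  rintro y -
  obtain ⟨⟨x, hx⟩, rfl⟩ := isoMap_surjective k l s y
  exact (hmem x hx).1 (hall hx)

end Spanning

/-! ## The sign of a list -/

section ListSign

variable {α : Type*} [LinearOrder α]

/-- The sign of the permutation which sorts a list; it is `0` if the list has repetitions. -/
def listSign : List α → ℤ
  | [] => 1
  | x :: l => if x ∈ l then 0 else (-1) ^ l.countP (· < x) * listSign l

theorem listSign_swap (u v : List α) (x y : α) :
    listSign (u ++ x :: y :: v) = -listSign (u ++ y :: x :: v) := by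
  induction u with
  | nil =>
    simp only [List.nil_append, listSign, List.mem_cons, List.countP_cons]
    rcases lt_trichotomy x y with h | rfl | h
    · by_cases hx : x ∈ v <;> by_cases hy : y ∈ v <;>
        simp [hx, hy, h, h.ne, h.ne', h.not_gt, pow_succ, mul_left_comm]
    · simp
    · by_cases hx : x ∈ v <;> by_cases hy : y ∈ v <;>
        simp [hx, hy, h, h.ne, h.ne', h.not_gt, pow_succ, mul_left_comm]
  | cons z u ih =>
    have hp : (u ++ x :: y :: v).Perm (u ++ y :: x :: v) := (List.Perm.swap _ _ _).append_left u
    rw [List.cons_append, List.cons_append, listSign, listSign, ih, hp.countP_eq]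
    simp only [hp.mem_iff]
    split_ifs <;> simp

theorem listSign_mul_self {l : List α} (hl : l.Nodup) : listSign l * listSign l = 1 := by
  induction l with
  | nil => rfl
  | cons x l ih =>
    rw [List.nodup_cons] at hl
    rw [listSign, if_neg hl.1, mul_mul_mul_comm, ih hl.2, ← pow_add, ← two_mul, pow_mul]
    simp

/-- The signs are cross-multiplied, so no division is needed, and the prefix `u` makes the induction
on the permutation possible. -/
theorem listSign_smul_of_perm {M : Type*} [AddCommGroup M] {F : List α → M}
    (hF : ∀ u x y v, F (u ++ x :: y :: v) = -F (u ++ y :: x :: v)) {l l' : List α}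
    (h : l.Perm l') : ∀ u, (u ++ l).Nodup →
      listSign (u ++ l') • F (u ++ l) = listSign (u ++ l) • F (u ++ l') := by
  induction h with
  | nil => exact fun _ _ => rfl
  | cons x _ ih =>
    intro u hu
    have := ih (u ++ [x]) (by simpa using hu)
    simpa using this
  | swap x y l =>
    intro u _
    rw [hF, listSign_swap, smul_neg, neg_smul, neg_neg]
  | @trans l₁ l₂ l₃ h₁ h₂ ih₁ ih₂ =>
    intro u hu
    have hu₂ : (u ++ l₂).Nodup := (h₁.append_left u).nodup_iff.1 hu
    have e₁ := ih₁ u hu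
    have e₂ := ih₂ u hu₂
    have hs := listSign_mul_self hu₂
    calc listSign (u ++ l₃) • F (u ++ l₁)
        = (listSign (u ++ l₃) * (listSign (u ++ l₂) * listSign (u ++ l₂))) • F (u ++ l₁) := by
          rw [hs, mul_one]
      _ = (listSign (u ++ l₃) * listSign (u ++ l₂)) • listSign (u ++ l₂) • F (u ++ l₁) := by
          rw [smul_smul, mul_assoc]
      _ = (listSign (u ++ l₁) * listSign (u ++ l₂)) • listSign (u ++ l₃) • F (u ++ l₂) := by
          rw [e₁, smul_smul, smul_smul]
          congr 1
          ring
      _ = listSign (u ++ l₁) • F (u ++ l₃) := by rw [e₂, smul_smul, mul_assoc, hs, mul_one]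

theorem listSign_smul_eq {M : Type*} [AddCommGroup M] {F : List α → M}
    (hF : ∀ u x y v, F (u ++ x :: y :: v) = -F (u ++ y :: x :: v)) {l l' : List α}
    (h : l.Perm l') (hl : l.Nodup) : F l' = (listSign l * listSign l') • F l := by
  have := listSign_smul_of_perm hF h [] hl
  rw [List.nil_append, List.nil_append] at this
  rw [mul_smul, this, smul_smul, listSign_mul_self hl, one_smul]

/-- Rearranging the list so that `x` and `y` come first changes both sides by the same sign; there
the map just exchanges the first two letters. -/
theorem listSign_map_swap (x y : α) (hxy : x ≠ y) {l : List α} (hl : l.Nodup) (hx : x ∈ l)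
    (hy : y ∈ l) : listSign (l.map (Equiv.swap x y)) = -listSign l := by
  have hp : l.Perm (x :: y :: (l.erase x).erase y) :=
    (List.perm_cons_erase hx).trans ((List.perm_cons_erase
      ((List.mem_erase_of_ne hxy.symm).2 hy)).cons x)
  set t := (l.erase x).erase y with ht
  have hnd : (x :: y :: t).Nodup := hp.nodup_iff.1 hl
  have hmap : (x :: y :: t).map (Equiv.swap x y) = y :: x :: t := by
    rw [List.nodup_cons, List.nodup_cons] at hnd
    rw [List.map_cons, List.map_cons, Equiv.swap_apply_left, Equiv.swap_apply_right]
    congr 2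
    conv_rhs => rw [← List.map_id t]
    refine List.map_congr_left fun z hz => Equiv.swap_apply_of_ne_of_ne ?_ ?_
    · rintro rfl
      exact hnd.1 (List.mem_cons_of_mem _ hz)
    · rintro rfl
      exact hnd.2.1 hz
  have h1 := listSign_smul_eq (F := fun l : List α => listSign (l.map (Equiv.swap x y)))
    (fun u a b v => by simp only [List.map_append, List.map_cons]; exact listSign_swap _ _ _ _)
    hp.symm hnd
  have h2 := listSign_swap [] t y x
  rw [List.nil_append, List.nil_append] at h2
  rw [h1, hmap, h2, smul_eq_mul, mul_comm (listSign (x :: y :: t)), mul_neg, mul_assoc,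
    listSign_mul_self hnd, mul_one]

/-- Decomposition into transpositions. The list must contain every element, so that each
transposition moves two of its letters. -/
theorem listSign_map [Fintype α] (σ : Equiv.Perm α) : ∀ {l : List α}, l.Nodup → (∀ x, x ∈ l) →
    listSign (l.map σ) = Equiv.Perm.sign σ * listSign l := by
  induction σ using Equiv.Perm.swap_induction_on with
  | one => intro l _ _; simp
  | swap_mul g x y hxy ih =>
    intro l hl hall
    have h1 : l.map (Equiv.swap x y * g) = (l.map g).map (Equiv.swap x y) := by simp
    have hall' : ∀ z, z ∈ l.map g := fun z => List.mem_map.2 ⟨g⁻¹ z, hall _, by simp⟩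
    rw [h1, listSign_map_swap x y hxy (hl.map g.injective) (hall' x) (hall' y), ih hl hall]
    simp [Equiv.Perm.sign_swap hxy]

theorem alternating_map [Fintype α] {M : Type*} [AddCommGroup M] {F : List α → M}
    (hF : ∀ u x y v, F (u ++ x :: y :: v) = -F (u ++ y :: x :: v)) (σ : Equiv.Perm α)
    {l : List α} (hl : l.Nodup) (hall : ∀ x, x ∈ l) :
    F (l.map σ) = ((Equiv.Perm.sign σ : ℤˣ) : ℤ) • F l := by
  have hp : l.Perm (l.map σ) := by
    rw [List.perm_ext_iff_of_nodup hl (hl.map σ.injective)]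
    exact fun x => ⟨fun _ => List.mem_map.2 ⟨σ⁻¹ x, hall _, by simp⟩, fun _ => hall x⟩
  rw [listSign_smul_eq hF hp hl, listSign_map σ hl hall, mul_left_comm, listSign_mul_self hl,
    mul_one]

omit [LinearOrder α] in
theorem symmetric_perm {M : Type*} {F : List α → M}
    (hF : ∀ u x y v, F (u ++ x :: y :: v) = F (u ++ y :: x :: v)) {l l' : List α}
    (h : l.Perm l') : ∀ u, F (u ++ l) = F (u ++ l') := by
  induction h with
  | nil => exact fun _ => rfl
  | cons x _ ih => intro u; simpa using ih (u ++ [x])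
  | swap x y l => exact fun u => hF u _ _ _
  | trans _ _ ih₁ ih₂ => exact fun u => (ih₁ u).trans (ih₂ u)

theorem listSign_move (u b v : List α) (x : α) :
    listSign (u ++ x :: (b ++ v)) = (-1) ^ b.length * listSign (u ++ (b ++ x :: v)) := by
  induction b generalizing u with
  | nil => simp
  | cons y b ih =>
    rw [List.cons_append, listSign_swap]
    have := ih (u ++ [y])
    rw [List.append_assoc, List.append_assoc] at this
    rw [List.length_cons, pow_succ, List.cons_append, mul_neg_one, neg_mul]
    exact congrArg Neg.neg this

theorem listSign_append_comm (u a b v : List α) :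
    listSign (u ++ (a ++ (b ++ v))) =
      (-1) ^ (a.length * b.length) * listSign (u ++ (b ++ (a ++ v))) := by
  induction a generalizing u with
  | nil => simp
  | cons x a ih =>
    have h1 := ih (u ++ [x])
    rw [List.append_assoc, List.append_assoc] at h1
    have h2 := listSign_move u b (a ++ v) x
    calc listSign (u ++ (x :: a ++ (b ++ v)))
        = (-1) ^ (a.length * b.length) * listSign (u ++ x :: (b ++ (a ++ v))) := h1
      _ = _ := by
        rw [h2, ← mul_assoc, ← pow_add, List.length_cons, add_mul, one_mul]
        rfl

end ListSign

/-! ## Signed products of cyclic sums -/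

section SignedForm

variable {r n : ℕ} (ζ : ∀ m : ℕ, rootsOfUnity m ℂ)

/-- The product of the cyclic sums of a list of words, times the sign of the concatenation. -/
def signedForm (r : ℕ) {n : ℕ} (ζ : ∀ m : ℕ, rootsOfUnity m ℂ) (L : List (CWord n)) : Form r n :=
  (listSign (L.map Prod.snd).flatten : ℂ) • cycList r ζ L

theorem cycList_append (L L' : List (CWord n)) :
    cycList r ζ (L ++ L') = cycList r ζ L * cycList r ζ L' := by simp [cycList]

/-- One sign comes from exchanging two segments of the concatenated word, the other from graded
commutativity. For words of equal length `b` and equal colour the exponent is `b ^ 2 + (b - 1) ^ 2`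
or `2 * b ^ 2`, so open words anticommute and closed words commute. -/
theorem signedForm_swap (L₁ L₂ : List (CWord n)) (p q : CWord n) (hp : p.2 ≠ []) (hq : q.2 ≠ []) :
    signedForm r ζ (L₁ ++ p :: q :: L₂) =
      (-1 : ℂ) ^ (p.2.length * q.2.length + wordDeg p.1 p.2 * wordDeg q.1 q.2) •
        signedForm r ζ (L₁ ++ q :: p :: L₂) := by
  have h1 := mul_comm_of_mem_pow oneForms_anti (cycWord_mem_pow (r := r) ζ p.1 hp)
    (cycWord_mem_pow (r := r) ζ q.1 hq)
  have h2 : cycList r ζ (L₁ ++ p :: q :: L₂) =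
      (-1 : ℂ) ^ (wordDeg p.1 p.2 * wordDeg q.1 q.2) • cycList r ζ (L₁ ++ q :: p :: L₂) := by
    rw [cycList_append, cycList_append, cycList_cons, cycList_cons, cycList_cons, cycList_cons,
      ← mul_assoc (cycWord r ζ p.1 p.2), h1, smul_mul_assoc, mul_smul_comm, mul_assoc]
  have h3 := listSign_append_comm (L₁.map Prod.snd).flatten p.2 q.2 (L₂.map Prod.snd).flatten
  rw [signedForm, signedForm, h2]
  simp only [List.map_append, List.map_cons, List.flatten_append, List.flatten_cons]
  rw [h3, smul_smul, smul_smul, pow_add]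
  congr 1
  push_cast
  ring

theorem signedForm_perm {L L' : List (CWord n)} (h : L.Perm L') : ∀ u : List (CWord n),
    (∀ p ∈ L, p.2 ≠ []) →
    ∃ e : ℂ, signedForm r ζ (u ++ L) = e • signedForm r ζ (u ++ L') := by
  induction h with
  | nil => exact fun _ _ => ⟨1, by rw [one_smul]⟩
  | cons x _ ih =>
    intro u hu
    obtain ⟨e, he⟩ := ih (u ++ [x]) fun p hp => hu p (List.mem_cons_of_mem _ hp)
    exact ⟨e, by simpa using he⟩
  | swap x y l =>
    intro u hu
    exact ⟨_, signedForm_swap ζ u l y x (hu y (by simp)) (hu x (by simp))⟩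
  | trans h₁ _ ih₁ ih₂ =>
    intro u hu
    obtain ⟨e₁, h₁'⟩ := ih₁ u hu
    obtain ⟨e₂, h₂'⟩ := ih₂ u fun p hp => hu p (h₁.mem_iff.2 hp)
    exact ⟨e₁ * e₂, by rw [h₁', h₂', smul_smul]⟩

theorem neg_one_pow_mul_self (k : ℕ) : ((-1 : ℂ) ^ k) * (-1) ^ k = 1 := by
  rw [← pow_add, ← two_mul, pow_mul]
  simp

theorem root_ne_zero {b : ℕ} (γ : rootsOfUnity b ℂ) : ((γ : ℂˣ) : ℂ) ≠ 0 := Units.ne_zero _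

/-- The sign drops out because `b * (b - 1)` is even; hence the cyclic sum closes up under rotation.
-/
theorem cycRatio_pow (b : ℕ) : cycRatio ζ b ^ b = 1 := by
  rw [cycRatio, mul_pow, inv_pow, root_pow, inv_one, one_mul, ← pow_mul]
  refine Even.neg_one_pow ?_
  rw [mul_comm]
  exact Nat.even_mul_pred_self b

theorem cycWord_rotate_one (c : Bool) (w : List (Fin n)) : cycWord r ζ c (w.rotate 1) =
    (((ζ w.length : ℂˣ) : ℂ) * (-1) ^ (w.length - 1)) • cycWord r ζ c w := by
  have h1 : cycRatio ζ w.length • cycWord r ζ c (w.rotate 1) = cycWord r ζ c w := by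
    rw [cycWord, cycWord, Finset.smul_sum, List.length_rotate]
    have h2 := Finset.sum_range_succ (fun j => cycRatio ζ w.length ^ j • wordForm r c (w.rotate j))
      w.length
    rw [Finset.sum_range_succ', cycRatio_pow, List.rotate_length, pow_zero, List.rotate_zero] at h2
    rw [← add_right_cancel h2]
    refine Finset.sum_congr rfl fun j _ => ?_
    rw [smul_smul, List.rotate_rotate, ← pow_succ', add_comm 1 j]
  rw [← h1, smul_smul, cycRatio, mul_mul_mul_comm, neg_one_pow_mul_self, mul_one,
    mul_inv_cancel₀ (root_ne_zero _), one_smul]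

/-- The factor `(-1) ^ (b - 1)` in `cycRatio` is the sign of a `b`-cycle. It cancels against the
sign of the concatenated word, leaving the bare root of unity needed for `ψ`. -/
theorem signedForm_rotate (c : Bool) (w : List (Fin n)) (L₁ L₂ : List (CWord n)) (j : ℕ) :
    signedForm r ζ (L₁ ++ (c, w.rotate j) :: L₂) =
      ((ζ w.length : ℂˣ) : ℂ) ^ j • signedForm r ζ (L₁ ++ (c, w) :: L₂) := by
  induction j with
  | zero => simp
  | succ j ih =>
    have h1 : ∀ w : List (Fin n), signedForm r ζ (L₁ ++ (c, w.rotate 1) :: L₂) =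
        ((ζ w.length : ℂˣ) : ℂ) • signedForm r ζ (L₁ ++ (c, w) :: L₂) := by
      intro w
      cases w with
      -- The cyclic sum of the empty word is an empty sum, so both sides vanish.
      | nil =>
        have : signedForm r ζ (L₁ ++ (c, []) :: L₂) = 0 := by
          rw [signedForm, cycList_append, cycList_cons]
          simp [cycWord]
        rw [List.rotate_nil, this, smul_zero]
      | cons x t =>
        rw [signedForm, signedForm, cycList_append, cycList_cons, cycList_append, cycList_cons,
          cycWord_rotate_one, List.rotate_cons_succ, List.rotate_zero]
        simp only [List.map_append, List.map_cons, List.flatten_append, List.flatten_cons]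
        have h2 := listSign_move (L₁.map Prod.snd).flatten t (L₂.map Prod.snd).flatten x
        have h3 : (L₁.map Prod.snd).flatten ++ (t ++ [x] ++ (L₂.map Prod.snd).flatten) =
            (L₁.map Prod.snd).flatten ++ (t ++ x :: (L₂.map Prod.snd).flatten) := by simp
        rw [h3, List.cons_append, h2, smul_mul_assoc, mul_smul_comm, smul_smul, smul_smul]
        congr 1
        have h4 := neg_one_pow_mul_self t.length
        push_cast
        rw [List.length_cons, Nat.add_sub_cancel]
        ring
    have h2 := h1 (w.rotate j)
    rw [List.rotate_rotate] at h2
    rw [h2, List.length_rotate, ih, smul_smul, pow_succ']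

theorem signedForm_map_rotate (c : Bool) {m B : ℕ} (W : Fin m → List (Fin n))
    (hW : ∀ b, (W b).length = B) (j : Fin m → ℕ) (bs : List (Fin m)) (L₂ : List (CWord n)) :
    ∀ L₁ : List (CWord n),
    signedForm r ζ (L₁ ++ (bs.map (fun b => (c, (W b).rotate (j b))) ++ L₂)) =
      (bs.map fun b => ((ζ B : ℂˣ) : ℂ) ^ j b).prod •
        signedForm r ζ (L₁ ++ (bs.map (fun b => (c, W b)) ++ L₂)) := by
  induction bs with
  | nil => intro L₁; simp
  | cons b bs ih =>
    intro L₁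
    have h1 := ih (L₁ ++ [(c, (W b).rotate (j b))])
    rw [List.append_assoc, List.append_assoc] at h1
    simp only [List.map_cons, List.prod_cons, List.cons_append]
    refine h1.trans ?_
    rw [List.singleton_append, signedForm_rotate, smul_smul, hW, mul_comm]

/-- This is the source of `ε`: equal blocks with open roots are permuted with sign, those with
closed roots without. -/
theorem signedForm_map_perm (c : Bool) {m B : ℕ} (hB : 0 < B) (W : Fin m → List (Fin n))
    (hW : ∀ b, (W b).length = B) (σ : Equiv.Perm (Fin m)) (L₁ L₂ : List (CWord n)) :
    signedForm r ζ (L₁ ++ ((List.finRange m).map (fun b => (c, W (σ b))) ++ L₂)) =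
      (if c then 1 else ((signChar (Fin m) σ : ℂˣ) : ℂ)) •
        signedForm r ζ (L₁ ++ ((List.finRange m).map (fun b => (c, W b)) ++ L₂)) := by
  have hne : ∀ b, W b ≠ [] := by
    intro b h
    have := hW b
    rw [h, List.length_nil] at this
    omega
  set F : List (Fin m) → Form r n :=
    fun l => signedForm r ζ (L₁ ++ (l.map (fun b => (c, W b)) ++ L₂)) with hF
  have hswap : ∀ u x y v, F (u ++ x :: y :: v) =
      (-1 : ℂ) ^ (B * B + (B - 1 + c.toNat) * (B - 1 + c.toNat)) • F (u ++ y :: x :: v) := by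
    intro u x y v
    have := signedForm_swap (r := r) ζ (L₁ ++ u.map fun b => (c, W b))
      (v.map (fun b => (c, W b)) ++ L₂) (c, W x) (c, W y) (hne x) (hne y)
    simpa [hF, wordDeg, hW] using this
  have hmap : (List.finRange m).map (fun b => (c, W (σ b))) =
      ((List.finRange m).map σ).map (fun b => (c, W b)) := by
    rw [List.map_map]
    rfl
  rw [hmap]
  change F ((List.finRange m).map σ) = _ • F (List.finRange m)
  obtain ⟨B, rfl⟩ : ∃ B', B = B' + 1 := ⟨B - 1, by omega⟩
  cases c with
  | false =>
    have hodd : (-1 : ℂ) ^ ((B + 1) * (B + 1) +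
        (B + 1 - 1 + false.toNat) * (B + 1 - 1 + false.toNat)) = -1 := by
      refine Odd.neg_one_pow ⟨B * B + B, ?_⟩
      simp only [Bool.toNat_false, Nat.add_sub_cancel]
      ring
    have := alternating_map (F := F) (fun u x y v => by rw [hswap, hodd, neg_one_smul]) σ
      (List.nodup_finRange m) (List.mem_finRange)
    rw [this, if_neg (by simp), ← Int.cast_smul_eq_zsmul ℂ]
    rfl
  | true =>
    have heven : (-1 : ℂ) ^ ((B + 1) * (B + 1) +
        (B + 1 - 1 + true.toNat) * (B + 1 - 1 + true.toNat)) = 1 := by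
      refine Even.neg_one_pow ⟨(B + 1) * (B + 1), ?_⟩
      simp only [Bool.toNat_true, Nat.add_sub_cancel]
    rw [if_pos rfl, one_smul]
    have hp : ((List.finRange m).map σ).Perm (List.finRange m) := by
      rw [List.perm_ext_iff_of_nodup ((List.nodup_finRange m).map σ.injective)
        (List.nodup_finRange m)]
      exact fun x => ⟨fun _ => List.mem_finRange x,
        fun _ => List.mem_map.2 ⟨σ⁻¹ x, List.mem_finRange _, by simp⟩⟩
    exact symmetric_perm (F := F) (fun u x y v => by rw [hswap, heven, one_smul]) hp []

theorem formAct_prm_pathForm (w : Equiv.Perm (Fin n)) (l : List (Fin n)) :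
    formAct r n (prm r w) (pathForm (diag r n) l) = pathForm (diag r n) (l.map w) := by
  induction l with
  | nil => exact map_one _
  | cons x l ih =>
    cases l with
    | nil => exact map_one _
    | cons y l =>
      rw [pathForm_cons_cons, map_mul, ih, formAct_prm_diag]
      rfl

theorem formAct_prm_wordForm (w : Equiv.Perm (Fin n)) (c : Bool) (l : List (Fin n)) :
    formAct r n (prm r w) (wordForm r c l) = wordForm r c (l.map w) := by
  cases c with
  | false => exact formAct_prm_pathForm w l
  | true =>
    rw [wordForm, map_mul, formAct_prm_pathForm, wordForm]
    congr 1
    rcases List.eq_nil_or_concat' l with rfl | ⟨u, x, rfl⟩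
    · exact map_one _
    · rw [lastForm_append_singleton, formAct_prm_omega, List.map_append, List.map_singleton,
        lastForm_append_singleton]

theorem formAct_prm_cycWord (w : Equiv.Perm (Fin n)) (c : Bool) (l : List (Fin n)) :
    formAct r n (prm r w) (cycWord r ζ c l) = cycWord r ζ c (l.map w) := by
  rw [cycWord, cycWord, map_sum, List.length_map]
  refine Finset.sum_congr rfl fun j _ => ?_
  rw [map_smul, formAct_prm_wordForm, List.map_rotate]

theorem formAct_prm_cycList (w : Equiv.Perm (Fin n)) (L : List (CWord n)) :
    formAct r n (prm r w) (cycList r ζ L) = cycList r ζ (L.map fun p => (p.1, p.2.map w)) := by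
  rw [cycList, map_list_prod, List.map_map, cycList, List.map_map]
  congr 1
  exact List.map_congr_left fun p _ => formAct_prm_cycWord ζ w p.1 p.2

/-- Renaming the letters multiplies the sign of the concatenation by the sign of `w`. Twisting by
the sign character makes the action a pure relabelling. -/
theorem formAct_prm_signedForm (w : Equiv.Perm (Fin n)) (L : List (CWord n))
    (hL : (L.map Prod.snd).flatten.Perm (List.finRange n)) :
    ((signChar (Fin n) w : ℂˣ) : ℂ) • formAct r n (prm r w) (signedForm r ζ L) =
      signedForm r ζ (L.map fun p => (p.1, p.2.map w)) := by
  have h1 : ((L.map fun p => (p.1, p.2.map w)).map Prod.snd).flatten =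
      (L.map Prod.snd).flatten.map w := by
    rw [List.map_map, List.map_flatten, List.map_map]
    rfl
  rw [signedForm, signedForm, map_smul, formAct_prm_cycList, smul_smul, h1,
    listSign_map w (hL.nodup_iff.2 (List.nodup_finRange n))
      fun x => hL.mem_iff.2 (List.mem_finRange x)]
  push_cast
  rfl

end SignedForm

/-! ## The words of the blocks -/

section BlockWords

variable {r : ℕ} {a : ℕ} {lam : Nat.Partition a} {X : Type*}

/-- The word of a block. -/
def blockWord (f : Vertex r lam → X) (i : Fin a) (b : Fin (mult lam i)) : List X :=
  List.ofFn fun t : Fin (r * (i.1 + 1)) => f ⟨i, b, ((t : ℕ) : ZMod (r * (i.1 + 1)))⟩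

@[simp] theorem length_blockWord (f : Vertex r lam → X) (i : Fin a) (b : Fin (mult lam i)) :
    (blockWord f i b).length = r * (i.1 + 1) := by simp [blockWord]

theorem blockWord_map {Y : Type*} (g : X → Y) (f : Vertex r lam → X) (i : Fin a)
    (b : Fin (mult lam i)) : (blockWord f i b).map g = blockWord (g ∘ f) i b := by
  rw [blockWord, List.map_ofFn]
  rfl

/-- The list of all blocks. -/
def blockIndex (lam : Nat.Partition a) : List (Σ i : Fin a, Fin (mult lam i)) :=
  (List.finRange a).flatMap fun i => (List.finRange (mult lam i)).map fun b => ⟨i, b⟩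

theorem nodup_blockIndex : (blockIndex lam).Nodup := by
  rw [blockIndex, List.nodup_flatMap]
  refine ⟨fun i _ => (List.nodup_finRange _).map fun b b' h => by simpa using h, ?_⟩
  refine (List.nodup_finRange a).imp fun {i j} hij => ?_
  intro x hx hx'
  rw [List.mem_map] at hx hx'
  obtain ⟨b, _, rfl⟩ := hx
  obtain ⟨b', _, h⟩ := hx'
  exact hij (congrArg Sigma.fst h).symm

theorem mem_blockIndex (x : Σ i : Fin a, Fin (mult lam i)) : x ∈ blockIndex lam := by
  rw [blockIndex, List.mem_flatMap]
  exact ⟨x.1, List.mem_finRange _, List.mem_map.2 ⟨x.2, List.mem_finRange _, rfl⟩⟩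

theorem sum_mult : ∑ i : Fin a, mult lam i = lam.parts.card := by
  have h₁ : lam.parts.card = ∑ m ∈ Finset.range (a + 1), lam.parts.count m :=
    (Multiset.sum_count_eq_card fun m hm => by
      rw [Finset.mem_range, Nat.lt_succ_iff, ← lam.parts_sum]
      exact Multiset.le_sum_of_mem hm).symm
  have h₀ : lam.parts.count 0 = 0 :=
    Multiset.count_eq_zero.2 fun h => lt_irrefl _ (lam.parts_pos h)
  rw [h₁, Finset.sum_range_succ', h₀, add_zero, Finset.sum_range]
  rfl

theorem length_blockIndex : (blockIndex lam).length = lam.parts.card := by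
  rw [← sum_mult, blockIndex, List.length_flatMap, Fin.sum_univ_def]
  simp

/-- The list of coloured words of all blocks. -/
def blockList (c : Bool) (f : Vertex r lam → X) : List (Bool × List X) :=
  (blockIndex lam).map fun x => (c, blockWord f x.1 x.2)

variable [NeZero r]

omit [NeZero r] in
theorem nodup_blockWord {f : Vertex r lam → X} (hf : Function.Injective f) (i : Fin a)
    (b : Fin (mult lam i)) : (blockWord f i b).Nodup := by
  refine List.nodup_ofFn.2 fun t t' h => ?_
  have h1 := hf h
  simp only [Sigma.mk.injEq, heq_eq_eq, Prod.mk.injEq, true_and] at h1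
  have h2 := congrArg ZMod.val h1
  rw [ZMod.val_natCast_of_lt t.2, ZMod.val_natCast_of_lt t'.2] at h2
  exact Fin.ext h2

theorem mem_blockWord {f : Vertex r lam → X} {i : Fin a} {b : Fin (mult lam i)} {x : X} :
    x ∈ blockWord f i b ↔ ∃ t, f ⟨i, b, t⟩ = x := by
  rw [blockWord, List.mem_ofFn]
  constructor
  · rintro ⟨t, rfl⟩
    exact ⟨_, rfl⟩
  · rintro ⟨t, rfl⟩
    exact ⟨⟨t.val, ZMod.val_lt t⟩, by simp⟩

theorem mem_flatten_blockList {c : Bool} {f : Vertex r lam → X} {x : X} :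
    x ∈ ((blockList c f).map Prod.snd).flatten ↔ ∃ v, f v = x := by
  rw [List.mem_flatten]
  constructor
  · rintro ⟨l, hl, hx⟩
    rw [blockList, List.map_map, List.mem_map] at hl
    obtain ⟨y, _, rfl⟩ := hl
    obtain ⟨t, ht⟩ := mem_blockWord.1 hx
    exact ⟨_, ht⟩
  · rintro ⟨⟨i, b, t⟩, rfl⟩
    refine ⟨blockWord f i b, ?_, mem_blockWord.2 ⟨t, rfl⟩⟩
    rw [blockList, List.map_map, List.mem_map]
    exact ⟨⟨i, b⟩, mem_blockIndex _, rfl⟩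

theorem nodup_flatten_blockList (c : Bool) {f : Vertex r lam → X} (hf : Function.Injective f) :
    ((blockList c f).map Prod.snd).flatten.Nodup := by
  rw [List.nodup_flatten, blockList, List.map_map]
  constructor
  · intro l hl
    rw [List.mem_map] at hl
    obtain ⟨y, _, rfl⟩ := hl
    exact nodup_blockWord hf _ _
  · rw [List.pairwise_map]
    refine nodup_blockIndex.imp fun {x y} hxy => ?_
    intro z hz hz'
    obtain ⟨t, ht⟩ := mem_blockWord.1 hz
    obtain ⟨t', ht'⟩ := mem_blockWord.1 hz'
    refine hxy ?_
    have := hf (ht.trans ht'.symm)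
    obtain ⟨i, b⟩ := x
    obtain ⟨i', b'⟩ := y
    have h1 : i = i' := congrArg Sigma.fst this
    subst h1
    simp only [Sigma.mk.injEq, heq_eq_eq, Prod.mk.injEq, true_and] at this ⊢
    exact this.1

/-- The cyclic component is read at the image block, since `blockPerm` permutes the blocks and then
rotates. -/
theorem blockWord_comp_blockPerm (f : Vertex r lam → X) (g : BlockGroup r lam) (i : Fin a)
    (b : Fin (mult lam i)) : blockWord (f ∘ blockPerm r lam g) i b =
      (blockWord f i (g.right i b)).rotate (g.left i (g.right i b)).toAdd.val := by
  refine List.ext_getElem (by simp) fun k hk _ => ?_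
  rw [List.getElem_rotate]
  simp only [blockWord, List.getElem_ofFn, Function.comp_apply, List.length_ofFn]
  have : blockPerm r lam g ⟨i, b, (k : ZMod (r * (i.1 + 1)))⟩ =
      ⟨i, g.right i b, (g.left i (g.right i b)).toAdd + (k : ZMod (r * (i.1 + 1)))⟩ := rfl
  rw [this]
  congr 3
  rw [ZMod.natCast_mod, Nat.cast_add, ZMod.natCast_zmod_val]
  exact add_comm _ _

variable {n : ℕ} (ζ : ∀ m : ℕ, rootsOfUnity m ℂ)

/-- The character by which a block group acts on the form of its blocks. -/
def blockChar (c : Bool) (g : BlockGroup r lam) : ℂˣ :=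
  (if c then 1 else eps r lam g) * psi r lam ζ g

theorem signedForm_blockList (c : Bool) (f : Vertex r lam → Fin n) (g : BlockGroup r lam)
    (L₁ L₂ : List (CWord n)) :
    signedForm r ζ (L₁ ++ (blockList c (f ∘ blockPerm r lam g) ++ L₂)) =
      ((blockChar ζ c g : ℂˣ) : ℂ) • signedForm r ζ (L₁ ++ (blockList c f ++ L₂)) := by
  set χ : Fin a → ℂ := fun i => (if c then 1 else ((signChar _ (g.right i) : ℂˣ) : ℂ)) *
    ∏ b, ((cycChar (ζ (r * (i.1 + 1))) (g.left i b) : ℂˣ) : ℂ) with hχ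
  -- Blocks of one size: the permutation is undone first and the rotations afterwards. `hall` then
  -- runs through the sizes, with the list before the current one left arbitrary.
  have hstep : ∀ (i : Fin a) (A B : List (CWord n)),
      signedForm r ζ (A ++ ((List.finRange (mult lam i)).map
        (fun b => (c, blockWord (f ∘ blockPerm r lam g) i b)) ++ B)) =
      χ i • signedForm r ζ (A ++ ((List.finRange (mult lam i)).map
        (fun b => (c, blockWord f i b)) ++ B)) := by
    intro i A B
    have hpos : 0 < r * (i.1 + 1) := Nat.mul_pos (NeZero.pos r) (Nat.succ_pos _)
    have h1 := signedForm_map_perm (r := r) ζ c hpos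
      (fun b => (blockWord f i b).rotate (g.left i b).toAdd.val) (fun b => by simp) (g.right i) A B
    have h2 := signedForm_map_rotate (r := r) ζ c (fun b => blockWord f i b)
      (fun b => length_blockWord f i b) (fun b => (g.left i b).toAdd.val)
      (List.finRange (mult lam i)) B A
    simp only [blockWord_comp_blockPerm]
    rw [h1, h2, smul_smul, hχ]
    congr 2
  have hall : ∀ (is : List (Fin a)) (A : List (CWord n)),
      signedForm r ζ (A ++ (is.flatMap (fun i => (List.finRange (mult lam i)).map
        (fun b => (c, blockWord (f ∘ blockPerm r lam g) i b))) ++ L₂)) =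
      (is.map χ).prod • signedForm r ζ (A ++ (is.flatMap (fun i =>
        (List.finRange (mult lam i)).map (fun b => (c, blockWord f i b))) ++ L₂)) := by
    intro is
    induction is with
    | nil => intro A; simp
    | cons i is ih =>
      intro A
      have h1 := ih (A ++ (List.finRange (mult lam i)).map
        (fun b => (c, blockWord (f ∘ blockPerm r lam g) i b)))
      simp only [List.append_assoc] at h1
      rw [List.flatMap_cons, List.flatMap_cons, List.append_assoc, List.append_assoc, h1, hstep,
        smul_smul, List.map_cons, List.prod_cons, mul_comm]
  have hlist : ∀ f : Vertex r lam → Fin n, blockList c f = (List.finRange a).flatMap fun i =>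
      (List.finRange (mult lam i)).map fun b => (c, blockWord f i b) := by
    intro f
    rw [blockList, blockIndex, List.map_flatMap]
    simp only [List.map_map]
    rfl
  rw [hlist, hlist, hall]
  congr 1
  rw [← Fin.prod_univ_def, hχ, Finset.prod_mul_distrib, blockChar, Units.val_mul]
  congr 1
  · cases c
    · simp [eps, Units.coe_prod]
    · simp
  · simp [psi, Units.coe_prod]

end BlockWords

/-! ## Lists of words as lists of blocks -/

section Sorting

/-- Bucket sort: every entry belongs to exactly one of the classes given by the keys. -/
theorem perm_flatMap_filter {α κ : Type*} (p : κ → α → Bool) (keys : List κ) (hk : keys.Nodup)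
    (hp : ∀ k k' x, p k x = true → p k' x = true → k = k') : ∀ l : List α,
    (∀ x ∈ l, ∃ k ∈ keys, p k x = true) → l.Perm (keys.flatMap fun k => l.filter (p k)) := by
  induction keys with
  | nil =>
    intro l hl
    cases l with
    | nil => exact List.Perm.refl _
    | cons x l => obtain ⟨k, hk, _⟩ := hl x (by simp); simp at hk
  | cons k keys ih =>
    intro l hl
    rw [List.nodup_cons] at hk
    have h1 := ih hk.2 (l.filter fun x => !p k x) fun x hx => by
      rw [List.mem_filter] at hx
      obtain ⟨k', hk', hx'⟩ := hl x hx.1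
      rcases List.mem_cons.1 hk' with rfl | hk'
      · simp [hx'] at hx
      · exact ⟨k', hk', hx'⟩
    have h2 : (keys.flatMap fun k' => (l.filter fun x => !p k x).filter (p k')) =
        keys.flatMap fun k' => l.filter (p k') := by
      refine List.flatMap_congr fun k' hk' => ?_
      rw [List.filter_filter]
      refine List.filter_congr fun x _ => ?_
      by_cases hx : p k' x = true
      · have : p k x ≠ true := by
          intro h
          have := hp _ _ _ h hx
          subst this
          exact hk.1 hk'
        simp [hx, this]
      · simp [hx]
    rw [h2] at h1
    rw [List.flatMap_cons]
    exact (List.filter_append_perm (p k) l).symm.trans (h1.append_left _)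

theorem map_get_cast {α : Type*} (l : List α) {m : ℕ} (h : l.length = m) :
    (List.finRange m).map (fun b => l.get (b.cast h.symm)) = l := by
  subst h
  rw [← List.ofFn_eq_map]
  exact List.ofFn_get l

variable {r : ℕ} [NeZero r] {X : Type*}

/-- A list of words whose lengths are divisible by `r` is the list of blocks of a partition. -/
theorem exists_blockList (c : Bool) (Ws : List (List X))
    (hdvd : ∀ w ∈ Ws, r ∣ w.length) {a : ℕ} (lam : Nat.Partition a)
    (hlam : lam.parts = ((Ws.map fun w => w.length / r : List ℕ) : Multiset ℕ)) :
    ∃ f : Vertex r lam → X, (Ws.map fun w => (c, w)).Perm (blockList c f) := by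
  have hr : 0 < r := NeZero.pos r
  -- Words are sorted by length. As the parts of `lam` are the lengths divided by `r`, each class
  -- has exactly the required multiplicity.
  set q : Fin a → List X → Bool := fun i w => decide (w.length = r * (i.1 + 1)) with hq
  have hcount : ∀ i : Fin a, (Ws.filter (q i)).length = mult lam i := by
    intro i
    rw [mult, hlam, Multiset.coe_count, List.count, List.countP_map, List.countP_eq_length_filter]
    congr 1
    refine List.filter_congr fun w hw => ?_
    obtain ⟨e, he⟩ := hdvd w hw
    simp only [hq, Function.comp_apply, he, Nat.mul_div_cancel_left e hr]
    rw [Bool.eq_iff_iff, decide_eq_true_iff, beq_iff_eq]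
    exact ⟨fun h => Nat.eq_of_mul_eq_mul_left hr h, fun h => by rw [h]⟩
  have hlen : ∀ (i : Fin a) (b : Fin (mult lam i)),
      ((Ws.filter (q i)).get (b.cast (hcount i).symm)).length = r * (i.1 + 1) := by
    intro i b
    have h1 := List.get_mem (Ws.filter (q i)) (b.cast (hcount i).symm)
    rw [List.mem_filter] at h1
    simpa [hq] using h1.2
  refine ⟨fun v => ((Ws.filter (q v.1)).get (v.2.1.cast (hcount v.1).symm)).get
    ⟨v.2.2.val, by rw [hlen]; exact ZMod.val_lt _⟩, ?_⟩
  rw [blockList, blockIndex, List.map_flatMap]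
  simp only [List.map_map]
  have hword : ∀ i : Fin a, ((List.finRange (mult lam i)).map
      ((fun x : Σ i : Fin a, Fin (mult lam i) => (c, blockWord (r := r) (fun v : Vertex r lam =>
        ((Ws.filter (q v.1)).get (v.2.1.cast (hcount v.1).symm)).get
        ⟨v.2.2.val, by rw [hlen]; exact ZMod.val_lt _⟩) x.1 x.2)) ∘ fun b => ⟨i, b⟩)) =
      (Ws.filter (q i)).map fun w => (c, w) := by
    intro i
    conv_rhs => rw [← map_get_cast (Ws.filter (q i)) (hcount i), List.map_map]
    refine List.map_congr_left fun b _ => ?_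
    simp only [Function.comp_apply, Prod.mk.injEq, true_and]
    refine List.ext_getElem ?_ fun k hk hk' => ?_
    · rw [length_blockWord, hlen]
    · rw [length_blockWord] at hk
      simp only [blockWord, List.getElem_ofFn, List.get_eq_getElem, ZMod.val_natCast_of_lt hk]
  simp only [hword]
  have h1 := (perm_flatMap_filter q (List.finRange a) (List.nodup_finRange a) ?_ Ws ?_).map
    (fun w => (c, w))
  · rwa [List.map_flatMap] at h1
  · intro i j w hi hj
    simp only [hq, decide_eq_true_iff] at hi hj
    have := Nat.eq_of_mul_eq_mul_left hr (hi.symm.trans hj)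
    exact Fin.ext (by omega)
  · intro w hw
    obtain ⟨e, he⟩ := hdvd w hw
    have hmem : e ∈ lam.parts := by
      rw [hlam, Multiset.mem_coe, List.mem_map]
      exact ⟨w, hw, by rw [he, Nat.mul_div_cancel_left e hr]⟩
    have hpos := lam.parts_pos hmem
    have hle : e ≤ a := by
      rw [← lam.parts_sum]
      exact Multiset.le_sum_of_mem hmem
    refine ⟨⟨e - 1, by omega⟩, List.mem_finRange _, ?_⟩
    simp only [hq, decide_eq_true_iff, he]
    congr 1
    omega

/-- The partition of the lengths of a list of words, divided by `r`. -/
def lengthPartition (r : ℕ) [NeZero r] (Ws : List (List X)) (hne : ∀ w ∈ Ws, w ≠ [])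
    (hdvd : ∀ w ∈ Ws, r ∣ w.length) : Nat.Partition (Ws.map fun w => w.length / r).sum where
  parts := ((Ws.map fun w => w.length / r : List ℕ) : Multiset ℕ)
  parts_pos := by
    intro i hi
    rw [Multiset.mem_coe, List.mem_map] at hi
    obtain ⟨w, hw, rfl⟩ := hi
    exact Nat.div_pos (Nat.le_of_dvd (List.length_pos_iff.2 (hne w hw)) (hdvd w hw)) (NeZero.pos r)
  parts_sum := by simp

omit [NeZero r] in
theorem mul_sum_length_div (Ws : List (List X)) (hdvd : ∀ w ∈ Ws, r ∣ w.length) :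
    r * (Ws.map fun w => w.length / r).sum = Ws.flatten.length := by
  induction Ws with
  | nil => rfl
  | cons w Ws ih =>
    rw [List.map_cons, List.sum_cons, mul_add, ih fun w' h => hdvd w' (List.mem_cons_of_mem _ h),
      Nat.mul_div_cancel' (hdvd w (by simp)), List.flatten_cons, List.length_append]

end Sorting

/-! ## The vectors attached to an identification of the blocks -/

section BlockVec

variable {r n k l : ℕ} [NeZero r]

/-- The list of coloured words of all blocks of a pair of partitions. -/
def pairList {P : PartitionPair r n k l} (f : Vertex r P.fst ⊕ Vertex r P.snd → Fin n) :
    List (CWord n) :=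
  blockList false (f ∘ Sum.inl) ++ blockList true (f ∘ Sum.inr)

omit [NeZero r] in
theorem count_blockList {a : ℕ} {lam : Nat.Partition a} (c c' : Bool) (f : Vertex r lam → Fin n) :
    ((blockList c f).map Prod.fst).count c' = if c = c' then lam.parts.card else 0 := by
  rw [blockList, List.map_map]
  have : (Prod.fst ∘ fun x : Σ i : Fin a, Fin (mult lam i) => (c, blockWord f x.1 x.2)) =
      Function.const _ c := rfl
  rw [this, List.map_const, length_blockIndex, List.count_replicate]
  simp

theorem admissible_pairList {P : PartitionPair r n k l}
    {f : Vertex r P.fst ⊕ Vertex r P.snd → Fin n} (hf : Function.Bijective f) :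
    Admissible r k l (pairList f) where
  perm := by
    rw [pairList, List.map_append, List.flatten_append]
    refine (List.perm_ext_iff_of_nodup ?_ (List.nodup_finRange n)).2 fun x => ?_
    · refine List.Nodup.append (nodup_flatten_blockList _ (hf.1.comp Sum.inl_injective))
        (nodup_flatten_blockList _ (hf.1.comp Sum.inr_injective)) ?_
      intro x hx hx'
      obtain ⟨v, hv⟩ := mem_flatten_blockList.1 hx
      obtain ⟨v', hv'⟩ := mem_flatten_blockList.1 hx'
      exact Sum.inl_ne_inr (hf.1 (hv.trans hv'.symm))
    · refine ⟨fun _ => List.mem_finRange x, fun _ => ?_⟩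
      rw [List.mem_append, mem_flatten_blockList, mem_flatten_blockList]
      obtain ⟨v | v, rfl⟩ := hf.2 x
      · exact Or.inl ⟨v, rfl⟩
      · exact Or.inr ⟨v, rfl⟩
  ne_nil := by
    intro p hp h
    have h0 : p.2.length = 0 := by rw [h]; rfl
    rw [pairList, List.mem_append, blockList, blockList, List.mem_map, List.mem_map] at hp
    have hr := NeZero.pos r
    rcases hp with ⟨x, _, rfl⟩ | ⟨x, _, rfl⟩
    all_goals
      simp only [length_blockWord, Nat.mul_eq_zero] at h0
      omega
  dvd := by
    intro p hp
    rw [pairList, List.mem_append, blockList, blockList, List.mem_map, List.mem_map] at hp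
    rcases hp with ⟨x, _, rfl⟩ | ⟨x, _, rfl⟩
    all_goals
      rw [length_blockWord]
      exact dvd_mul_right _ _
  count_true := by
    rw [pairList, List.map_append, List.count_append, count_blockList, count_blockList,
      P.length_snd]
    simp
  count_false := by
    rw [pairList, List.map_append, List.count_append, count_blockList, count_blockList]
    have := P.length_fst
    simp
    omega

/-- The words are separated by colour, and the lengths divided by `r` give the two partitions. The
labelling reaches every letter, and equality of cardinals makes it bijective. -/
theorem exists_pairList {L : List (CWord n)} (hL : Admissible r k l L) :
    ∃ (P : PartitionPair r n k l) (f : Vertex r P.fst ⊕ Vertex r P.snd → Fin n),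
      Function.Bijective f ∧ L.Perm (pairList f) := by
  set Ws : Bool → List (List (Fin n)) := fun c => (L.filter fun p => p.1 == c).map Prod.snd with hWs
  have hback : ∀ c, (Ws c).map (fun w => (c, w)) = L.filter fun p => p.1 == c := by
    intro c
    rw [hWs, List.map_map]
    conv_rhs => rw [← List.map_id (L.filter fun p => p.1 == c)]
    refine List.map_congr_left fun p hp => ?_
    rw [List.mem_filter, beq_iff_eq] at hp
    exact Prod.ext hp.2.symm rfl
  have hsplit : L.Perm ((Ws false).map (fun w => (false, w)) ++ (Ws true).map fun w => (true, w)) := by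
    rw [hback, hback]
    refine (List.filter_append_perm (fun p : CWord n => p.1 == false) L).symm.trans ?_
    have : (L.filter fun p => !(p.1 == false)) = L.filter fun p => p.1 == true :=
      List.filter_congr fun p _ => by cases p.1 <;> rfl
    rw [this]
  have hmem : ∀ c, ∀ w ∈ Ws c, (c, w) ∈ L := by
    intro c w hw
    have : (c, w) ∈ L.filter fun p => p.1 == c := by
      rw [← hback]
      exact List.mem_map_of_mem hw
    exact (List.mem_filter.1 this).1
  have hne : ∀ c, ∀ w ∈ Ws c, w ≠ [] := fun c w hw => hL.ne_nil _ (hmem c w hw)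
  have hdvd : ∀ c, ∀ w ∈ Ws c, r ∣ w.length := fun c w hw => hL.dvd _ (hmem c w hw)
  have hcount : ∀ c, (Ws c).length = (L.map Prod.fst).count c := by
    intro c
    rw [hWs, List.length_map, List.count, List.countP_map, List.countP_eq_length_filter]
    rfl
  let P : PartitionPair r n k l :=
    { size₁ := _
      size₂ := _
      fst := lengthPartition r (Ws false) (hne false) (hdvd false)
      snd := lengthPartition r (Ws true) (hne true) (hdvd true)
      size_eq := by
        rw [mul_add, mul_sum_length_div _ (hdvd false), mul_sum_length_div _ (hdvd true)]
        have h1 := (hsplit.map Prod.snd).flatten.length_eq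
        rw [hL.perm.length_eq, List.length_finRange] at h1
        simpa [Function.comp_def] using h1.symm
      length_fst := by
        have h1 : (lengthPartition r (Ws false) (hne false) (hdvd false)).parts.card =
            (Ws false).length := by simp [lengthPartition]
        rw [h1, hcount, add_assoc]
        exact hL.count_false
      length_snd := by
        have h1 : (lengthPartition r (Ws true) (hne true) (hdvd true)).parts.card =
            (Ws true).length := by simp [lengthPartition]
        rw [h1, hcount]
        exact hL.count_true }
  obtain ⟨f₁, h₁⟩ := exists_blockList (r := r) false (Ws false) (hdvd false) P.fst rfl
  obtain ⟨f₂, h₂⟩ := exists_blockList (r := r) true (Ws true) (hdvd true) P.snd rfl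
  have hperm : L.Perm (pairList (P := P) (Sum.elim f₁ f₂)) := by
    rw [pairList, Sum.elim_comp_inl, Sum.elim_comp_inr]
    exact hsplit.trans (h₁.append h₂)
  refine ⟨P, Sum.elim f₁ f₂, ?_, hperm⟩
  have hsurj : Function.Surjective (Sum.elim f₁ f₂) := by
    intro x
    have h1 : x ∈ (L.map Prod.snd).flatten := hL.perm.mem_iff.2 (List.mem_finRange x)
    rw [(hperm.map Prod.snd).flatten.mem_iff, pairList, List.map_append, List.flatten_append,
      List.mem_append, mem_flatten_blockList, mem_flatten_blockList] at h1
    rcases h1 with ⟨v, hv⟩ | ⟨v, hv⟩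
    · exact ⟨Sum.inl v, hv⟩
    · exact ⟨Sum.inr v, hv⟩
  exact (Fintype.bijective_iff_surjective_and_card _).2
    ⟨hsurj, Fintype.card_congr P.vertexEquiv⟩

variable (ζ : ∀ m : ℕ, rootsOfUnity m ℂ)

theorem signedForm_mem_filtration {L : List (CWord n)} (hL : Admissible r k l L) :
    signedForm r ζ L ∈ filtration r n (k + l) l :=
  Submodule.smul_mem _ _ (cycList_mem_filtration ζ hL)

/-- The vector attached to an identification of the blocks with `{1, …, n}`. -/
def blockVec (s : ℤ) {P : PartitionPair r n k l} (f : Vertex r P.fst ⊕ Vertex r P.snd ≃ Fin n) :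
    isotypic (repA r n k l) s :=
  isoMap r n k l s ⟨signedForm r ζ (pairList f),
    signedForm_mem_filtration ζ (admissible_pairList f.bijective)⟩

theorem isoMap_congr_smul (s : ℤ) {x y : filtration r n (k + l) l} {c : ℂ}
    (h : x.1 = c • y.1) : isoMap r n k l s x = c • isoMap r n k l s y := by
  rw [← map_smul]
  congr 1
  exact Subtype.ext h

/-- Relabelling inside the blocks scales the vector by `ε ψ`; this is the eigenvector property
required for a map out of the induced character. -/
theorem blockVec_comp (s : ℤ) {P : PartitionPair r n k l}
    (f : Vertex r P.fst ⊕ Vertex r P.snd ≃ Fin n) (g : BlockGroup r P.fst × BlockGroup r P.snd) :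
    blockVec ζ s ((Equiv.sumCongr (blockPerm r P.fst g.1) (blockPerm r P.snd g.2)).trans f) =
      ((P.character ζ g : ℂˣ) : ℂ) • blockVec ζ s f := by
  refine isoMap_congr_smul s ?_
  change signedForm r ζ (blockList false ((f ∘ Sum.inl) ∘ blockPerm r P.fst g.1) ++
    blockList true ((f ∘ Sum.inr) ∘ blockPerm r P.snd g.2)) =
    _ • signedForm r ζ (blockList false (f ∘ Sum.inl) ++ blockList true (f ∘ Sum.inr))
  have h1 := signedForm_blockList ζ false (f ∘ Sum.inl) g.1 []
    (blockList true ((f ∘ Sum.inr) ∘ blockPerm r P.snd g.2))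
  have h2 := signedForm_blockList ζ true (f ∘ Sum.inr) g.2 (blockList false (f ∘ Sum.inl)) []
  rw [List.nil_append, List.nil_append] at h1
  rw [List.append_nil, List.append_nil] at h2
  rw [h1, h2, smul_smul]
  congr 1
  simp [blockChar, PartitionPair.character]

theorem isotypicRep_blockVec (s : ℤ) {P : PartitionPair r n k l}
    (f : Vertex r P.fst ⊕ Vertex r P.snd ≃ Fin n) (w : Equiv.Perm (Fin n)) :
    ((signChar (Fin n) w : ℂˣ) : ℂ) • isotypicRep (repA r n k l) s w (blockVec ζ s f) =
      blockVec ζ s (f.trans w) := by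
  rw [blockVec, isotypicRep_isoMap, ← map_smul, blockVec]
  congr 1
  refine Subtype.ext ?_
  have h1 := formAct_prm_signedForm (r := r) ζ w (pairList f)
    (admissible_pairList f.bijective).perm
  refine h1.trans ?_
  congr 1
  simp only [pairList, blockList, List.map_append, List.map_map, Function.comp_def,
    blockWord_map, Equiv.trans_apply]

/-- An admissible product of cyclic sums can be reordered into the standard order of blocks, which
costs only a scalar. -/
theorem span_blockVec (hζ : ∀ m, 0 < m → IsPrimitiveRoot (ζ m) m) {s : ℤ}
    (hs : IsCoprime s (r : ℤ)) :
    Submodule.span ℂ {x | ∃ (P : PartitionPair r n k l)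
      (f : Vertex r P.fst ⊕ Vertex r P.snd ≃ Fin n), x = blockVec ζ s f} = ⊤ := by
  refine isotypic_eq_top ζ hζ hs _ fun L hL => ?_
  obtain ⟨P, f, hf, hperm⟩ := exists_pairList hL
  obtain ⟨e, he⟩ := signedForm_perm (r := r) ζ hperm [] hL.ne_nil
  rw [List.nil_append, List.nil_append] at he
  have hsq := listSign_mul_self (hL.perm.nodup_iff.2 (List.nodup_finRange n))
  have h1 : cycList r ζ L = ((listSign (L.map Prod.snd).flatten : ℂ) * e) •
      signedForm r ζ (pairList f) := by
    rw [mul_smul, ← he, signedForm, smul_smul]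
    have : (listSign (L.map Prod.snd).flatten : ℂ) * listSign (L.map Prod.snd).flatten = 1 := by
      exact_mod_cast hsq
    rw [this, one_smul]
  rw [isoMap_congr_smul (y := ⟨signedForm r ζ (pairList f),
    signedForm_mem_filtration ζ (admissible_pairList hf)⟩) s h1]
  exact Submodule.smul_mem _ _ (Submodule.subset_span ⟨P, Equiv.ofBijective f hf, rfl⟩)

end BlockVec

/-! ## Maps out of sums of induced characters -/

section Induced

variable {G H B : Type*} [Group G] [Group H] [AddCommGroup B] [Module ℂ B] (φ : G →* H)
  (χ : G →* ℂˣ) (σ : Representation ℂ H B)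

/-- The map from an induced character given by a vector on which the subgroup acts by this
character. -/
def indLift (v : B) (hv : ∀ g, σ (φ g) v = ((χ g : ℂˣ) : ℂ) • v) :
    Representation.IndV φ (charRep χ) →ₗ[ℂ] B :=
  Representation.Coinvariants.lift _
    (TensorProduct.lift ((Finsupp.lift _ _ _ fun h => LinearMap.toSpanSingleton ℂ B (σ h⁻¹ v)) ∘ₗ
      (MonoidAlgebra.coeffLinearEquiv ℂ).toLinearMap))
    fun g => by
      ext h
      -- In these coinvariants the subgroup acts by left translation, so `mk h` is sent to `σ h⁻¹
      -- v`; the inverse character arising here cancels the one in the tensor factor.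
      have h1 : σ (φ g)⁻¹ v = ((χ g : ℂˣ) : ℂ)⁻¹ • v := by
        have h2 : (((χ g⁻¹ : ℂˣ) : ℂ)) = ((χ g : ℂˣ) : ℂ)⁻¹ := by
          rw [map_inv, Units.val_inv_eq_inv_val]
        rw [← map_inv, hv, h2]
      simp [charRep, h1, smul_smul]

theorem indLift_mk (v : B) (hv : ∀ g, σ (φ g) v = ((χ g : ℂˣ) : ℂ) • v) (h : H) (c : ℂ) :
    indLift φ χ σ v hv (Representation.IndV.mk φ (charRep χ) h c) = c • σ h⁻¹ v := by
  simp [indLift]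

theorem indLift_ind (v : B) (hv : ∀ g, σ (φ g) v = ((χ g : ℂˣ) : ℂ) • v) (h : H) :
    indLift φ χ σ v hv ∘ₗ Representation.ind φ (charRep χ) h = σ h ∘ₗ indLift φ χ σ v hv := by
  refine Representation.IndV.hom_ext _ _ fun h' => LinearMap.ext fun c => ?_
  rw [LinearMap.comp_apply, LinearMap.comp_apply, Representation.ind_mk, indLift_mk,
    LinearMap.comp_apply, LinearMap.comp_apply, indLift_mk, map_smul, mul_inv_rev, inv_inv,
    map_mul]
  rfl

/-- The defining relation of the coinvariants: generators in the same coset of the subgroup are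
proportional. -/
theorem indV_mk_mul (g : G) (h : H) :
    ((χ g : ℂˣ) : ℂ) • Representation.IndV.mk φ (charRep χ) (φ g * h) 1 =
      Representation.IndV.mk φ (charRep χ) h 1 := by
  have h1 := Representation.Coinvariants.mk_self_apply
    (Representation.tprod ((Representation.leftRegular ℂ H).comp φ) (charRep χ)) g
    ((MonoidAlgebra.single h (1 : ℂ)) ⊗ₜ[ℂ] (1 : ℂ))
  have h2 : Representation.tprod ((Representation.leftRegular ℂ H).comp φ) (charRep χ) g
      ((MonoidAlgebra.single h (1 : ℂ)) ⊗ₜ[ℂ] (1 : ℂ)) =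
      (MonoidAlgebra.single (φ g * h) (1 : ℂ)) ⊗ₜ[ℂ] (((χ g : ℂˣ) : ℂ) • (1 : ℂ)) := by
    simp [charRep]
  rw [h2] at h1
  rw [← map_smul]
  exact h1

theorem span_indV_mk :
    Submodule.span ℂ (Set.range fun h => Representation.IndV.mk φ (charRep χ) h 1) = ⊤ := by
  rw [eq_top_iff]
  rintro x -
  obtain ⟨y, rfl⟩ := Representation.Coinvariants.mk_surjective _ x
  induction y using TensorProduct.induction_on with
  | zero => rw [map_zero]; exact Submodule.zero_mem _
  | add y z hy hz => rw [map_add]; exact Submodule.add_mem _ hy hz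
  | tmul y c =>
    induction y using MonoidAlgebra.induction_linear with
    | zero => rw [TensorProduct.zero_tmul, map_zero]; exact Submodule.zero_mem _
    | add y z hy hz => rw [TensorProduct.add_tmul, map_add]; exact Submodule.add_mem _ hy hz
    | single h a =>
      have h2 : (MonoidAlgebra.single h a : MonoidAlgebra ℂ H) ⊗ₜ[ℂ] c =
          (a * c) • ((MonoidAlgebra.single h 1 : MonoidAlgebra ℂ H) ⊗ₜ[ℂ] (1 : ℂ)) := by
        rw [mul_comm, mul_smul, TensorProduct.smul_tmul', MonoidAlgebra.smul_single, smul_eq_mul,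
          mul_one, ← TensorProduct.tmul_smul, smul_eq_mul, mul_one]
      rw [h2, map_smul]
      exact Submodule.smul_mem _ _ (Submodule.subset_span ⟨h, rfl⟩)

end Induced

/-! ### Direct sums of induced characters -/

section DirectSumLemmas

variable {H B ι : Type*} [Group H] [AddCommGroup B] [Module ℂ B] [DecidableEq ι] {V : ι → Type*}
  [∀ i, AddCommGroup (V i)] [∀ i, Module ℂ (V i)]

theorem toModule_comp_directSum (ρ : ∀ i, Representation ℂ H (V i)) (σ : Representation ℂ H B)
    (f : ∀ i, V i →ₗ[ℂ] B) (hf : ∀ i h, f i ∘ₗ ρ i h = σ h ∘ₗ f i) (h : H) :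
    DirectSum.toModule ℂ ι B f ∘ₗ Representation.directSum ρ h =
      σ h ∘ₗ DirectSum.toModule ℂ ι B f := by
  refine DirectSum.linearMap_ext _ fun i => LinearMap.ext fun x => ?_
  have h1 : Representation.directSum ρ h (DirectSum.lof ℂ ι V i x) =
      DirectSum.lof ℂ ι V i (ρ i h x) := DirectSum.lmap_lof (fun i => ρ i h) i x
  rw [LinearMap.comp_apply, LinearMap.comp_apply, h1, LinearMap.comp_apply, LinearMap.comp_apply,
    DirectSum.toModule_lof, DirectSum.toModule_lof]
  exact LinearMap.congr_fun (hf i h) x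

theorem span_lof {κ : Type*} (e : ∀ i, κ → V i)
    (he : ∀ i, Submodule.span ℂ (Set.range (e i)) = ⊤) :
    Submodule.span ℂ {x | ∃ i h, x = DirectSum.lof ℂ ι V i (e i h)} = ⊤ := by
  rw [eq_top_iff]
  rintro x -
  induction x using DirectSum.induction_on with
  | zero => exact Submodule.zero_mem _
  | add x y hx hy => exact Submodule.add_mem _ hx hy
  | of i x =>
    have hx : x ∈ Submodule.span ℂ (Set.range (e i)) := by
      rw [he]
      exact Submodule.mem_top
    have h1 := Submodule.apply_mem_span_image_of_mem_span (DirectSum.lof ℂ ι V i) hx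
    refine Submodule.span_mono ?_ h1
    rintro _ ⟨_, ⟨h, rfl⟩, rfl⟩
    exact ⟨i, h, rfl⟩

variable {G : ι → Type*} [∀ i, Group (G i)] (φ : ∀ i, G i →* H) (χ : ∀ i, G i →* ℂˣ)

/-- The standard generators of a sum of induced characters. -/
def indGen (i : ι) (h : H) : ⨁ i, Representation.IndV (φ i) (charRep (χ i)) :=
  DirectSum.lof ℂ ι (fun i => Representation.IndV (φ i) (charRep (χ i))) i
    (Representation.IndV.mk (φ i) (charRep (χ i)) h 1)

theorem span_indGen : Submodule.span ℂ {x | ∃ i h, x = indGen φ χ i h} = ⊤ :=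
  span_lof (fun i h => Representation.IndV.mk (φ i) (charRep (χ i)) h 1)
    fun i => span_indV_mk (φ i) (χ i)

theorem indGen_mul (i : ι) (g : G i) (h : H) :
    ((χ i g : ℂˣ) : ℂ) • indGen φ χ i (φ i g * h) = indGen φ χ i h := by
  rw [indGen, indGen, ← map_smul, indV_mk_mul]

end DirectSumLemmas

/-! ### The map from the sum of induced characters and the dimension count -/

section Main

variable {r n k l : ℕ} [NeZero r] (ζ : ∀ m : ℕ, rootsOfUnity m ℂ)

/-- An identification of the blocks of a pair of partitions with `{1, …, n}`. -/
abbrev BlockLabelling (r n k l : ℕ) [NeZero r] : Type :=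
  Σ P : PartitionPair r n k l, Vertex r P.fst ⊕ Vertex r P.snd ≃ Fin n

/-- The twist of the isotypic component by the sign character. -/
abbrev twistedRep (r n k l : ℕ) (s : ℤ) :
    Representation ℂ (Equiv.Perm (Fin n)) (ℂ ⊗[ℂ] isotypic (repA r n k l) s) :=
  (charRep (signChar (Fin n))).tprod (isotypicRep (repA r n k l) s)

theorem twistedRep_blockVec (s : ℤ) {P : PartitionPair r n k l}
    (f : Vertex r P.fst ⊕ Vertex r P.snd ≃ Fin n) (w : Equiv.Perm (Fin n)) :
    twistedRep r n k l s w (1 ⊗ₜ blockVec ζ s f) = 1 ⊗ₜ blockVec ζ s (f.trans w) := by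
  rw [← isotypicRep_blockVec, ← TensorProduct.smul_tmul]
  simp [twistedRep, charRep]

/-- Acting by the embedded subgroup on the values of `vertexEquiv` is the same as precomposing it
with the block permutations, where `blockVec_comp` applies. -/
theorem twistedRep_embedding (s : ℤ) (P : PartitionPair r n k l)
    (g : BlockGroup r P.fst × BlockGroup r P.snd) :
    twistedRep r n k l s (P.embedding g) (1 ⊗ₜ blockVec ζ s P.vertexEquiv) =
      ((P.character ζ g : ℂˣ) : ℂ) • (1 ⊗ₜ blockVec ζ s P.vertexEquiv) := by
  rw [twistedRep_blockVec, ← TensorProduct.tmul_smul, ← blockVec_comp]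
  congr 2
  apply Equiv.ext
  intro x
  simp [PartitionPair.embedding]

open Classical in
/-- The map from the sum of induced characters. -/
def fromSum (r n k l : ℕ) [NeZero r] (ζ : ∀ m : ℕ, rootsOfUnity m ℂ) (s : ℤ) :
    (⨁ P : PartitionPair r n k l, Representation.IndV P.embedding (charRep (P.character ζ))) →ₗ[ℂ]
      ℂ ⊗[ℂ] isotypic (repA r n k l) s :=
  DirectSum.toModule ℂ _ _ fun P => indLift P.embedding (P.character ζ) (twistedRep r n k l s)
    (1 ⊗ₜ blockVec ζ s P.vertexEquiv) (twistedRep_embedding ζ s P)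

theorem fromSum_comp (s : ℤ) (w : Equiv.Perm (Fin n)) :
    fromSum r n k l ζ s ∘ₗ Representation.directSum
      (fun P : PartitionPair r n k l => P.summand ζ) w =
    twistedRep r n k l s w ∘ₗ fromSum r n k l ζ s := by
  classical
  exact toModule_comp_directSum (fun P : PartitionPair r n k l => P.summand ζ)
    (twistedRep r n k l s) _ (fun P h => indLift_ind _ _ _ _ _ h) w

open Classical in
/-- The generator of the sum of induced characters attached to a labelling of the blocks. -/
def sumGen (x : BlockLabelling r n k l) :
    ⨁ P : PartitionPair r n k l, Representation.IndV P.embedding (charRep (P.character ζ)) :=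
  indGen (fun P : PartitionPair r n k l => P.embedding) (fun P => P.character ζ) x.1
    (x.1.vertexEquiv.symm.trans x.2 : Equiv.Perm (Fin n))⁻¹

/-- The inverse in `sumGen` compensates for the inverse in `indLift_mk`, so labellings on the two
sides correspond directly. -/
theorem fromSum_sumGen (s : ℤ) (x : BlockLabelling r n k l) :
    fromSum r n k l ζ s (sumGen ζ x) = 1 ⊗ₜ blockVec ζ s x.2 := by
  classical
  rw [fromSum, sumGen, indGen, DirectSum.toModule_lof, indLift_mk, one_smul, inv_inv, twistedRep_blockVec]
  congr 2
  apply Equiv.ext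
  intro v
  simp

theorem span_sumGen : Submodule.span ℂ (Set.range (sumGen (r := r) (n := n) (k := k) (l := l) ζ)) =
    ⊤ := by
  classical
  rw [eq_top_iff, ← span_indGen (fun P : PartitionPair r n k l => P.embedding)
    (fun P => P.character ζ)]
  refine Submodule.span_mono ?_
  rintro _ ⟨P, h, rfl⟩
  refine ⟨⟨P, P.vertexEquiv.trans (h⁻¹ : Equiv.Perm (Fin n))⟩, ?_⟩
  have : (P.vertexEquiv.symm.trans (P.vertexEquiv.trans (h⁻¹ : Equiv.Perm (Fin n))) :
      Equiv.Perm (Fin n)) = h⁻¹ := by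
    apply Equiv.ext
    intro v
    simp
  rw [sumGen, this, inv_inv]

/-- The counterpart of `blockVec_comp` in the source: labellings in one orbit of the block group
give proportional generators, which bounds the dimension from above. -/
theorem sumGen_comp (P : PartitionPair r n k l) (f : Vertex r P.fst ⊕ Vertex r P.snd ≃ Fin n)
    (g : BlockGroup r P.fst × BlockGroup r P.snd) :
    sumGen ζ ⟨P, (Equiv.sumCongr (blockPerm r P.fst g.1) (blockPerm r P.snd g.2)).trans f⟩ =
      ((P.character ζ g : ℂˣ) : ℂ) • sumGen ζ ⟨P, f⟩ := by
  have h1 : P.embedding g * (P.vertexEquiv.symm.trans ((Equiv.sumCongr (blockPerm r P.fst g.1)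
      (blockPerm r P.snd g.2)).trans f) : Equiv.Perm (Fin n))⁻¹ =
      (P.vertexEquiv.symm.trans f : Equiv.Perm (Fin n))⁻¹ := by
    rw [← inv_inj, mul_inv_rev, inv_inv, inv_inv, mul_inv_eq_iff_eq_mul]
    apply Equiv.ext
    intro v
    simp [PartitionPair.embedding]
  classical
  rw [sumGen, sumGen, ← h1]
  exact (indGen_mul (fun P : PartitionPair r n k l => P.embedding) (fun P => P.character ζ) P g
    _).symm

theorem fromSum_surjective (hζ : ∀ m, 0 < m → IsPrimitiveRoot (ζ m) m) {s : ℤ}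
    (hs : IsCoprime s (r : ℤ)) : Function.Surjective (fromSum r n k l ζ s) := by
  rw [← LinearMap.range_eq_top, eq_top_iff]
  rintro x -
  have h1 : ∀ y : isotypic (repA r n k l) s, (1 : ℂ) ⊗ₜ[ℂ] y ∈
      LinearMap.range (fromSum r n k l ζ s) := by
    intro y
    have hy : y ∈ Submodule.span ℂ {x | ∃ (P : PartitionPair r n k l)
        (f : Vertex r P.fst ⊕ Vertex r P.snd ≃ Fin n), x = blockVec ζ s f} := by
      rw [span_blockVec ζ hζ hs]
      exact Submodule.mem_top
    induction hy using Submodule.span_induction with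
    | mem x hx =>
      obtain ⟨P, f, rfl⟩ := hx
      exact ⟨_, fromSum_sumGen ζ s ⟨P, f⟩⟩
    | zero => rw [TensorProduct.tmul_zero]; exact Submodule.zero_mem _
    | add x y _ _ hx hy => rw [TensorProduct.tmul_add]; exact Submodule.add_mem _ hx hy
    | smul c x _ hx => rw [TensorProduct.tmul_smul]; exact Submodule.smul_mem _ _ hx
  have h2 : x = 1 ⊗ₜ TensorProduct.lid ℂ _ x := by
    rw [← TensorProduct.lid_symm_apply, LinearEquiv.symm_apply_apply]
  rw [h2]
  exact h1 _

open Classical in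
/-- Criterion for the map from the sum of induced characters to be bijective. -/
theorem fromSum_bijective (hζ : ∀ m, 0 < m → IsPrimitiveRoot (ζ m) m) {s : ℤ}
    (hs : IsCoprime s (r : ℤ)) (code : BlockLabelling r n k l → Dec r n)
    (hplain : ∀ x, Dec.plain n (code x) = code x)
    (hdeg : ∀ x, Dec.deg n (code x) = k + l) (hcl : ∀ x, Dec.closed n (code x) = l)
    (hstab : ∀ x ξ, Dec.act ξ n le_rfl (code x) = code x → torChar s ξ = 1)
    (hcode : ∀ x y, code x = code y → sumGen ζ x ∈ Submodule.span ℂ {sumGen ζ y}) :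
    Function.Bijective (fromSum r n k l ζ s) := by
  have hsurj := fromSum_surjective (k := k) (l := l) (n := n) ζ hζ hs
  have hfin := finite_dec (r := r) n
  let D : Set.range code → Dec r n := Subtype.val
  have : Fintype (Set.range code) := Fintype.ofFinite _
  -- One labelling per code suffices to span the source. Since `Dec r n` is finite, this also yields
  -- finite dimensionality, without counting the pairs of partitions.
  choose rep hrep using fun d : Set.range code => d.2
  have hspan : Submodule.span ℂ (Set.range fun d => sumGen ζ (rep d)) = ⊤ := by
    rw [eq_top_iff, ← span_sumGen ζ]
    refine Submodule.span_le.2 ?_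
    rintro _ ⟨x, rfl⟩
    refine Submodule.span_mono ?_ (hcode x (rep ⟨code x, x, rfl⟩) (hrep ⟨code x, x, rfl⟩).symm)
    rintro _ rfl
    exact ⟨_, rfl⟩
  have hli := linearIndependent_isoMap k l s D Subtype.val_injective
    (by rintro ⟨_, x, rfl⟩; exact hplain x) (by rintro ⟨_, x, rfl⟩; exact hdeg x)
    (by rintro ⟨_, x, rfl⟩; exact hcl x) (by rintro ⟨_, x, rfl⟩; exact hstab x)
  have hfd : Module.Finite ℂ (⨁ P : PartitionPair r n k l,
      Representation.IndV P.embedding (charRep (P.character ζ))) :=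
    ⟨⟨Finset.univ.image fun d => sumGen ζ (rep d), by simpa using hspan⟩⟩
  have hfd' : Module.Finite ℂ (ℂ ⊗[ℂ] isotypic (repA r n k l) s) := Module.Finite.of_surjective _ hsurj
  have hfd'' : Module.Finite ℂ (isotypic (repA r n k l) s) :=
    Module.Finite.equiv (TensorProduct.lid ℂ _)
  have h1 : Fintype.card (Set.range code) ≤ Module.finrank ℂ (ℂ ⊗[ℂ] isotypic (repA r n k l) s) := by
    rw [(TensorProduct.lid ℂ (isotypic (repA r n k l) s)).finrank_eq]
    exact hli.fintype_card_le_finrank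
  have h2 : Module.finrank ℂ (⨁ P : PartitionPair r n k l,
      Representation.IndV P.embedding (charRep (P.character ζ))) ≤ Fintype.card (Set.range code) := by
    have := finrank_range_le_card (R := ℂ) (fun d => sumGen ζ (rep d))
    rwa [Set.finrank, hspan, finrank_top] at this
  have h3 := LinearMap.finrank_le_finrank_of_surjective hsurj
  -- The source has dimension at most the number of codes, the target at least that number, and a
  -- surjection forces equality.
  exact ⟨(LinearMap.injective_iff_surjective_of_finrank_eq_finrank
    (le_antisymm (h2.trans h1) h3)).2 hsurj, hsurj⟩

end Main

/-! ## The decreasing forest of a coloured permutation -/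

section FirstReturn

variable {m : ℕ}

/-- The first return map of a permutation of `{0, …, m}` to `{0, …, m - 1}`. -/
def firstReturn (π : Equiv.Perm (Fin (m + 1))) : Equiv.Perm (Fin m) :=
  Equiv.removeNone (finSuccEquivLast.permCongr π)

theorem castSucc_firstReturn (π : Equiv.Perm (Fin (m + 1))) (x : Fin m) :
    (firstReturn π x).castSucc =
      if π x.castSucc = Fin.last m then π (Fin.last m) else π x.castSucc := by
  have hx : finSuccEquivLast.permCongr π (some x) = finSuccEquivLast (π x.castSucc) := by
    simp [Equiv.permCongr_apply]
  have hl : finSuccEquivLast.permCongr π none = finSuccEquivLast (π (Fin.last m)) := by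
    simp [Equiv.permCongr_apply]
  have hs : (firstReturn π x).castSucc = finSuccEquivLast.symm (some (firstReturn π x)) := by simp
  rw [hs, Equiv.symm_apply_eq]
  split_ifs with h
  · rw [firstReturn, Equiv.removeNone_none, hl]
    rw [hx, h, finSuccEquivLast_last]
  · obtain ⟨y, hy⟩ := Fin.exists_castSucc_eq.2 h
    rw [firstReturn, Equiv.removeNone_some, hx]
    exact ⟨y, by rw [hx, ← hy, finSuccEquivLast_castSucc]⟩

/-- Removing the last point from its cycle forgets only where it was inserted, and its image records
that. -/
theorem eq_of_firstReturn_eq {π π' : Equiv.Perm (Fin (m + 1))}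
    (h : firstReturn π = firstReturn π') (hl : π (Fin.last m) = π' (Fin.last m)) : π = π' := by
  refine finSuccEquivLast.permCongr.injective (Equiv.Perm.decomposeOption.injective ?_)
  refine Prod.ext ?_ h
  simp [Equiv.permCongr_apply, hl]

theorem firstReturn_invariant {Y : Type*} {π : Equiv.Perm (Fin (m + 1))} {c : Fin (m + 1) → Y}
    (hc : ∀ x, c (π x) = c x) (x : Fin m) : c (firstReturn π x).castSucc = c x.castSucc := by
  rw [castSucc_firstReturn]
  split_ifs with h
  · rw [hc, ← h, hc]
  · exact hc _

theorem invariant_of_firstReturn {Y : Type*} {π : Equiv.Perm (Fin (m + 1))} {c : Fin (m + 1) → Y}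
    (hc : ∀ x : Fin m, c (firstReturn π x).castSucc = c x.castSucc)
    (hl : c (π (Fin.last m)) = c (Fin.last m)) (x : Fin (m + 1)) : c (π x) = c x := by
  induction x using Fin.lastCases with
  | last => exact hl
  | cast x =>
    have := hc x
    rw [castSucc_firstReturn] at this
    split_ifs at this with h
    · rw [h, ← hl, this]
    · exact this

/-- The first return map deletes the last point from its cycle and leaves the cycles otherwise
unchanged. -/
theorem sameCycle_firstReturn (π : Equiv.Perm (Fin (m + 1))) (x y : Fin m) :
    (firstReturn π).SameCycle x y ↔ π.SameCycle x.castSucc y.castSucc := by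
  constructor
  · intro h
    obtain ⟨k, hk, rfl⟩ := h.exists_pow_eq'
    clear h hk
    induction k with
    | zero => exact Equiv.Perm.SameCycle.refl _ _
    | succ k ih =>
      refine ih.trans ?_
      rw [pow_succ', Equiv.Perm.mul_apply]
      generalize ((firstReturn π) ^ k) x = z
      rw [castSucc_firstReturn]
      split_ifs with h
      · exact ⟨2, by rw [← h]; rfl⟩
      · exact ⟨1, rfl⟩
  · intro h
    obtain ⟨k, _, hk⟩ := h.exists_pow_eq'
    clear h
    -- One step of the first return map can use up two steps of `π`, hence the strong induction.
    induction k using Nat.strong_induction_on generalizing x with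
    | _ k ih =>
      have hstep : (firstReturn π).SameCycle x (firstReturn π x) := ⟨1, rfl⟩
      have h1 := castSucc_firstReturn π x
      rcases k with _ | k
      · rw [pow_zero, Equiv.Perm.one_apply] at hk
        rw [Fin.castSucc_injective _ hk]
      · rw [pow_succ, Equiv.Perm.mul_apply] at hk
        by_cases hx : π x.castSucc = Fin.last m
        · rw [if_pos hx] at h1
          rw [hx] at hk
          rcases k with _ | k
          · rw [pow_zero, Equiv.Perm.one_apply] at hk
            exact absurd hk.symm (Fin.castSucc_ne_last y)
          · rw [pow_succ, Equiv.Perm.mul_apply, ← h1] at hk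
            exact hstep.trans (ih k (by omega) _ (by omega) hk)
        · rw [if_neg hx] at h1
          rw [← h1] at hk
          exact hstep.trans (ih k (by omega) _ (by omega) hk)

end FirstReturn

/-! ### Forests encoding permutations with coloured cycles -/

section Code

variable {r n : ℕ}

/-- The slot of the last point for a coloured permutation. -/
def slotCode {m : ℕ} (c : Bool) : Option (Fin m) → Slot r m
  | none => if c then some none else none
  | some j => some (some (j, 1))

/-- The decreasing forest of a permutation and a colouring of its cycles: the edge at a point goes
to the next smaller point on its cycle that is met first. -/
def Dec.code (r : ℕ) : ∀ m : ℕ, Equiv.Perm (Fin m) → (Fin m → Bool) → Dec r m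
  | 0, _, _ => ()
  | m + 1, π, c => ((Dec.code r m (firstReturn π) (c ∘ Fin.castSucc),
      slotCode (c (Fin.last m)) (finSuccEquivLast (π (Fin.last m)))) : Dec r m × Slot r m)

theorem Dec.plain_code (m : ℕ) (π : Equiv.Perm (Fin m)) (c : Fin m → Bool) :
    Dec.plain m (Dec.code r m π c) = Dec.code r m π c := by
  induction m with
  | zero => rfl
  | succ m ih =>
    refine Prod.ext (ih _ _) ?_
    change slotPlain (slotCode (c (Fin.last m)) (finSuccEquivLast (π (Fin.last m)))) =
      slotCode (c (Fin.last m)) (finSuccEquivLast (π (Fin.last m)))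
    cases finSuccEquivLast (π (Fin.last m)) with
    | none => cases c (Fin.last m) <;> rfl
    | some j => rfl

/-- The forest without its last vertex determines the first return map, and the slot of the last
vertex determines its image under the permutation. -/
theorem Dec.code_injective (m : ℕ) {π π' : Equiv.Perm (Fin m)} {c c' : Fin m → Bool}
    (hc : ∀ x, c (π x) = c x) (hc' : ∀ x, c' (π' x) = c' x)
    (h : Dec.code r m π c = Dec.code r m π' c') : π = π' ∧ c = c' := by
  induction m with
  | zero => exact ⟨Subsingleton.elim _ _, Subsingleton.elim _ _⟩
  | succ m ih =>
    have h1 : Dec.code r m (firstReturn π) (c ∘ Fin.castSucc) =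
      Dec.code r m (firstReturn π') (c' ∘ Fin.castSucc) := congrArg Prod.fst h
    have h2 : slotCode (r := r) (c (Fin.last m)) (finSuccEquivLast (π (Fin.last m))) =
      slotCode (c' (Fin.last m)) (finSuccEquivLast (π' (Fin.last m))) := congrArg Prod.snd h
    obtain ⟨h3, h4⟩ := ih (firstReturn_invariant hc) (firstReturn_invariant hc') h1
    have h5 : finSuccEquivLast (π (Fin.last m)) = finSuccEquivLast (π' (Fin.last m)) ∧
        c (Fin.last m) = c' (Fin.last m) := by
      cases e : finSuccEquivLast (π (Fin.last m)) with
      | none =>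
        cases e' : finSuccEquivLast (π' (Fin.last m)) with
        | none =>
          rw [e, e'] at h2
          refine ⟨rfl, ?_⟩
          cases hl : c (Fin.last m) <;> cases hl' : c' (Fin.last m) <;>
            simp_all [slotCode]
        | some j =>
          rw [e, e'] at h2
          cases hl : c (Fin.last m) <;> simp [slotCode, hl] at h2
      | some j =>
        cases e' : finSuccEquivLast (π' (Fin.last m)) with
        | none =>
          rw [e, e'] at h2
          cases hl : c' (Fin.last m) <;> simp [slotCode, hl] at h2
        | some j' =>
          rw [e, e'] at h2
          simp only [slotCode, Option.some.injEq, Prod.mk.injEq, and_true] at h2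
          subst h2
          refine ⟨rfl, ?_⟩
          have e1 : π (Fin.last m) = j.castSucc := by
            rw [← Equiv.eq_symm_apply] at e
            simpa using e
          have e2 : π' (Fin.last m) = j.castSucc := by
            rw [← Equiv.eq_symm_apply] at e'
            simpa using e'
          -- An edge slot does not record the colour; it is recovered from the target, which lies on
          -- the same cycle.
          rw [← hc, ← hc' (Fin.last m), e1, e2]
          exact congrFun h4 j
    refine ⟨eq_of_firstReturn_eq h3 (finSuccEquivLast.injective h5.1), funext fun x => ?_⟩
    induction x using Fin.lastCases with
    | last => exact h5.2
    | cast x => exact congrFun h4 x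

/-- A torus element fixing a forest takes equal values at the ends of each edge, and the trees of
the code are the cycles of the permutation. -/
theorem Dec.invariant_of_act_code (ξ : Fin n → rootsOfUnity r ℂ) (m : ℕ) (h : m ≤ n)
    (π : Equiv.Perm (Fin m)) (c : Fin m → Bool)
    (hact : Dec.act ξ m h (Dec.code r m π c) = Dec.code r m π c) (x : Fin m) :
    ξ (Fin.castLE h (π x)) = ξ (Fin.castLE h x) := by
  induction m with
  | zero => exact x.elim0
  | succ m ih =>
    have h1 : Dec.act ξ m (Nat.le_of_succ_le h) (Dec.code r m (firstReturn π) (c ∘ Fin.castSucc)) =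
      Dec.code r m (firstReturn π) (c ∘ Fin.castSucc) := congrArg Prod.fst hact
    have h2 : slotAct ξ m h (slotCode (c (Fin.last m)) (finSuccEquivLast (π (Fin.last m)))) =
      slotCode (c (Fin.last m)) (finSuccEquivLast (π (Fin.last m))) := congrArg Prod.snd hact
    refine invariant_of_firstReturn (c := fun x => ξ (Fin.castLE h x)) (π := π)
      (fun x => ih _ _ _ h1 x) ?_ x
    cases e : finSuccEquivLast (π (Fin.last m)) with
    | none =>
      rw [← Equiv.eq_symm_apply] at e
      have e1 : π (Fin.last m) = Fin.last m := by simpa using e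
      simp only [e1]
    | some j =>
      rw [e] at h2
      rw [← Equiv.eq_symm_apply] at e
      have e1 : π (Fin.last m) = j.castSucc := by simpa using e
      simp only [slotCode, slotAct, Option.some.injEq, Prod.mk.injEq, true_and, one_mul,
        mul_inv_eq_one] at h2
      simp only [e1]
      exact h2.symm

/-- `v` is the smallest point of its cycle. -/
def IsCycleMin {m : ℕ} (π : Equiv.Perm (Fin m)) (v : Fin m) : Prop := ∀ y, π.SameCycle v y → v ≤ y

theorem isCycleMin_firstReturn {m : ℕ} (π : Equiv.Perm (Fin (m + 1))) (v : Fin m) :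
    IsCycleMin (firstReturn π) v ↔ IsCycleMin π v.castSucc := by
  constructor
  · intro h y
    induction y using Fin.lastCases with
    | last => exact fun _ => (Fin.castSucc_lt_last v).le
    | cast y => exact fun hy => Fin.castSucc_le_castSucc_iff.2 (h y ((sameCycle_firstReturn π v y).2 hy))
  · exact fun h y hy => Fin.castSucc_le_castSucc_iff.1 (h _ ((sameCycle_firstReturn π v y).1 hy))

theorem isCycleMin_last {m : ℕ} (π : Equiv.Perm (Fin (m + 1))) :
    IsCycleMin π (Fin.last m) ↔ π (Fin.last m) = Fin.last m := by
  constructor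
  · intro h
    exact le_antisymm (Fin.le_last _) (h _ ⟨1, rfl⟩)
  · intro h y hy
    rw [hy.eq_of_left h]

-- The roots of the code are the smallest points of the cycles: a point becomes a root when it is
-- fixed after all larger points have been removed.
open Classical in
theorem Dec.closed_code (m : ℕ) (π : Equiv.Perm (Fin m)) (c : Fin m → Bool) :
    Dec.closed m (Dec.code r m π c) =
      ∑ v : Fin m, if c v = true ∧ IsCycleMin π v then 1 else 0 := by
  induction m with
  | zero => rfl
  | succ m ih =>
    change Dec.closed m (Dec.code r m (firstReturn π) (c ∘ Fin.castSucc)) +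
      slotClosed (slotCode (c (Fin.last m)) (finSuccEquivLast (π (Fin.last m)))) = _
    rw [ih, Fin.sum_univ_castSucc]
    congr 1
    · simp only [isCycleMin_firstReturn, Function.comp_apply]
    · rw [isCycleMin_last]
      cases e : finSuccEquivLast (π (Fin.last m)) with
      | none =>
        rw [← Equiv.eq_symm_apply] at e
        have e1 : π (Fin.last m) = Fin.last m := by simpa using e
        cases hl : c (Fin.last m) <;> simp [slotCode, slotClosed, slotWeight, e1]
      | some j =>
        rw [← Equiv.eq_symm_apply] at e
        have e1 : π (Fin.last m) = j.castSucc := by simpa using e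
        simp [slotCode, slotClosed, slotWeight, e1, Fin.castSucc_ne_last]

open Classical in
theorem Dec.deg_code (m : ℕ) (π : Equiv.Perm (Fin m)) (c : Fin m → Bool) :
    Dec.deg m (Dec.code r m π c) +
      (∑ v : Fin m, if c v = false ∧ IsCycleMin π v then 1 else 0) = m := by
  induction m with
  | zero => rfl
  | succ m ih =>
    have h1 := ih (firstReturn π) (c ∘ Fin.castSucc)
    change Dec.deg m (Dec.code r m (firstReturn π) (c ∘ Fin.castSucc)) +
      slotDeg (slotCode (c (Fin.last m)) (finSuccEquivLast (π (Fin.last m)))) + _ = _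
    rw [Fin.sum_univ_castSucc]
    simp only [isCycleMin_firstReturn, Function.comp_apply] at h1
    have h2 : slotDeg (slotCode (r := r) (c (Fin.last m)) (finSuccEquivLast (π (Fin.last m)))) +
        (if c (Fin.last m) = false ∧ IsCycleMin π (Fin.last m) then 1 else 0) = 1 := by
      rw [isCycleMin_last]
      cases e : finSuccEquivLast (π (Fin.last m)) with
      | none =>
        rw [← Equiv.eq_symm_apply] at e
        have e1 : π (Fin.last m) = Fin.last m := by simpa using e
        cases hl : c (Fin.last m) <;> simp [slotCode, slotDeg, e1]
      | some j =>
        rw [← Equiv.eq_symm_apply] at e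
        have e1 : π (Fin.last m) = j.castSucc := by simpa using e
        simp [slotCode, slotDeg, e1, Fin.castSucc_ne_last]
    omega

end Code

/-! ## The rotation of the blocks -/

section Rotation

variable {r a a' : ℕ} {lam : Nat.Partition a} {lam' : Nat.Partition a'}

/-- The simultaneous rotation of all blocks by one step. -/
def blockRot (r : ℕ) {a : ℕ} (lam : Nat.Partition a) : Equiv.Perm (Vertex r lam) :=
  blockPerm r lam (SemidirectProduct.inl fun _ _ => Multiplicative.ofAdd 1)

theorem blockRot_apply (i : Fin a) (b : Fin (mult lam i)) (x : ZMod (r * (i.1 + 1))) :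
    blockRot r lam ⟨i, b, x⟩ = ⟨i, b, 1 + x⟩ := rfl

theorem blockRot_pow_apply (k : ℕ) (i : Fin a) (b : Fin (mult lam i))
    (x : ZMod (r * (i.1 + 1))) : (blockRot r lam ^ k) ⟨i, b, x⟩ = ⟨i, b, k + x⟩ := by
  induction k with
  | zero => simp
  | succ k ih =>
    rw [pow_succ', Equiv.Perm.mul_apply, ih, blockRot_apply, ← add_assoc, Nat.cast_succ]
    rw [add_comm (1 : ZMod (r * (i.1 + 1)))]

/-- The period of a point under the rotation recovers the size of its block. -/
theorem blockRot_pow_eq_self_iff (k : ℕ) (v : Vertex r lam) :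
    (blockRot r lam ^ k) v = v ↔ r * (v.1.1 + 1) ∣ k := by
  obtain ⟨i, b, x⟩ := v
  rw [blockRot_pow_apply, ← ZMod.natCast_eq_zero_iff]
  simp

theorem pow_apply_of_comm {e : Vertex r lam ≃ Vertex r lam'}
    (he : ∀ v, e (blockRot r lam v) = blockRot r lam' (e v)) (k : ℕ) (v : Vertex r lam) :
    e ((blockRot r lam ^ k) v) = (blockRot r lam' ^ k) (e v) := by
  induction k with
  | zero => rfl
  | succ k ih => rw [pow_succ', pow_succ', Equiv.Perm.mul_apply, Equiv.Perm.mul_apply, he, ih]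

variable [NeZero r]

theorem fst_eq_of_comm {e : Vertex r lam ≃ Vertex r lam'}
    (he : ∀ v, e (blockRot r lam v) = blockRot r lam' (e v)) (v : Vertex r lam) :
    (e v).1.1 = v.1.1 := by
  have h1 : ∀ k, r * ((e v).1.1 + 1) ∣ k ↔ r * (v.1.1 + 1) ∣ k := by
    intro k
    rw [← blockRot_pow_eq_self_iff, ← blockRot_pow_eq_self_iff, ← pow_apply_of_comm he,
      e.apply_eq_iff_eq]
  have h2 := Nat.dvd_antisymm ((h1 _).2 dvd_rfl) ((h1 _).1 dvd_rfl)
  have := Nat.eq_of_mul_eq_mul_left (NeZero.pos r) h2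
  omega

theorem card_vertex_fiber (j : ℕ) : Fintype.card {v : Vertex r lam // v.1.1 = j} =
    lam.parts.count (j + 1) * (r * (j + 1)) := by
  rw [Fintype.card_subtype, Finset.card_filter, Fintype.sum_sigma]
  have h1 : ∀ i : Fin a, (∑ p : Fin (mult lam i) × ZMod (r * (i.1 + 1)),
      if (⟨i, p⟩ : Vertex r lam).1.1 = j then 1 else 0) =
      if i.1 = j then lam.parts.count (j + 1) * (r * (j + 1)) else 0 := by
    intro i
    by_cases h : i.1 = j
    · subst h
      simp only [if_true, Finset.sum_const, smul_eq_mul, mul_one]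
      rw [Finset.card_univ, Fintype.card_prod, ZMod.card, Fintype.card_fin]
      rfl
    · simp [h]
  rw [Finset.sum_congr rfl fun i _ => h1 i]
  by_cases hj : j < a
  · rw [Finset.sum_eq_single ⟨j, hj⟩]
    · simp
    · intro i _ hi
      rw [if_neg]
      rintro rfl
      exact hi rfl
    · simp
  · have h0 : lam.parts.count (j + 1) = 0 := by
      refine Multiset.count_eq_zero.2 fun h => ?_
      have := Multiset.le_sum_of_mem h
      rw [lam.parts_sum] at this
      omega
    simp [h0]

/-- A bijection commuting with the rotations preserves periods, so for each size both sides have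
equally many points in blocks of that size. -/
theorem parts_eq_of_comm {e : Vertex r lam ≃ Vertex r lam'}
    (he : ∀ v, e (blockRot r lam v) = blockRot r lam' (e v)) : lam.parts = lam'.parts := by
  ext j
  rcases j with _ | j
  · rw [Multiset.count_eq_zero.2 fun h => lt_irrefl _ (lam.parts_pos h),
      Multiset.count_eq_zero.2 fun h => lt_irrefl _ (lam'.parts_pos h)]
  · have h1 : Fintype.card {v : Vertex r lam // v.1.1 = j} =
        Fintype.card {v : Vertex r lam' // v.1.1 = j} :=
      Fintype.card_congr (e.subtypeEquiv fun v => by rw [fst_eq_of_comm he])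
    rw [card_vertex_fiber, card_vertex_fiber] at h1
    exact Nat.eq_of_mul_eq_mul_right (Nat.mul_pos (NeZero.pos r) (Nat.succ_pos j)) h1

/-- The centraliser of the rotation is the block group: a commuting permutation is determined by the
images of the base points `0` of the blocks, and these stay in blocks of the same size. -/
theorem exists_blockPerm_of_comm (e : Equiv.Perm (Vertex r lam))
    (he : ∀ v, e (blockRot r lam v) = blockRot r lam (e v)) : ∃ g, blockPerm r lam g = e := by
  have h1 : ∀ (i : Fin a) (b : Fin (mult lam i)), ∃ p : Fin (mult lam i) × ZMod (r * (i.1 + 1)),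
      e ⟨i, b, 0⟩ = ⟨i, p⟩ := by
    intro i b
    have h2 := fst_eq_of_comm he ⟨i, b, 0⟩
    generalize e ⟨i, b, 0⟩ = w at h2
    obtain ⟨i', p⟩ := w
    obtain rfl : i' = i := Fin.ext h2
    exact ⟨p, rfl⟩
  choose p hp using h1
  have h2 : ∀ (i : Fin a) (b : Fin (mult lam i)) (x : ZMod (r * (i.1 + 1))),
      e ⟨i, b, x⟩ = ⟨i, (p i b).1, x + (p i b).2⟩ := by
    intro i b x
    have h3 := pow_apply_of_comm he x.val ⟨i, b, 0⟩
    rw [hp, blockRot_pow_apply, add_zero, ZMod.natCast_zmod_val] at h3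
    rw [h3]
    have := blockRot_pow_apply (r := r) x.val i (p i b).1 (p i b).2
    rwa [ZMod.natCast_zmod_val] at this
  have hinj : ∀ i, Function.Injective fun b => (p i b).1 := by
    intro i b b' h
    have h3 : e ⟨i, b, 0⟩ = e ⟨i, b', (p i b).2 - (p i b').2⟩ := by
      rw [h2, h2, sub_add_cancel, zero_add]
      exact congrArg (fun y => (⟨i, y, (p i b).2⟩ : Vertex r lam)) h
    have h4 := e.injective h3
    simp only [Sigma.mk.injEq, heq_eq_eq, Prod.mk.injEq, true_and] at h4
    exact h4.1
  let σ : Perms lam := fun i => Equiv.ofBijective _ (Finite.injective_iff_bijective.1 (hinj i))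
  -- The cyclic component is indexed by the target block, whence the preimage under `σ i`.
  refine ⟨⟨fun i b => Multiplicative.ofAdd (p i ((σ i)⁻¹ b)).2, σ⟩, ?_⟩
  apply Equiv.ext
  rintro ⟨i, b, x⟩
  have h3 : blockPerm r lam ⟨fun i b => Multiplicative.ofAdd (p i ((σ i)⁻¹ b)).2, σ⟩ ⟨i, b, x⟩ =
      ⟨i, σ i b, (p i ((σ i)⁻¹ (σ i b))).2 + x⟩ := rfl
  have h4 : (σ i)⁻¹ (σ i b) = b := (σ i).symm_apply_apply b
  rw [h3, h2, h4, add_comm x]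
  rfl

/-- On each block the function is constant, and the block size is a multiple of `r`. -/
theorem prod_eq_one_of_invariant {M : Type*} [CommMonoid M] (g : Vertex r lam → M)
    (hg : ∀ v, g (blockRot r lam v) = g v) (hr : ∀ v, g v ^ r = 1) : ∏ v, g v = 1 := by
  rw [Fintype.prod_sigma]
  refine Finset.prod_eq_one fun i _ => ?_
  rw [Fintype.prod_prod_type]
  refine Finset.prod_eq_one fun b _ => ?_
  have h1 : ∀ x : ZMod (r * (i.1 + 1)), g ⟨i, b, x⟩ = g ⟨i, b, 0⟩ := by
    intro x
    have h2 : ∀ k : ℕ, g ((blockRot r lam ^ k) ⟨i, b, 0⟩) = g ⟨i, b, 0⟩ := by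
      intro k
      induction k with
      | zero => rfl
      | succ k ih => rw [pow_succ', Equiv.Perm.mul_apply, hg, ih]
    have h3 := h2 x.val
    rwa [blockRot_pow_apply, add_zero, ZMod.natCast_zmod_val] at h3
  rw [Finset.prod_congr rfl fun x _ => h1 x, Finset.prod_const, Finset.card_univ, ZMod.card,
    pow_mul, hr, one_pow]

end Rotation

/-! ## The decreasing forest of a labelling -/

section LabelCode

/-- Each cycle has exactly one smallest point, so counting cycle minima counts the blocks. -/
theorem sum_isCycleMin {m : ℕ} {B : Type*} [Fintype B] (π : Equiv.Perm (Fin m)) (κ : Fin m → B)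
    (hsurj : Function.Surjective κ) (hκ : ∀ x y, π.SameCycle x y ↔ κ x = κ y) (q : B → Prop)
    [DecidablePred q] [∀ v, Decidable (q (κ v) ∧ IsCycleMin π v)] :
    (∑ v : Fin m, if q (κ v) ∧ IsCycleMin π v then 1 else 0) = ∑ b, if q b then 1 else 0 := by
  classical
  rw [← Finset.card_filter, ← Finset.card_filter]
  refine Finset.card_bij (fun v _ => κ v) ?_ ?_ ?_
  · intro v hv
    rw [Finset.mem_filter] at hv ⊢
    exact ⟨Finset.mem_univ _, hv.2.1⟩
  · intro v hv w hw h
    rw [Finset.mem_filter] at hv hw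
    exact le_antisymm (hv.2.2 w ((hκ v w).2 h)) (hw.2.2 v ((hκ w v).2 h.symm))
  · intro b hb
    rw [Finset.mem_filter] at hb
    obtain ⟨v₀, hv₀⟩ := hsurj b
    obtain ⟨v, hv, hmin⟩ := Finset.exists_min_image (Finset.univ.filter fun v => κ v = b) id
      ⟨v₀, by simp [hv₀]⟩
    rw [Finset.mem_filter] at hv
    refine ⟨v, ?_, hv.2⟩
    rw [Finset.mem_filter, hv.2]
    refine ⟨Finset.mem_univ _, hb.2, fun y hy => hmin y ?_⟩
    rw [Finset.mem_filter, ← (hκ v y).1 hy]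
    exact ⟨Finset.mem_univ _, hv.2⟩

theorem eq_of_sameCycle {X Y : Type*} [Finite X] {π : Equiv.Perm X} {c : X → Y}
    (hc : ∀ x, c (π x) = c x) {x y : X} (h : π.SameCycle x y) : c x = c y := by
  classical
  have := Fintype.ofFinite X
  obtain ⟨k, hk, rfl⟩ := h.exists_pow_eq'
  clear hk h
  induction k with
  | zero => rfl
  | succ k ih => rw [pow_succ', Equiv.Perm.mul_apply, hc, ih]

variable {r n k l : ℕ} [NeZero r]

/-- The permutation of `{1, …, n}` which rotates all blocks of a labelling. -/
def labelPerm (x : BlockLabelling r n k l) : Equiv.Perm (Fin n) :=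
  x.2.permCongr (Equiv.sumCongr (blockRot r x.1.fst) (blockRot r x.1.snd))

/-- The colouring of `{1, …, n}` by the two partitions. -/
def labelColour (x : BlockLabelling r n k l) (v : Fin n) : Bool := (x.2.symm v).isRight

theorem labelPerm_apply (x : BlockLabelling r n k l)
    (u : Vertex r x.1.fst ⊕ Vertex r x.1.snd) : labelPerm x (x.2 u) =
      x.2 (Equiv.sumCongr (blockRot r x.1.fst) (blockRot r x.1.snd) u) := by
  simp [labelPerm, Equiv.permCongr_apply]

theorem labelColour_labelPerm (x : BlockLabelling r n k l) (v : Fin n) :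
    labelColour x (labelPerm x v) = labelColour x v := by
  obtain ⟨u, rfl⟩ := x.2.surjective v
  rw [labelPerm_apply, labelColour, labelColour, Equiv.symm_apply_apply, Equiv.symm_apply_apply]
  cases u <;> rfl

/-- The block of a point. -/
def labelBlock (x : BlockLabelling r n k l) (v : Fin n) :
    (Σ i : Fin x.1.size₁, Fin (mult x.1.fst i)) ⊕ (Σ i : Fin x.1.size₂, Fin (mult x.1.snd i)) :=
  Sum.map (fun u => ⟨u.1, u.2.1⟩) (fun u => ⟨u.1, u.2.1⟩) (x.2.symm v)

theorem labelBlock_surjective (x : BlockLabelling r n k l) :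
    Function.Surjective (labelBlock x) := by
  rintro (⟨i, b⟩ | ⟨i, b⟩)
  · exact ⟨x.2 (Sum.inl ⟨i, b, 0⟩), by simp [labelBlock]⟩
  · exact ⟨x.2 (Sum.inr ⟨i, b, 0⟩), by simp [labelBlock]⟩

theorem sameCycle_blockRot {a : ℕ} {lam : Nat.Partition a} (i : Fin a) (b : Fin (mult lam i))
    (t t' : ZMod (r * (i.1 + 1))) :
    ∃ k : ℕ, (blockRot r lam ^ k) ⟨i, b, t⟩ = ⟨i, b, t'⟩ := by
  refine ⟨(t' - t).val, ?_⟩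
  rw [blockRot_pow_apply, ZMod.natCast_zmod_val, sub_add_cancel]

theorem sameCycle_labelPerm (x : BlockLabelling r n k l) (v w : Fin n) :
    (labelPerm x).SameCycle v w ↔ labelBlock x v = labelBlock x w := by
  constructor
  · refine eq_of_sameCycle fun v => ?_
    obtain ⟨u, rfl⟩ := x.2.surjective v
    rw [labelPerm_apply, labelBlock, labelBlock, Equiv.symm_apply_apply, Equiv.symm_apply_apply]
    cases u <;> rfl
  · obtain ⟨u, rfl⟩ := x.2.surjective v
    obtain ⟨u', rfl⟩ := x.2.surjective w
    have hpow : ∀ (j : ℕ) u, (labelPerm x ^ j) (x.2 u) =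
        x.2 (Sum.map (blockRot r x.1.fst ^ j) (blockRot r x.1.snd ^ j) u) := by
      intro j u
      induction j with
      | zero => cases u <;> rfl
      | succ j ih =>
        rw [pow_succ', Equiv.Perm.mul_apply, ih, labelPerm_apply]
        cases u <;> simp [pow_succ']
    rw [labelBlock, labelBlock, Equiv.symm_apply_apply, Equiv.symm_apply_apply]
    intro h
    rcases u with ⟨i, b, t⟩ | ⟨i, b, t⟩ <;> rcases u' with ⟨i', b', t'⟩ | ⟨i', b', t'⟩
    · simp only [Sum.map_inl, Sum.inl.injEq, Sigma.mk.injEq] at h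
      obtain ⟨rfl, h⟩ := h
      obtain rfl := eq_of_heq h
      obtain ⟨j, hj⟩ := sameCycle_blockRot (r := r) i b t t'
      refine ⟨j, ?_⟩
      rw [zpow_natCast, hpow, Sum.map_inl, hj]
    · simp at h
    · simp at h
    · simp only [Sum.map_inr, Sum.inr.injEq, Sigma.mk.injEq] at h
      obtain ⟨rfl, h⟩ := h
      obtain rfl := eq_of_heq h
      obtain ⟨j, hj⟩ := sameCycle_blockRot (r := r) i b t t'
      refine ⟨j, ?_⟩
      rw [zpow_natCast, hpow, Sum.map_inr, hj]

theorem labelColour_eq (x : BlockLabelling r n k l) (v : Fin n) :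
    labelColour x v = (labelBlock x v).isRight := by
  rw [labelColour, labelBlock, Sum.isRight_map]

/-- The decreasing forest of a labelling. -/
def labelCode (x : BlockLabelling r n k l) : Dec r n :=
  Dec.code r n (labelPerm x) (labelColour x)

theorem closed_labelCode (x : BlockLabelling r n k l) : Dec.closed n (labelCode x) = l := by
  classical
  rw [labelCode, Dec.closed_code]
  simp only [labelColour_eq]
  rw [sum_isCycleMin (labelPerm x) (labelBlock x) (labelBlock_surjective x)
    (sameCycle_labelPerm x) (fun b => b.isRight = true), Fintype.sum_sum_type]
  simp only [Sum.isRight_inl, Sum.isRight_inr, Bool.false_eq_true, if_false, if_true,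
    Finset.sum_const_zero, zero_add, Finset.sum_const, Finset.card_univ, Fintype.card_sigma,
    Fintype.card_fin, sum_mult, smul_eq_mul, mul_one, x.1.length_snd]

theorem deg_labelCode (x : BlockLabelling r n k l) : Dec.deg n (labelCode x) = k + l := by
  classical
  have h1 := Dec.deg_code (r := r) n (labelPerm x) (labelColour x)
  simp only [labelColour_eq] at h1
  rw [sum_isCycleMin (labelPerm x) (labelBlock x) (labelBlock_surjective x)
    (sameCycle_labelPerm x) (fun b => b.isRight = false), Fintype.sum_sum_type] at h1
  simp only [Sum.isRight_inl, Sum.isRight_inr, Bool.true_eq_false, if_false, if_true,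
    Finset.sum_const_zero, add_zero, Finset.sum_const, Finset.card_univ, Fintype.card_sigma,
    Fintype.card_fin, sum_mult, smul_eq_mul, mul_one] at h1
  have h2 := x.1.length_fst
  rw [labelCode]
  omega

/-- A stabilising torus element is constant on the blocks, and their sizes are multiples of `r`; so
the product of its `s`-th powers is `1`. -/
theorem torChar_of_act_labelCode (s : ℤ) (x : BlockLabelling r n k l)
    (ξ : Fin n → rootsOfUnity r ℂ)
    (h : Dec.act ξ n le_rfl (labelCode x) = labelCode x) : torChar s ξ = 1 := by
  have h1 : ∀ v, ξ (labelPerm x v) = ξ v := Dec.invariant_of_act_code ξ n le_rfl _ _ h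
  change ∏ v : Fin n, (ξ v : ℂˣ) ^ s = 1
  rw [← Equiv.prod_comp x.2, Fintype.prod_sum_type]
  have h2 : ∀ v, ((ξ v : ℂˣ) ^ s) ^ r = 1 := by
    intro v
    have h3 : (ξ v : ℂˣ) ^ r = 1 := (ξ v).2
    rw [← zpow_natCast, ← zpow_mul, mul_comm, zpow_mul, zpow_natCast, h3, one_zpow]
  rw [prod_eq_one_of_invariant, prod_eq_one_of_invariant, one_mul]
  · intro v
    have h3 := h1 (x.2 (Sum.inr v))
    rw [labelPerm_apply] at h3
    exact congrArg (fun γ : rootsOfUnity r ℂ => (γ : ℂˣ) ^ s) h3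
  · exact fun v => h2 _
  · intro v
    have h3 := h1 (x.2 (Sum.inl v))
    rw [labelPerm_apply] at h3
    exact congrArg (fun γ : rootsOfUnity r ℂ => (γ : ℂˣ) ^ s) h3
  · exact fun v => h2 _

theorem exists_sumCongr {X₁ X₂ Y₁ Y₂ : Type*} (e : X₁ ⊕ X₂ ≃ Y₁ ⊕ Y₂)
    (he : ∀ x, (e x).isRight = x.isRight) :
    ∃ (e₁ : X₁ ≃ Y₁) (e₂ : X₂ ≃ Y₂), e = Equiv.sumCongr e₁ e₂ := by
  have h1 : ∀ x, ∃ y, e (Sum.inl x) = Sum.inl y := by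
    intro x
    have := he (Sum.inl x)
    cases h : e (Sum.inl x) with
    | inl y => exact ⟨y, rfl⟩
    | inr y => rw [h] at this; simp at this
  have h2 : ∀ x, ∃ y, e (Sum.inr x) = Sum.inr y := by
    intro x
    have := he (Sum.inr x)
    cases h : e (Sum.inr x) with
    | inl y => rw [h] at this; simp at this
    | inr y => exact ⟨y, rfl⟩
  choose f₁ hf₁ using h1
  choose f₂ hf₂ using h2
  have hb₁ : Function.Bijective f₁ := by
    refine ⟨fun x x' h => ?_, fun y => ?_⟩
    · have : e (Sum.inl x) = e (Sum.inl x') := by rw [hf₁, hf₁, h]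
      exact Sum.inl_injective (e.injective this)
    · obtain ⟨x | x, hx⟩ := e.surjective (Sum.inl y)
      · exact ⟨x, Sum.inl_injective ((hf₁ x).symm.trans hx)⟩
      · exact absurd ((hf₂ x).symm.trans hx) Sum.inr_ne_inl
  have hb₂ : Function.Bijective f₂ := by
    refine ⟨fun x x' h => ?_, fun y => ?_⟩
    · have : e (Sum.inr x) = e (Sum.inr x') := by rw [hf₂, hf₂, h]
      exact Sum.inr_injective (e.injective this)
    · obtain ⟨x | x, hx⟩ := e.surjective (Sum.inr y)
      · exact absurd ((hf₁ x).symm.trans hx) Sum.inl_ne_inr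
      · exact ⟨x, Sum.inr_injective ((hf₂ x).symm.trans hx)⟩
  refine ⟨Equiv.ofBijective f₁ hb₁, Equiv.ofBijective f₂ hb₂, Equiv.ext ?_⟩
  rintro (x | x)
  · exact hf₁ x
  · exact hf₂ x

omit [NeZero r] in
theorem PartitionPair.eq_of_parts {P P' : PartitionPair r n k l}
    (h₁ : P.fst.parts = P'.fst.parts) (h₂ : P.snd.parts = P'.snd.parts) : P = P' := by
  obtain ⟨a, b, p, q, _, _, _⟩ := P
  obtain ⟨a', b', p', q', _, _, _⟩ := P'
  change p.parts = p'.parts at h₁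
  change q.parts = q'.parts at h₂
  obtain rfl : a = a' := by rw [← p.parts_sum, h₁, p'.parts_sum]
  obtain rfl : b = b' := by rw [← q.parts_sum, h₂, q'.parts_sum]
  obtain rfl := Nat.Partition.ext h₁
  obtain rfl := Nat.Partition.ext h₂
  rfl

/-- Equal codes mean equal rotations and colourings of the letters. The bijection comparing the
labellings then respects the two colours and commutes with the rotations, which forces equal
partitions and places it in the block group. -/
theorem sumGen_mem_span_of_labelCode_eq (ζ : ∀ m : ℕ, rootsOfUnity m ℂ)
    (x y : BlockLabelling r n k l) (h : labelCode x = labelCode y) :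
    sumGen ζ x ∈ Submodule.span ℂ {sumGen ζ y} := by
  obtain ⟨hπ, hc⟩ := Dec.code_injective n (labelColour_labelPerm x) (labelColour_labelPerm y) h
  obtain ⟨P, f⟩ := x
  obtain ⟨P', f'⟩ := y
  have hside : ∀ u, ((f.trans f'.symm) u).isRight = u.isRight := by
    intro u
    have := congrFun hc (f u)
    simp only [labelColour, Equiv.symm_apply_apply] at this
    exact this.symm
  obtain ⟨e₁, e₂, he⟩ := exists_sumCongr (f.trans f'.symm) hside
  have hf : f = (Equiv.sumCongr e₁ e₂).trans f' := by
    rw [← he]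
    apply Equiv.ext
    intro v
    simp
  have hcomm : ∀ u, Equiv.sumCongr e₁ e₂ (Equiv.sumCongr (blockRot r P.fst) (blockRot r P.snd) u) =
      Equiv.sumCongr (blockRot r P'.fst) (blockRot r P'.snd) (Equiv.sumCongr e₁ e₂ u) := by
    intro u
    have h1 := labelPerm_apply ⟨P, f⟩ u
    have h2 := labelPerm_apply ⟨P', f'⟩ (Equiv.sumCongr e₁ e₂ u)
    rw [hπ] at h1
    simp only [hf, Equiv.trans_apply] at h1 h2
    exact f'.injective (h1.symm.trans h2)
  have h₁ : ∀ v, e₁ (blockRot r P.fst v) = blockRot r P'.fst (e₁ v) := fun v =>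
    Sum.inl_injective (hcomm (Sum.inl v))
  have h₂ : ∀ v, e₂ (blockRot r P.snd v) = blockRot r P'.snd (e₂ v) := fun v =>
    Sum.inr_injective (hcomm (Sum.inr v))
  obtain rfl := PartitionPair.eq_of_parts (parts_eq_of_comm h₁) (parts_eq_of_comm h₂)
  obtain ⟨g₁, rfl⟩ := exists_blockPerm_of_comm e₁ h₁
  obtain ⟨g₂, rfl⟩ := exists_blockPerm_of_comm e₂ h₂
  subst hf
  rw [sumGen_comp ζ P f' (g₁, g₂)]
  exact Submodule.smul_mem _ _ (Submodule.mem_span_singleton_self _)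

/-- The map from the sum of induced characters as an isomorphism of representations. -/
theorem nonempty_equiv (ζ : ∀ m : ℕ, rootsOfUnity m ℂ)
    (hζ : ∀ m, 0 < m → IsPrimitiveRoot (ζ m) m) {s : ℤ} (hs : IsCoprime s (r : ℤ)) :
    Nonempty (Representation.Equiv (twistedRep r n k l s)
      (Representation.directSum (fun P : PartitionPair r n k l => P.summand ζ))) := by
  have hb := fromSum_bijective (k := k) (l := l) ζ hζ hs labelCode (fun x => Dec.plain_code n _ _) deg_labelCode
    closed_labelCode (torChar_of_act_labelCode s) (sumGen_mem_span_of_labelCode_eq (k := k) ζ)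
  exact ⟨(Representation.Equiv.mk (LinearEquiv.ofBijective _ hb) fun w =>
    fromSum_comp (k := k) (l := l) (n := n) ζ s w).symm⟩

end LabelCode

end TwistedTorus

end

theorem mainTheorem3 (r n : ℕ) [NeZero r] (hn : 0 < n) (hrn : r ∣ n) (s : ℤ)
    (hs : IsCoprime s (r : ℤ)) (k l : ℕ)
    (ζ : ∀ m : ℕ, rootsOfUnity m ℂ) (hζ : ∀ m, 0 < m → IsPrimitiveRoot (ζ m) m) :
    Nonempty (Representation.Equiv
      ((TwistedTorus.charRep (TwistedTorus.signChar (Fin n))).tprod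
        (TwistedTorus.isotypicRep (TwistedTorus.repA r n k l) s))
      (Representation.directSum
        (fun P : TwistedTorus.PartitionPair r n k l => P.summand ζ))) :=
  TwistedTorus.nonempty_equiv ζ hζ hs
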